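/- Let $K$ be an algebraically closed field of characteristic $0$ and let $p,q$ be relatively prime integers with $1<p<q$. Let $R=K[\{A_{\nu\mu}\}_{\nu p+\mu q<pq}]$ ($\nu,\mu\ge 0$), let $$F=Y^p-X^q+\sum_{\nu p+\mu q<pq}A_{\nu\mu}X^\nu Y^\mu\in R[X,Y],$$ and put $A=R[X,Y]/(F,F_X,F_Y)$ and $N=R[X,Y]/(F_X,F_Y)$. Write $x,y$ for the residue classes of $X,Y$ in $N$. Let $\Delta\in R$ be the norm of multiplication by $F(x,y)$ on the $R$-module $N$. Let $\mathfrak q=\ker(R\to A)$, let $\mathcal H=V(\mathfrak q)\subset \operatorname{Spec}R$ be the corresponding closed subscheme $\operatorname{Spec}(R/\mathfrak q)$, let $\mathcal H_{pq}=\mathcal H\setminus V(\operatorname{Ann}_R\Omega^1_{A/R})$ be the set of points of $\mathcal H$ over which $A/R$ is unramified, and let $U_0=\emptyset$, $U_l=\mathcal H_{pq}\setminus V(F_l(A/R))$ for $l\ge1$, where $F_l(A/R)$ is the $l$-th Fitting ideal of the $R$-module $A$. For $l\ge 1$ let $\mathcal H^l_{pq}=U_l\setminus U_{l-1}$. For $a=(a_{\nu\mu})\in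 K^n$, where $n=\frac12(p+1)(q+1)-1$ is the number of indeterminates $A_{\nu\mu}$, let $C_a$ be the affine plane curve $F(a,X,Y)=0$; a node of $C_a$ is a singular point at which the Hesse determinant of $F(a,X,Y)$ does not vanish. (1) The monomials $x^\alpha y^\beta$ ($0\le\alpha<q-1$, $0\le\beta<p-1$) form an $R$-basis of $N$, and $\Delta=\det M$, where $M=(r^{\alpha\beta}_{\nu\mu})$ is given by $x^\alpha y^\beta F(x,y)=\sum_{\nu<q-1,\,\mu<p-1} r^{\alpha\beta}_{\nu\mu}x^\nu y^\mu$. (2) $\Delta$ is irreducible in $R$, and $\mathfrak q=(\Delta)$; that is, $\mathcal H$ is the hypersurface $V(\Delta)$. (3) $\mathcal H^1_{pq}$ is the set of all points of $\mathcal H_{pq}$ at which the local ring of $\mathcal H$ is regular. (4) For $l\ge 1$ and $a\in K^n$, the closed point $a$ of $\operatorname{Spec}R$ lies in $\mathcal H^l_{pq}$ if and only if all singular points of $C_a$ are nodes and there are exactly $l$ of them. (5) Let $l\ge1$ and let $a$ be a closed point of $\mathcal H^l_{pq}$. Embed $R$ in the completion $K[[\{T_{\nu\mu}\}]]$ of its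 local ring at $a$, where $T_{\nu\mu}=A_{\nu\mu}-a_{\nu\mu}$. The analytic branches of $\mathcal H$ at $a$ are the minimal primes of $\mathfrak q K[[\{T_{\nu\mu}\}]]$. There are exactly $l$ of them, and they correspond bijectively to the nodes of $C_a$ in the following way. For each node $P=(\xi,\eta)$ there is a power series $\Delta_P$ of order $1$ such that $P\mapsto(\Delta_P)$ is a bijection from the nodes to the branches; the ring $K[[\{T_{\nu\mu}\}]]/(\Delta_P)$ is a regular local ring, and the leading form of $\Delta_P$ is $$c_P\sum_{\nu p+\mu q<pq}\xi^\nu\eta^\mu T_{\nu\mu}\qquad\text{with } c_P\in K\setminus\{0\}.$$ So the tangent space of the branch $(\Delta_P)$ is the hyperplane $\sum\xi^\nu\eta^\mu T_{\nu\mu}=0$. Moreover $\Delta$ equals $\prod_P\Delta_P$ up to a unit of $K[[\{T_{\nu\mu}\}]]$. -/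

import Mathlib

noncomputable section

namespace CurvesPQ

/-- The exponents `(ν, μ) ∈ ℕ²` with `ν p + μ q < p q`. The bounds `ν < q`, `μ < p` follow from this
inequality, see `mem_exponents`. -/
def exponents (p q : ℕ) : Finset (ℕ × ℕ) :=
  (Finset.range q ×ˢ Finset.range p).filter fun i => i.1 * p + i.2 * q < p * q

theorem mem_exponents {p q : ℕ} {i : ℕ × ℕ} :
    i ∈ exponents p q ↔ i.1 * p + i.2 * q < p * q := by
  simp only [exponents, Finset.mem_filter, Finset.mem_product, Finset.mem_range,
    and_iff_right_iff_imp]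
  intro h
  refine ⟨?_, ?_⟩
  · by_contra hc
    have := Nat.mul_le_mul_right p (not_lt.mp hc)
    have := Nat.mul_comm p q
    omega
  · by_contra hc
    have := Nat.mul_le_mul_right q (not_lt.mp hc)
    omega

/-- The index type of the coefficients `a_{νμ}`. -/
abbrev Idx (p q : ℕ) : Type := {i : ℕ × ℕ // i ∈ exponents p q}

/-- The ring `R = K[{A_{νμ}}]`; its spectrum is the affine space of curves of type `p, q`. -/
abbrev CoeffRing (K : Type*) [Field K] (p q : ℕ) := MvPolynomial (Idx p q) K

/-- The ring `R[X, Y]`, with `X` the variable `0` and `Y` the variable `1`. -/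
abbrev PlaneRing (K : Type*) [Field K] (p q : ℕ) := MvPolynomial (Fin 2) (CoeffRing K p q)

/-- The generic normed Weierstraß polynomial `F = Y^p - X^q + ∑ A_{νμ} X^ν Y^μ`. -/
def genericF (K : Type*) [Field K] (p q : ℕ) : PlaneRing K p q :=
  MvPolynomial.X 1 ^ p - MvPolynomial.X 0 ^ q +
    ∑ i : Idx p q, MvPolynomial.C (MvPolynomial.X i) *
      MvPolynomial.X 0 ^ i.1.1 * MvPolynomial.X 1 ^ i.1.2

/-- The `R`-algebra `A = R[X, Y] / (F, F_X, F_Y)`. -/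
abbrev SingAlg (K : Type*) [Field K] (p q : ℕ) :=
  PlaneRing K p q ⧸ (Ideal.span {genericF K p q, MvPolynomial.pderiv 0 (genericF K p q),
    MvPolynomial.pderiv 1 (genericF K p q)} : Ideal (PlaneRing K p q))

/-- The `R`-algebra `N = R[X, Y] / (F_X, F_Y)`. -/
abbrev CritAlg (K : Type*) [Field K] (p q : ℕ) :=
  PlaneRing K p q ⧸ (Ideal.span {MvPolynomial.pderiv 0 (genericF K p q),
    MvPolynomial.pderiv 1 (genericF K p q)} : Ideal (PlaneRing K p q))

/-- The exponents `(α, β)` with `α < q - 1`, `β < p - 1`. -/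
abbrev BasisIdx (p q : ℕ) : Type := Fin (q - 1) × Fin (p - 1)

/-- The monomial `X^α Y^β` in `R[X, Y]`. -/
def basisMonomial (K : Type*) [Field K] (p q : ℕ) (i : BasisIdx p q) : PlaneRing K p q :=
  MvPolynomial.X 0 ^ (i.1 : ℕ) * MvPolynomial.X 1 ^ (i.2 : ℕ)

/-- The residue class `F(ξ, η)` of `F` in `N`. -/
def critF (K : Type*) [Field K] (p q : ℕ) : CritAlg K p q :=
  Ideal.Quotient.mk _ (genericF K p q)

/-- The matrix `M = (r^{αβ}_{νμ})` with respect to a basis `b` of `N`: its row `i` holds the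
coordinates of `b i * F(ξ, η)`. -/
def relationMatrix (K : Type*) [Field K] (p q : ℕ)
    (b : Module.Basis (BasisIdx p q) (CoeffRing K p q) (CritAlg K p q)) :
    Matrix (BasisIdx p q) (BasisIdx p q) (CoeffRing K p q) :=
  Matrix.of fun i j => b.repr (b i * critF K p q) j

/-- The discriminant `Δ`, the norm over `R` of multiplication by `F(ξ, η)` on `N`. -/
def disc (K : Type*) [Field K] (p q : ℕ) : CoeffRing K p q :=
  Algebra.norm (CoeffRing K p q) (critF K p q)

/-- The kernel of the structure map `R → A`, i.e. the ideal of `ℋ` in affine space. -/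
def hypersurfaceIdeal (K : Type*) [Field K] (p q : ℕ) : Ideal (CoeffRing K p q) :=
  RingHom.ker (algebraMap (CoeffRing K p q) (SingAlg K p q))

/-- The hypersurface `ℋ = Spec (R / ker (R → A))` as a closed subset of `Spec R`. -/
def hypersurface (K : Type*) [Field K] (p q : ℕ) : Set (PrimeSpectrum (CoeffRing K p q)) :=
  PrimeSpectrum.zeroLocus (hypersurfaceIdeal K p q : Set (CoeffRing K p q))

/-- The local ring of `ℋ` at a point `x`. -/
abbrev LocalRingAt (K : Type*) [Field K] (p q : ℕ) (x : PrimeSpectrum (CoeffRing K p q)) :=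
  Localization.AtPrime x.asIdeal ⧸ (hypersurfaceIdeal K p q).map
    (algebraMap (CoeffRing K p q) (Localization.AtPrime x.asIdeal))

/-- The `l`-th Fitting ideal of the module generated by the finite family `x`: it is generated by
the minors of size `(number of generators) - l` of the matrix of all relations. It does not depend
on the choice of the generators. -/
def fittingIdeal {R M ι : Type*} [CommRing R] [AddCommGroup M] [Module R M] [Fintype ι]
    (x : ι → M) (l : ℕ) : Ideal R :=
  Ideal.span {d | ∃ (v : Fin (Fintype.card ι - l) → ι → R) (g : Fin (Fintype.card ι - l) → ι),
    (∀ k, ∑ i, v k i • x i = 0) ∧ d = (Matrix.of fun k j => v k (g j)).det}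

/-- The Fitting ideal `F_l(A/R)`, computed from the generators `x^α y^β` (`α < q - 1`, `β < p - 1`)
of `A`. -/
def fittingA (K : Type*) [Field K] (p q l : ℕ) : Ideal (CoeffRing K p q) :=
  fittingIdeal (R := CoeffRing K p q) (M := SingAlg K p q)
    (fun i : BasisIdx p q => Ideal.Quotient.mk _ (basisMonomial K p q i)) l

/-- `ℋ_{pq}`: the points of `ℋ` over which `A/R` is unramified. -/
def nodalLocus (K : Type*) [Field K] (p q : ℕ) : Set (PrimeSpectrum (CoeffRing K p q)) :=
  hypersurface K p q \ PrimeSpectrum.zeroLocus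
    (Module.annihilator (CoeffRing K p q)
      (KaehlerDifferential (CoeffRing K p q) (SingAlg K p q)) : Set (CoeffRing K p q))

/-- `U_l`: empty for `l = 0`, and `ℋ_{pq} \ V(F_l(A/R))` for `l ≥ 1`. -/
def atMostLocus (K : Type*) [Field K] (p q : ℕ) : ℕ → Set (PrimeSpectrum (CoeffRing K p q))
  | 0 => ∅
  | l + 1 => nodalLocus K p q \
      PrimeSpectrum.zeroLocus (fittingA K p q (l + 1) : Set (CoeffRing K p q))

/-- `ℋ^l_{pq} = U_l \ U_{l-1}` for `l ≥ 1`. -/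
def exactLocus (K : Type*) [Field K] (p q l : ℕ) : Set (PrimeSpectrum (CoeffRing K p q)) :=
  atMostLocus K p q l \ atMostLocus K p q (l - 1)

/-- The closed point of `Spec R` given by `a ∈ K^n`. -/
def closedPoint (K : Type*) [Field K] (p q : ℕ) (a : Idx p q → K) :
    PrimeSpectrum (CoeffRing K p q) :=
  MvPolynomial.pointToPoint a

/-- The equation `F(a, X, Y)` of the curve `C_a`. -/
def curvePoly {K : Type*} [Field K] {p q : ℕ} (a : Idx p q → K) : MvPolynomial (Fin 2) K :=
  MvPolynomial.map (MvPolynomial.eval a) (genericF K p q)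

/-- The singular points of the plane curve `f = 0`. -/
def singularPoints {K : Type*} [Field K] (f : MvPolynomial (Fin 2) K) : Set (Fin 2 → K) :=
  {P | MvPolynomial.eval P f = 0 ∧ MvPolynomial.eval P (MvPolynomial.pderiv 0 f) = 0 ∧
    MvPolynomial.eval P (MvPolynomial.pderiv 1 f) = 0}

/-- The Hesse determinant `f_XX f_YY - f_XY²`. -/
def hessian {K : Type*} [Field K] (f : MvPolynomial (Fin 2) K) : MvPolynomial (Fin 2) K :=
  MvPolynomial.pderiv 0 (MvPolynomial.pderiv 0 f) * MvPolynomial.pderiv 1 (MvPolynomial.pderiv 1 f)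
    - MvPolynomial.pderiv 0 (MvPolynomial.pderiv 1 f) ^ 2

/-- The nodes of the plane curve `f = 0`. -/
def nodes {K : Type*} [Field K] (f : MvPolynomial (Fin 2) K) : Set (Fin 2 → K) :=
  {P | P ∈ singularPoints f ∧ MvPolynomial.eval P (hessian f) ≠ 0}

/-- The completion of the local ring of affine space at a closed point `a`: power series in the
variables `T_{νμ} = A_{νμ} - a_{νμ}`. -/
abbrev CompletedRing (K : Type*) [Field K] (p q : ℕ) := MvPowerSeries (Idx p q) K

/-- The canonical map from `R` to its completion at `a`, `A_{νμ} ↦ T_{νμ} + a_{νμ}`. -/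
def toCompletion {K : Type*} [Field K] {p q : ℕ} (a : Idx p q → K) :
    CoeffRing K p q →ₐ[K] CompletedRing K p q :=
  MvPolynomial.aeval fun i => MvPowerSeries.X i + MvPowerSeries.C (a i)

/-- The analytic branches of `ℋ` at `a`: the minimal primes of the ideal of `ℋ` in the
completion at `a`. -/
def branches {K : Type*} [Field K] {p q : ℕ} (a : Idx p q → K) :
    Set (Ideal (CompletedRing K p q)) :=
  ((hypersurfaceIdeal K p q).map (toCompletion a)).minimalPrimes

/-- The Zariski tangent space, inside `K^n`, of the formal germ with ideal `I`: the common zeros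
of the linear parts of the elements of `I`. -/
def tangentSpace {K : Type*} [Field K] {p q : ℕ} (I : Ideal (CompletedRing K p q)) :
    Set (Idx p q → K) :=
  {t | ∀ f ∈ I, ∑ i, MvPowerSeries.coeff (Finsupp.single i 1) f * t i = 0}

/-- The linear form `∑ ξ^ν η^μ T_{νμ}` of the point `P = (ξ, η)`. -/
def nodeForm {K : Type*} [Field K] (p q : ℕ) (P : Fin 2 → K) : CompletedRing K p q :=
  ∑ i : Idx p q, MvPowerSeries.C (P 0 ^ i.1.1 * P 1 ^ i.1.2) * MvPowerSeries.X i

end CurvesPQ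

end

noncomputable section

namespace CurvesPQ

open MvPolynomial

/-! Everything is read off from multiplication by `f` on the algebra of critical points. Over a ring
in which `p` and `q` are units, `f_X` and `f_Y` have leading terms `-qX^(q-1)` and `pY^(p-1)` for
the weight `νp + μq`, so `S[X,Y]/(f_X,f_Y)` is free on the reduced monomials
(`exists_basis_quotient`), compatibly with base change (`critMatrix_map`). Since `A = N/FN`, the
fibre of `A` at a point has dimension equal to the corank of the specialized matrix `M`
(`singDim_add_rank`). Hence `Δ` vanishes exactly on `ℋ`, and the Fitting ideals measure the fibre
length (`fittingA_le_ker_iff`). Adding `t` to the constant coefficient replaces `M` by `M + t`, so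
on such a line `Δ` is a characteristic polynomial. If the Hesse determinant is invertible on the
fibre, the eigenvalue `0` is semisimple and `Δ` vanishes on the line to order exactly the fibre
length (`rootMultiplicity_shiftConst`).

Irreducibility: subtracting from `F` its first-order Taylor polynomial at `(X,Y)` yields a
retraction of `R[X,Y]` with kernel `(F,F_X,F_Y)`, so `A` is a domain and `𝔮` is prime.
Differentiating the resulting parametrization of `ℋ` gives `r₁₀ = X r₀₀` and `r₀₁ = Y r₀₀` in `A`
for the partial derivatives of an equation `r` of `ℋ`. So the singular point of the generic singular
curve is rational over the function field of `ℋ`, the generic fibre has length one, and `Δ` vanishes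
to order one along `ℋ` (`pderiv_disc_notMem`). Every prime factor of `Δ` defines a subset of `ℋ`,
hence there is only one, with multiplicity one.

Regularity: `A/R` is unramified at a point if and only if the Hesse determinant is invertible on the
fibre (`not_annihilator_le_ker_iff`); over a closed point this says that all singularities are
nodes, and the length counts them. For length one `Δ` has a nonzero derivative; for larger length
`M` has corank at least two and `Δ` lies in the square of the maximal ideal
(`exists_mul_det_mem_sq`).

Branches: at a node, Hensel's lemma continues the critical point to power series in the
coefficients. The critical value is `Δ_P`; by Taylor expansion its linear part is the form of the
node, and it divides `Δ` (`exists_criticalValue`). These primes are pairwise non-associated, so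
their product divides `Δ`, and comparing orders along the constant coefficient shows that the
cofactor is a unit. -/

/-- A family that is unitriangular, up to units, with respect to a basis and a weight function is
again a basis. -/
theorem triangular_bijective {ι S M : Type*} [CommRing S] [AddCommGroup M] [Module S M]
    (b : Module.Basis ι S M) (wt : ι → ℕ) (e : ι → M) (u : ι → S) (hu : ∀ i, IsUnit (u i))
    (he : ∀ i j, b.repr (e i - u i • b i) j ≠ 0 → wt j < wt i) :
    Function.Bijective (b.constr S e) := by
  classical
  constructor
  · rw [injective_iff_map_eq_zero]
    intro f hf
    by_contra hne
    have hs : (b.repr f).support.Nonempty := by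
      rw [Finsupp.support_nonempty_iff]
      simpa using hne
    -- At an index of maximal weight in the support only the diagonal term contributes to the image,
    -- and it is a unit multiple of the coefficient.
    obtain ⟨i, hi, hmax⟩ := Finset.exists_max_image _ wt hs
    have h1 : b.constr S e f = (b.repr f).sum fun j c => c • e j := by
      rw [Module.Basis.constr_apply]
    have h2 : b.repr (b.constr S e f) i = b.repr f i * u i := by
      rw [h1, Finsupp.sum, map_sum, Finsupp.finsetSum_apply]
      rw [Finset.sum_eq_single i]
      · have : b.repr (e i - u i • b i) i = 0 := by
          by_contra h
          exact lt_irrefl _ (he i i h)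
        rw [map_smul, Finsupp.smul_apply, smul_eq_mul]
        rw [map_sub, Finsupp.sub_apply, map_smul, Finsupp.smul_apply, b.repr_self,
          Finsupp.single_eq_same, smul_eq_mul, mul_one, sub_eq_zero] at this
        rw [this]
      · intro j hj hji
        have : b.repr (e j - u j • b j) i = 0 := by
          by_contra h
          exact absurd (he j i h) (not_lt.mpr (hmax j hj))
        rw [map_sub, Finsupp.sub_apply, map_smul, Finsupp.smul_apply, b.repr_self,
          Finsupp.single_eq_of_ne (Ne.symm hji), smul_zero, sub_zero] at this
        rw [map_smul, Finsupp.smul_apply, this, smul_zero]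
      · intro h
        rw [Finsupp.notMem_support_iff.mp h]; simp
    rw [hf, map_zero, Finsupp.zero_apply] at h2
    have := (hu i).mul_left_eq_zero.mp h2.symm
    exact (Finsupp.mem_support_iff.mp hi) this
  -- Surjectivity goes by induction on the weight: `u i • b i` differs from `e i` by basis vectors
  -- of smaller weight.
  · have key : ∀ n : ℕ, ∀ i, wt i < n → b i ∈ LinearMap.range (b.constr S e) := by
      intro n
      induction n with
      | zero => intro i hi; exact absurd hi (Nat.not_lt_zero _)
      | succ n ih =>
        intro i hi
        have h1 : e i ∈ LinearMap.range (b.constr S e) := ⟨b i, by simp⟩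
        have h2 : e i - u i • b i ∈ LinearMap.range (b.constr S e) := by
          rw [← b.linearCombination_repr (e i - u i • b i), Finsupp.linearCombination_apply]
          refine Submodule.sum_mem _ fun j hj => Submodule.smul_mem _ _ (ih j ?_)
          have := he i j (Finsupp.mem_support_iff.mp hj)
          omega
        have h3 : u i • b i ∈ LinearMap.range (b.constr S e) := by
          have := Submodule.sub_mem _ h1 h2
          simpa using this
        obtain ⟨v, hv⟩ := hu i
        have := Submodule.smul_mem _ (↑v⁻¹ : S) h3
        rwa [smul_smul, ← hv, Units.inv_mul, one_smul] at this
    rw [← LinearMap.range_eq_top, eq_top_iff, ← b.span_eq, Submodule.span_le]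
    rintro _ ⟨i, rfl⟩
    exact key _ i (Nat.lt_succ_self _)

/-! ### Weights and leading terms in two variables -/

section Weight

/-- The weight `m₀ p + m₁ q` of a monomial `X^{m₀} Y^{m₁}`. -/
def monWeight (p q : ℕ) (m : Fin 2 →₀ ℕ) : ℕ := m 0 * p + m 1 * q

theorem monWeight_add (p q : ℕ) (m n : Fin 2 →₀ ℕ) :
    monWeight p q (m + n) = monWeight p q m + monWeight p q n := by
  simp only [monWeight, Finsupp.add_apply]; ring

variable {S : Type*} [CommRing S]

/-- The polynomials all of whose monomials have weight less than `d`. -/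
def weightLT (S : Type*) [CommRing S] (p q d : ℕ) : Submodule S (MvPolynomial (Fin 2) S) :=
  restrictSupport S {m | monWeight p q m < d}

theorem mem_weightLT {p q d : ℕ} {f : MvPolynomial (Fin 2) S} :
    f ∈ weightLT S p q d ↔ ∀ m, coeff m f ≠ 0 → monWeight p q m < d := by
  rw [weightLT, mem_restrictSupport_iff]
  constructor
  · intro h m hm
    exact h (by simpa using hm)
  · intro h m hm
    exact h m (by simpa using hm)

theorem weightLT_mono {p q d e : ℕ} (h : d ≤ e) : weightLT S p q d ≤ weightLT S p q e := by
  intro f hf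
  rw [mem_weightLT] at *
  intro m hm
  exact (hf m hm).trans_le h

/-- One factor is allowed weight equal to `d`, the other stays strictly below `e`; this is the form
needed when only one of two factors has lost its leading term. -/
theorem mul_mem_weightLT {p q d e : ℕ} {f g : MvPolynomial (Fin 2) S}
    (hf : f ∈ weightLT S p q (d + 1)) (hg : g ∈ weightLT S p q e) :
    f * g ∈ weightLT S p q (d + e) := by
  classical
  rw [mem_weightLT] at *
  intro m hm
  rw [coeff_mul] at hm
  obtain ⟨x, hx, hne⟩ := Finset.exists_ne_zero_of_sum_ne_zero hm
  have h1 := hf x.1 (left_ne_zero_of_mul hne)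
  have h2 := hg x.2 (right_ne_zero_of_mul hne)
  rw [← Finset.HasAntidiagonal.mem_antidiagonal.mp hx, monWeight_add]
  omega

theorem monomial_mem_weightLT {p q d : ℕ} {m : Fin 2 →₀ ℕ} {c : S} (h : monWeight p q m < d) :
    monomial m c ∈ weightLT S p q d := by
  classical
  rw [mem_weightLT]
  intro n hn
  rw [coeff_monomial] at hn
  split_ifs at hn with h'
  · rwa [← h']
  · exact absurd rfl hn

/-- `f` has the leading term `c X^m` with respect to the weight. -/
def HasLeadingTerm (p q : ℕ) (f : MvPolynomial (Fin 2) S) (m : Fin 2 →₀ ℕ) (c : S) : Prop :=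
  f - monomial m c ∈ weightLT S p q (monWeight p q m)

theorem HasLeadingTerm.mem {p q : ℕ} {f : MvPolynomial (Fin 2) S} {m : Fin 2 →₀ ℕ} {c : S}
    (h : HasLeadingTerm p q f m c) : f ∈ weightLT S p q (monWeight p q m + 1) := by
  have := Submodule.add_mem _ (weightLT_mono (Nat.le_succ _) h)
    (monomial_mem_weightLT (c := c) (Nat.lt_succ_self (monWeight p q m)))
  simpa using this

theorem HasLeadingTerm.mul {p q : ℕ} {f g : MvPolynomial (Fin 2) S} {m n : Fin 2 →₀ ℕ} {c d : S}
    (hf : HasLeadingTerm p q f m c) (hg : HasLeadingTerm p q g n d) :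
    HasLeadingTerm p q (f * g) (m + n) (c * d) := by
  have h : f * g - monomial (m + n) (c * d) =
      f * (g - monomial n d) + monomial n d * (f - monomial m c) := by
    rw [show (monomial (m + n)) (c * d) = monomial m c * monomial n d by simp [monomial_mul]]
    ring
  unfold HasLeadingTerm
  rw [h, monWeight_add]
  refine Submodule.add_mem _ (mul_mem_weightLT hf.mem hg) ?_
  rw [add_comm]
  exact mul_mem_weightLT (monomial_mem_weightLT (Nat.lt_succ_self _)) hf

theorem HasLeadingTerm.monomial {p q : ℕ} (m : Fin 2 →₀ ℕ) (c : S) :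
    HasLeadingTerm p q (monomial m c) m c := by
  simp [HasLeadingTerm]

theorem HasLeadingTerm.pow {p q : ℕ} {f : MvPolynomial (Fin 2) S} {m : Fin 2 →₀ ℕ} {c : S}
    (hf : HasLeadingTerm p q f m c) (k : ℕ) : HasLeadingTerm p q (f ^ k) (k • m) (c ^ k) := by
  induction k with
  | zero => simpa using HasLeadingTerm.monomial (p := p) (q := q) 0 (1 : S)
  | succ k ih =>
    rw [pow_succ, pow_succ, succ_nsmul]
    exact ih.mul hf

end Weight

/-! ### Quotients by two polynomials with pure-power leading terms -/

section TwoPolys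

variable {S : Type*} [CommRing S] (p q r s : ℕ) (g h : MvPolynomial (Fin 2) S)

/-- The product `X^{m₀ mod r} Y^{m₁ mod s} g^{m₀ / r} h^{m₁ / s}`. -/
def mixedPower (m : Fin 2 →₀ ℕ) : MvPolynomial (Fin 2) S :=
  X 0 ^ (m 0 % r) * X 1 ^ (m 1 % s) * g ^ (m 0 / r) * h ^ (m 1 / s)

variable {p q r s g h}

/-- Division with remainder of the exponents by `r` and `s` gives each mixed power the leading
monomial `X^m`, with unit coefficient, so the family is triangular with respect to the monomials. -/
theorem mixedPower_bijective {c d : S} (hc : IsUnit c) (hd : IsUnit d)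
    (hg : HasLeadingTerm p q g (Finsupp.single 0 r) c)
    (hh : HasLeadingTerm p q h (Finsupp.single 1 s) d) :
    Function.Bijective ((basisMonomials (Fin 2) S).constr S (mixedPower r s g h)) := by
  refine triangular_bijective _ (monWeight p q) _ (fun m => c ^ (m 0 / r) * d ^ (m 1 / s))
    (fun m => (hc.pow _).mul (hd.pow _)) ?_
  intro m n hn
  have key : HasLeadingTerm p q (mixedPower r s g h m) m (c ^ (m 0 / r) * d ^ (m 1 / s)) := by
    have h1 := ((HasLeadingTerm.monomial (p := p) (q := q)
      (Finsupp.single 0 (m 0 % r) + Finsupp.single 1 (m 1 % s)) (1 : S)).mul (hg.pow (m 0 / r))).mul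
        (hh.pow (m 1 / s))
    have e1 : (Finsupp.single 0 (m 0 % r) + Finsupp.single 1 (m 1 % s) +
        (m 0 / r) • Finsupp.single 0 r + (m 1 / s) • Finsupp.single 1 s : Fin 2 →₀ ℕ) = m := by
      ext i
      fin_cases i
      · simpa [mul_comm] using Nat.mod_add_div (m 0) r
      · simpa [mul_comm] using Nat.mod_add_div (m 1) s
    have e2 : (monomial (Finsupp.single 0 (m 0 % r) + Finsupp.single 1 (m 1 % s)) (1 : S)) =
        (X 0 ^ (m 0 % r) * X 1 ^ (m 1 % s) : MvPolynomial (Fin 2) S) := by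
      rw [X_pow_eq_monomial, X_pow_eq_monomial, monomial_mul, one_mul]
    rw [e1, e2, one_mul] at h1
    exact h1
  have := mem_weightLT.mp key n
  apply this
  have e3 : (basisMonomials (Fin 2) S).repr
      (mixedPower r s g h m - (c ^ (m 0 / r) * d ^ (m 1 / s)) • basisMonomials (Fin 2) S m) n =
      coeff n (mixedPower r s g h m - MvPolynomial.monomial m (c ^ (m 0 / r) * d ^ (m 1 / s))) := by
    rw [coe_basisMonomials, smul_monomial, smul_eq_mul, mul_one]
    rfl
  rwa [e3] at hn

/-- The basis of `S[X, Y]` given by the products `mixedPower`. -/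
def mixedBasis {c d : S} (hc : IsUnit c) (hd : IsUnit d)
    (hg : HasLeadingTerm p q g (Finsupp.single 0 r) c)
    (hh : HasLeadingTerm p q h (Finsupp.single 1 s) d) :
    Module.Basis (Fin 2 →₀ ℕ) S (MvPolynomial (Fin 2) S) :=
  (basisMonomials (Fin 2) S).map (LinearEquiv.ofBijective _ (mixedPower_bijective hc hd hg hh))

theorem mixedBasis_apply {c d : S} (hc : IsUnit c) (hd : IsUnit d)
    (hg : HasLeadingTerm p q g (Finsupp.single 0 r) c)
    (hh : HasLeadingTerm p q h (Finsupp.single 1 s) d) (m : Fin 2 →₀ ℕ) :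
    mixedBasis hc hd hg hh m = mixedPower r s g h m := by
  simp [mixedBasis, -coe_basisMonomials]

/-- The exponent vector `(i, j)`. -/
def expVec (i j : ℕ) : Fin 2 →₀ ℕ := Finsupp.single 0 i + Finsupp.single 1 j

@[simp] theorem expVec_zero (i j : ℕ) : expVec i j 0 = i := by simp [expVec]
@[simp] theorem expVec_one (i j : ℕ) : expVec i j 1 = j := by simp [expVec]

theorem expVec_eta (m : Fin 2 →₀ ℕ) : expVec (m 0) (m 1) = m := by
  ext i; fin_cases i <;> simp

theorem expVec_inj {i j k l : ℕ} (h : expVec i j = expVec k l) : i = k ∧ j = l :=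
  ⟨by simpa using DFunLike.congr_fun h 0, by simpa using DFunLike.congr_fun h 1⟩

/-- The classes of the reduced monomials form a basis of `S[X, Y] / (g, h)`. -/
theorem exists_basis_quotient (hr : 0 < r) (hs : 0 < s) {c d : S} (hc : IsUnit c) (hd : IsUnit d)
    (hg : HasLeadingTerm p q g (Finsupp.single 0 r) c)
    (hh : HasLeadingTerm p q h (Finsupp.single 1 s) d) :
    ∃ b : Module.Basis (Fin r × Fin s) S
        (MvPolynomial (Fin 2) S ⧸ (Ideal.span {g, h} : Ideal (MvPolynomial (Fin 2) S))),
      ∀ i, b i = Ideal.Quotient.mk _ (X 0 ^ (i.1 : ℕ) * X 1 ^ (i.2 : ℕ)) := by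
  classical
  set B := mixedBasis hc hd hg hh with hB
  have hBa : ∀ m, B m = mixedPower r s g h m := mixedBasis_apply hc hd hg hh
  have hred : ∀ i : Fin r × Fin s, B (expVec i.1 i.2) = X 0 ^ (i.1 : ℕ) * X 1 ^ (i.2 : ℕ) := by
    intro i
    rw [hBa, mixedPower]
    simp [Nat.mod_eq_of_lt i.1.2, Nat.mod_eq_of_lt i.2.2, Nat.div_eq_of_lt i.1.2,
      Nat.div_eq_of_lt i.2.2]
  -- the coordinates with respect to reduced monomials vanish on the ideal
  have hvan : ∀ f ∈ (Ideal.span {g, h} : Ideal (MvPolynomial (Fin 2) S)),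
      ∀ i : Fin r × Fin s, B.repr f (expVec i.1 i.2) = 0 := by
    intro f hf i
    obtain ⟨u, v, rfl⟩ := Ideal.mem_span_pair.mp hf
    have hgm : ∀ u : MvPolynomial (Fin 2) S, B.repr (u * g) (expVec i.1 i.2) = 0 := by
      intro u
      have : (Finsupp.lapply (expVec i.1 i.2) ∘ₗ B.repr.toLinearMap ∘ₗ
          LinearMap.mulRight S g) = 0 := by
        refine B.ext fun m => ?_
        -- Multiplication by `g` only shifts the first exponent by `r`, which leads out of the
        -- reduced range.
        have : B m * g = B (m + expVec r 0) := by
          rw [hBa, hBa, mixedPower, mixedPower]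
          simp [Nat.add_div_right _ hr, pow_succ]
          ring
        simp only [LinearMap.comp_apply, LinearMap.mulRight_apply, this, LinearEquiv.coe_coe,
          B.repr_self, Finsupp.lapply_apply, LinearMap.zero_apply]
        rw [Finsupp.single_eq_of_ne]
        intro he
        have h0 : (i.1 : ℕ) = m 0 + r := by simpa using DFunLike.congr_fun he 0
        have := i.1.2
        omega
      exact LinearMap.congr_fun this u
    have hhm : ∀ u : MvPolynomial (Fin 2) S, B.repr (u * h) (expVec i.1 i.2) = 0 := by
      intro u
      have : (Finsupp.lapply (expVec i.1 i.2) ∘ₗ B.repr.toLinearMap ∘ₗ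
          LinearMap.mulRight S h) = 0 := by
        refine B.ext fun m => ?_
        have : B m * h = B (m + expVec 0 s) := by
          rw [hBa, hBa, mixedPower, mixedPower]
          simp [Nat.add_div_right _ hs, pow_succ]
          ring
        simp only [LinearMap.comp_apply, LinearMap.mulRight_apply, this, LinearEquiv.coe_coe,
          B.repr_self, Finsupp.lapply_apply, LinearMap.zero_apply]
        rw [Finsupp.single_eq_of_ne]
        intro he
        have h0 : (i.2 : ℕ) = m 1 + s := by simpa using DFunLike.congr_fun he 1
        have := i.2.2
        omega
      exact LinearMap.congr_fun this u
    rw [map_add, Finsupp.add_apply, hgm, hhm, add_zero]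
  have hli : LinearIndependent S (fun i : Fin r × Fin s =>
      (Ideal.Quotient.mk (Ideal.span {g, h}) (X 0 ^ (i.1 : ℕ) * X 1 ^ (i.2 : ℕ)))) := by
    rw [Fintype.linearIndependent_iff]
    intro w hw i
    have h1 : ∑ j : Fin r × Fin s, w j • B (expVec j.1 j.2) ∈
        (Ideal.span {g, h} : Ideal (MvPolynomial (Fin 2) S)) := by
      rw [← Ideal.Quotient.eq_zero_iff_mem, ← hw, map_sum]
      refine Finset.sum_congr rfl fun j _ => ?_
      rw [hred]
      rfl
    have h2 := hvan _ h1 i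
    rw [map_sum, Finsupp.finsetSum_apply, Finset.sum_eq_single i] at h2
    · simpa using h2
    · intro j _ hji
      rw [map_smul, Finsupp.smul_apply, B.repr_self, Finsupp.single_eq_of_ne, smul_zero]
      intro he
      have := expVec_inj he
      exact hji (Prod.ext (Fin.ext this.1.symm) (Fin.ext this.2.symm))
    · intro h; exact absurd (Finset.mem_univ _) h
  have hsp : ⊤ ≤ Submodule.span S (Set.range (fun i : Fin r × Fin s =>
      (Ideal.Quotient.mk (Ideal.span {g, h}) (X 0 ^ (i.1 : ℕ) * X 1 ^ (i.2 : ℕ))))) := by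
    -- A mixed power that is not a reduced monomial contains `g` or `h` as a factor and dies in the
    -- quotient.
    have hall : ∀ m, Ideal.Quotient.mk (Ideal.span {g, h}) (B m) ∈
        Submodule.span S (Set.range (fun i : Fin r × Fin s =>
      (Ideal.Quotient.mk (Ideal.span {g, h}) (X 0 ^ (i.1 : ℕ) * X 1 ^ (i.2 : ℕ))))) := by
      intro m
      by_cases h0 : m 0 < r
      · by_cases h1 : m 1 < s
        · refine Submodule.subset_span ⟨(⟨m 0, h0⟩, ⟨m 1, h1⟩), ?_⟩
          simp only
          rw [← hred (⟨m 0, h0⟩, ⟨m 1, h1⟩)]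
          simp only [expVec_eta]
        · have : Ideal.Quotient.mk (Ideal.span {g, h}) (B m) = 0 := by
            rw [Ideal.Quotient.eq_zero_iff_mem, hBa, mixedPower]
            refine Ideal.mul_mem_left _ _ (Ideal.pow_mem_of_mem _ (Ideal.subset_span (by simp)) _ ?_)
            exact Nat.div_pos (not_lt.mp h1) hs
          rw [this]; exact Submodule.zero_mem _
      · have : Ideal.Quotient.mk (Ideal.span {g, h}) (B m) = 0 := by
          rw [Ideal.Quotient.eq_zero_iff_mem, hBa, mixedPower, mul_assoc, mul_comm (g ^ _),
            ← mul_assoc]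
          refine Ideal.mul_mem_left _ _ (Ideal.pow_mem_of_mem _ (Ideal.subset_span (by simp)) _ ?_)
          exact Nat.div_pos (not_lt.mp h0) hr
        rw [this]; exact Submodule.zero_mem _
    rintro x -
    obtain ⟨f, rfl⟩ := Ideal.Quotient.mk_surjective x
    rw [← B.linearCombination_repr f, Finsupp.linearCombination_apply, Finsupp.sum, map_sum]
    refine Submodule.sum_mem _ fun m _ => ?_
    exact Submodule.smul_mem _ (B.repr f m) (hall m)
  exact ⟨Module.Basis.mk hli hsp, fun i => Module.Basis.mk_apply hli hsp i⟩

end TwoPolys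

/-! ### Weierstraß polynomials over an arbitrary base ring -/

section Specialization

variable {S T : Type*} [CommRing S] [CommRing T] {p q : ℕ}

/-- The polynomial `Y^p - X^q + ∑ a_{νμ} X^ν Y^μ` with coefficients in a commutative ring. -/
def weierstrassPoly (a : Idx p q → S) : MvPolynomial (Fin 2) S :=
  X 1 ^ p - X 0 ^ q + ∑ i : Idx p q, C (a i) * X 0 ^ i.1.1 * X 1 ^ i.1.2

theorem genericF_eq (K : Type*) [Field K] (p q : ℕ) :
    genericF K p q = weierstrassPoly (fun i : Idx p q => (X i : CoeffRing K p q)) := rfl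

theorem map_weierstrassPoly (φ : S →+* T) (a : Idx p q → S) :
    map φ (weierstrassPoly a) = weierstrassPoly (fun i => φ (a i)) := by
  simp [weierstrassPoly]

theorem map_genericF {K : Type*} [Field K] (φ : CoeffRing K p q →+* T) :
    map φ (genericF K p q) = weierstrassPoly (fun i => φ (X i)) := by
  rw [genericF_eq, map_weierstrassPoly]

theorem curvePoly_eq {K : Type*} [Field K] (a : Idx p q → K) :
    curvePoly a = weierstrassPoly a := by
  rw [curvePoly, map_genericF]; simp

theorem pderiv_zero_weierstrassPoly (a : Idx p q → S) :
    pderiv 0 (weierstrassPoly a) = - (C (q : S) * X 0 ^ (q - 1)) +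
      ∑ i : Idx p q, C (a i * (i.1.1 : S)) * X 0 ^ (i.1.1 - 1) * X 1 ^ i.1.2 := by
  simp only [weierstrassPoly, map_add, map_sub, map_sum, pderiv_mul, pderiv_pow, pderiv_C,
    pderiv_X_self, pderiv_X_of_ne (show (1 : Fin 2) ≠ 0 by decide), map_mul, map_natCast]
  congr 1
  · ring
  · refine Finset.sum_congr rfl fun i _ => ?_
    ring

theorem pderiv_one_weierstrassPoly (a : Idx p q → S) :
    pderiv 1 (weierstrassPoly a) = C (p : S) * X 1 ^ (p - 1) +
      ∑ i : Idx p q, C (a i * (i.1.2 : S)) * X 0 ^ i.1.1 * X 1 ^ (i.1.2 - 1) := by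
  simp only [weierstrassPoly, map_add, map_sub, map_sum, pderiv_mul, pderiv_pow, pderiv_C,
    pderiv_X_self, pderiv_X_of_ne (show (0 : Fin 2) ≠ 1 by decide), map_mul, map_natCast]
  congr 1
  · ring
  · refine Finset.sum_congr rfl fun i _ => ?_
    ring

theorem monomial_expVec (i j : ℕ) (c : S) :
    monomial (expVec i j) c = C c * X 0 ^ i * X 1 ^ j := by
  rw [X_pow_eq_monomial, X_pow_eq_monomial, C_mul_monomial, monomial_mul, expVec, mul_one, mul_one]

/-- Differentiation with respect to `X` lowers the weight by `p`, so `νp + μq < pq` becomes `(ν-1)p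
+ μq < (q-1)p`, strictly below the leading term. -/
theorem hasLeadingTerm_pderiv_zero (hq : 0 < q) (a : Idx p q → S) :
    HasLeadingTerm p q (pderiv 0 (weierstrassPoly a)) (Finsupp.single 0 (q - 1)) (-(q : S)) := by
  have h1 : monomial (Finsupp.single 0 (q - 1)) (-(q : S)) =
      - (C (q : S) * X (0 : Fin 2) ^ (q - 1)) := by
    rw [X_pow_eq_monomial, C_mul_monomial, mul_one, map_neg]
  rw [HasLeadingTerm, h1, pderiv_zero_weierstrassPoly, add_sub_cancel_left]
  refine Submodule.sum_mem _ fun i _ => ?_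
  rw [← monomial_expVec]
  -- For `ν = 0` the truncated exponent `ν - 1` is meaningless, but the coefficient carries the
  -- factor `ν = 0`.
  rcases Nat.eq_zero_or_pos i.1.1 with h0 | h0
  · rw [h0]; simp
  · refine monomial_mem_weightLT ?_
    have hi := mem_exponents.mp i.2
    simp only [monWeight, expVec_zero, expVec_one, Finsupp.single_eq_same]
    rw [Finsupp.single_eq_of_ne (by decide)]
    obtain ⟨k, hk⟩ : ∃ k, i.1.1 = k + 1 := ⟨i.1.1 - 1, by omega⟩
    obtain ⟨n, hn⟩ : ∃ n, q = n + 1 := ⟨q - 1, by omega⟩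
    rw [hk] at hi ⊢
    subst hn
    simp only [Nat.add_sub_cancel]
    nlinarith

theorem hasLeadingTerm_pderiv_one (hp : 0 < p) (a : Idx p q → S) :
    HasLeadingTerm p q (pderiv 1 (weierstrassPoly a)) (Finsupp.single 1 (p - 1)) (p : S) := by
  have h1 : monomial (Finsupp.single 1 (p - 1)) (p : S) =
      C (p : S) * X (1 : Fin 2) ^ (p - 1) := by
    rw [X_pow_eq_monomial, C_mul_monomial, mul_one]
  rw [HasLeadingTerm, h1, pderiv_one_weierstrassPoly, add_sub_cancel_left]
  refine Submodule.sum_mem _ fun i _ => ?_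
  rw [← monomial_expVec]
  rcases Nat.eq_zero_or_pos i.1.2 with h0 | h0
  · rw [h0]; simp
  · refine monomial_mem_weightLT ?_
    have hi := mem_exponents.mp i.2
    simp only [monWeight, expVec_zero, expVec_one, Finsupp.single_eq_same]
    rw [Finsupp.single_eq_of_ne (by decide)]
    obtain ⟨k, hk⟩ : ∃ k, i.1.2 = k + 1 := ⟨i.1.2 - 1, by omega⟩
    obtain ⟨n, hn⟩ : ∃ n, p = n + 1 := ⟨p - 1, by omega⟩
    rw [hk] at hi ⊢
    subst hn
    simp only [Nat.add_sub_cancel]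
    nlinarith

/-- The ideal `(f_X, f_Y)`. -/
abbrev critIdeal (f : MvPolynomial (Fin 2) S) : Ideal (MvPolynomial (Fin 2) S) :=
  Ideal.span {pderiv 0 f, pderiv 1 f}

/-- The ideal `(f, f_X, f_Y)`. -/
abbrev singIdeal (f : MvPolynomial (Fin 2) S) : Ideal (MvPolynomial (Fin 2) S) :=
  Ideal.span {f, pderiv 0 f, pderiv 1 f}

theorem exists_critBasis (hp : 1 < p) (hq : 1 < q) (hpS : IsUnit (p : S)) (hqS : IsUnit (q : S))
    (a : Idx p q → S) :
    ∃ b : Module.Basis (BasisIdx p q) S (MvPolynomial (Fin 2) S ⧸ critIdeal (weierstrassPoly a)),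
      ∀ i, b i = Ideal.Quotient.mk _ (X 0 ^ (i.1 : ℕ) * X 1 ^ (i.2 : ℕ)) :=
  exists_basis_quotient (by omega) (by omega) hqS.neg hpS
    (hasLeadingTerm_pderiv_zero (by omega) a) (hasLeadingTerm_pderiv_one (by omega) a)

/-- The monomial basis of `S[X, Y] / (f_X, f_Y)`. -/
def critBasis (hp : 1 < p) (hq : 1 < q) (hpS : IsUnit (p : S)) (hqS : IsUnit (q : S))
    (a : Idx p q → S) :
    Module.Basis (BasisIdx p q) S (MvPolynomial (Fin 2) S ⧸ critIdeal (weierstrassPoly a)) :=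
  (exists_critBasis hp hq hpS hqS a).choose

theorem critBasis_apply (hp : 1 < p) (hq : 1 < q) (hpS : IsUnit (p : S)) (hqS : IsUnit (q : S))
    (a : Idx p q → S) (i : BasisIdx p q) :
    critBasis hp hq hpS hqS a i = Ideal.Quotient.mk _ (X 0 ^ (i.1 : ℕ) * X 1 ^ (i.2 : ℕ)) :=
  (exists_critBasis hp hq hpS hqS a).choose_spec i

theorem map_mem_critIdeal (φ : S →+* T) {f g : MvPolynomial (Fin 2) S} (hg : g ∈ critIdeal f) :
    map φ g ∈ critIdeal (map φ f) := by
  obtain ⟨u, v, rfl⟩ := Ideal.mem_span_pair.mp hg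
  refine Ideal.mem_span_pair.mpr ⟨map φ u, map φ v, ?_⟩
  rw [pderiv_map, pderiv_map, map_add, map_mul, map_mul]

theorem map_mem_singIdeal (φ : S →+* T) {f g : MvPolynomial (Fin 2) S} (hg : g ∈ singIdeal f) :
    map φ g ∈ singIdeal (map φ f) := by
  have := Ideal.mem_map_of_mem (map φ) hg
  rw [Ideal.map_span] at this
  convert this using 2
  simp only [Set.image_insert_eq, Set.image_singleton, pderiv_map]

theorem smul_mk_eq (I : Ideal (MvPolynomial (Fin 2) S)) (c : S) (g : MvPolynomial (Fin 2) S) :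
    c • Ideal.Quotient.mk I g = Ideal.Quotient.mk I (C c) * Ideal.Quotient.mk I g := by
  rw [← map_mul, ← smul_eq_C_mul]
  rfl

/-- The matrix of multiplication by `f` on `S[X, Y] / (f_X, f_Y)`; row `i` holds the coordinates of
the product of `f` with the `i`-th basis monomial. -/
def critMatrix (hp : 1 < p) (hq : 1 < q) (hpS : IsUnit (p : S)) (hqS : IsUnit (q : S))
    (a : Idx p q → S) : Matrix (BasisIdx p q) (BasisIdx p q) S :=
  Matrix.of fun i j => (critBasis hp hq hpS hqS a).repr
    (critBasis hp hq hpS hqS a i * Ideal.Quotient.mk _ (weierstrassPoly a)) j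

theorem critMatrix_mem (hp : 1 < p) (hq : 1 < q) (hpS : IsUnit (p : S)) (hqS : IsUnit (q : S))
    (a : Idx p q → S) (i : BasisIdx p q) :
    X 0 ^ (i.1 : ℕ) * X 1 ^ (i.2 : ℕ) * weierstrassPoly a -
      ∑ k : BasisIdx p q, C (critMatrix hp hq hpS hqS a i k) * (X 0 ^ (k.1 : ℕ) * X 1 ^ (k.2 : ℕ)) ∈
      critIdeal (weierstrassPoly a) := by
  set bS := critBasis hp hq hpS hqS a with hbS
  have h1 : bS i * Ideal.Quotient.mk _ (weierstrassPoly a) =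
      ∑ k, critMatrix hp hq hpS hqS a i k • bS k := by
    conv_lhs => rw [← bS.sum_repr (bS i * Ideal.Quotient.mk _ (weierstrassPoly a))]
    rfl
  rw [← Ideal.Quotient.eq_zero_iff_mem, map_sub, map_mul, map_sum, sub_eq_zero,
    ← critBasis_apply hp hq hpS hqS a, h1]
  refine Finset.sum_congr rfl fun k _ => ?_
  rw [map_mul, hbS, critBasis_apply hp hq hpS hqS a, smul_mk_eq]

theorem critMatrix_eq_of_mem (hp : 1 < p) (hq : 1 < q) (hpS : IsUnit (p : S)) (hqS : IsUnit (q : S))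
    {a : Idx p q → S} {M : Matrix (BasisIdx p q) (BasisIdx p q) S}
    (hM : ∀ i : BasisIdx p q, X 0 ^ (i.1 : ℕ) * X 1 ^ (i.2 : ℕ) * weierstrassPoly a -
      ∑ k : BasisIdx p q, C (M i k) * (X 0 ^ (k.1 : ℕ) * X 1 ^ (k.2 : ℕ)) ∈
      critIdeal (weierstrassPoly a)) :
    critMatrix hp hq hpS hqS a = M := by
  ext i j
  set b := critBasis hp hq hpS hqS a with hb
  have h5 : b i * Ideal.Quotient.mk _ (weierstrassPoly a) = ∑ k, M i k • b k := by
    have h4 := hM i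
    rw [← Ideal.Quotient.eq_zero_iff_mem] at h4
    rw [← sub_eq_zero, ← h4, hb]
    simp only [critBasis_apply, smul_mk_eq]
    simp only [map_mul, map_pow, map_sub, map_sum]
  change b.repr (b i * Ideal.Quotient.mk _ (weierstrassPoly a)) j = _
  rw [h5, map_sum, Finsupp.finsetSum_apply, Finset.sum_eq_single j]
  · simp
  · intro k _ hk
    rw [map_smul, Finsupp.smul_apply, b.repr_self, Finsupp.single_eq_of_ne (Ne.symm hk), smul_zero]
  · intro h; exact absurd (Finset.mem_univ _) h

/-- The relations that reduce a product to basis monomials specialize term by term, and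
`critMatrix_eq_of_mem` says that such relations determine the matrix. This lets `Δ` be evaluated at
closed points, at generic points and along lines. -/
theorem critMatrix_map (φ : S →+* T) (hp : 1 < p) (hq : 1 < q) (hpS : IsUnit (p : S))
    (hqS : IsUnit (q : S)) (hpT : IsUnit (p : T)) (hqT : IsUnit (q : T)) (a : Idx p q → S) :
    critMatrix hp hq hpT hqT (fun i => φ (a i)) = (critMatrix hp hq hpS hqS a).map φ := by
  refine critMatrix_eq_of_mem hp hq hpT hqT fun i => ?_
  have h4 := map_mem_critIdeal φ (critMatrix_mem hp hq hpS hqS a i)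
  rw [map_weierstrassPoly] at h4
  simpa only [map_sub, map_mul, map_sum, map_pow, map_X, map_C, map_weierstrassPoly,
    Matrix.map_apply] using h4

/-- The discriminant of the specialization is the norm of multiplication by `f`. -/
theorem det_critMatrix (hp : 1 < p) (hq : 1 < q) (hpS : IsUnit (p : S)) (hqS : IsUnit (q : S))
    (a : Idx p q → S) :
    (critMatrix hp hq hpS hqS a).det =
      Algebra.norm S (Ideal.Quotient.mk (critIdeal (weierstrassPoly a)) (weierstrassPoly a)) := by
  rw [Algebra.norm_eq_matrix_det (critBasis hp hq hpS hqS a), ← Matrix.det_transpose]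
  congr 1
  ext i j
  rw [Matrix.transpose_apply, Algebra.leftMulMatrix_eq_repr_mul, critMatrix, Matrix.of_apply,
    mul_comm]

end Specialization

/-! ### The generic discriminant as a determinant -/

section Generic

variable (K : Type*) [Field K] [CharZero K] {p q : ℕ}

theorem isUnit_natCast_of_algebra {S : Type*} [CommRing S] [Algebra K S] {n : ℕ} (hn : 0 < n) :
    IsUnit (n : S) := by
  have : IsUnit (n : K) := by
    rw [isUnit_iff_ne_zero]; exact_mod_cast hn.ne'
  simpa using this.map (algebraMap K S)

/-- The generic matrix of multiplication by `F`. -/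
def genericMatrix (hp : 1 < p) (hq : 1 < q) :
    Matrix (BasisIdx p q) (BasisIdx p q) (CoeffRing K p q) :=
  critMatrix hp hq (isUnit_natCast_of_algebra K (by omega)) (isUnit_natCast_of_algebra K (by omega))
    (fun i : Idx p q => (X i : CoeffRing K p q))

theorem disc_eq_det (hp : 1 < p) (hq : 1 < q) : disc K p q = (genericMatrix K hp hq).det := by
  rw [genericMatrix, det_critMatrix]
  rfl

theorem map_disc {T : Type*} [CommRing T] (φ : CoeffRing K p q →+* T) (hp : 1 < p) (hq : 1 < q)
    (hpT : IsUnit (p : T)) (hqT : IsUnit (q : T)) :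
    φ (disc K p q) = (critMatrix hp hq hpT hqT (fun i => φ (X i))).det := by
  rw [disc_eq_det K hp hq, genericMatrix, critMatrix_map φ, RingHom.map_det]
  rfl

theorem exists_basis_critAlg (hp : 1 < p) (hq : 1 < q) :
    ∃ b : Module.Basis (BasisIdx p q) (CoeffRing K p q) (CritAlg K p q),
      (∀ i, b i = Ideal.Quotient.mk _ (basisMonomial K p q i)) ∧
      disc K p q = (relationMatrix K p q b).det :=
  ⟨critBasis hp hq (isUnit_natCast_of_algebra K (by omega)) (isUnit_natCast_of_algebra K (by omega))
    (fun i : Idx p q => (X i : CoeffRing K p q)), fun i => critBasis_apply _ _ _ _ _ i,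
    disc_eq_det K hp hq⟩

end Generic

/-! ### Hesse determinant, differentials and reducedness -/

section Unramified

variable {k : Type*} [Field k]

theorem derivation_mvPolynomial_fin_two {S A : Type*} [CommRing S] [AddCommGroup A] [Module S A]
    [Module (MvPolynomial (Fin 2) S) A]
    (D : Derivation S (MvPolynomial (Fin 2) S) A) (f : MvPolynomial (Fin 2) S) :
    D f = pderiv 0 f • D (X 0) + pderiv 1 f • D (X 1) := by
  induction f using MvPolynomial.induction_on with
  | C c => simp
  | add f g hf hg => rw [map_add, hf, hg, map_add, map_add]; module
  | mul_X f i hf =>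
    rw [D.leibniz, hf, pderiv_mul, pderiv_mul]
    fin_cases i
    · simp only [Fin.zero_eta, pderiv_X_self, pderiv_X_of_ne (show (0 : Fin 2) ≠ 1 by decide)]
      module
    · simp only [Fin.mk_one, pderiv_X_self, pderiv_X_of_ne (show (1 : Fin 2) ≠ 0 by decide)]
      module

/-- The commutator of two derivations is a derivation, and this one kills the variables. -/
theorem pderiv_comm {S : Type*} [CommRing S] (f : MvPolynomial (Fin 2) S) :
    pderiv 1 (pderiv 0 f) = pderiv 0 (pderiv 1 f) := by
  have h : ⁅(pderiv 1 : Derivation S (MvPolynomial (Fin 2) S) (MvPolynomial (Fin 2) S)),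
      (pderiv 0 : Derivation S (MvPolynomial (Fin 2) S) (MvPolynomial (Fin 2) S))⁆ = 0 := by
    refine derivation_ext fun i => ?_
    rw [Derivation.commutator_apply]
    fin_cases i <;> simp [pderiv_X]
  have := DFunLike.congr_fun h f
  rwa [Derivation.commutator_apply, Derivation.zero_apply, sub_eq_zero] at this

/-- The Hesse determinant over a commutative ring. -/
def hesse {S : Type*} [CommRing S] (f : MvPolynomial (Fin 2) S) : MvPolynomial (Fin 2) S :=
  pderiv 0 (pderiv 0 f) * pderiv 1 (pderiv 1 f) - pderiv 0 (pderiv 1 f) ^ 2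

theorem hessian_eq_hesse {k : Type*} [Field k] (f : MvPolynomial (Fin 2) k) :
    hessian f = hesse f := rfl

theorem map_hesse {S T : Type*} [CommRing S] [CommRing T] (φ : S →+* T)
    (f : MvPolynomial (Fin 2) S) : map φ (hesse f) = hesse (map φ f) := by
  simp [hesse, pderiv_map]

/-- The Hesse determinant of `f` annihilates the differentials of a quotient of `S[X, Y]` in which
`f_X` and `f_Y` vanish. -/
theorem hesse_smul_kaehler {S : Type*} [CommRing S] (f : MvPolynomial (Fin 2) S)
    (I : Ideal (MvPolynomial (Fin 2) S)) (h0 : pderiv 0 f ∈ I) (h1 : pderiv 1 f ∈ I)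
    (ω : Ω[(MvPolynomial (Fin 2) S ⧸ I)⁄S]) : Ideal.Quotient.mk I (hesse f) • ω = 0 := by
  let Q := MvPolynomial (Fin 2) S ⧸ I
  let d := KaehlerDifferential.D S Q
  let D : Derivation S (MvPolynomial (Fin 2) S) (Ω[Q⁄S]) := d.compAlgebraMap _
  have hD : ∀ g, D g = d (Ideal.Quotient.mk I g) := fun g => rfl
  have hs : ∀ (g : MvPolynomial (Fin 2) S) (w : Ω[Q⁄S]),
      g • w = (Ideal.Quotient.mk I g) • w := fun g w => rfl
  have hI : ∀ g ∈ I, D g = 0 := fun g hg => by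
    rw [hD, Ideal.Quotient.eq_zero_iff_mem.mpr hg, map_zero]
  have e0 := hI _ h0
  have e1 := hI _ h1
  rw [derivation_mvPolynomial_fin_two] at e0 e1
  rw [pderiv_comm] at e0
  -- Cramer's rule: `d f_X = 0` and `d f_Y = 0` form a linear system in `dX`, `dY` whose matrix is
  -- the Hesse matrix.
  have hx : hesse f • D (X 0) = 0 := by
    have : hesse f • D (X 0) = pderiv 1 (pderiv 1 f) •
        (pderiv 0 (pderiv 0 f) • D (X 0) + pderiv 0 (pderiv 1 f) • D (X 1)) -
        pderiv 0 (pderiv 1 f) •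
        (pderiv 0 (pderiv 1 f) • D (X 0) + pderiv 1 (pderiv 1 f) • D (X 1)) := by
      rw [hesse]; module
    rw [this, e0, e1]; simp
  have hy : hesse f • D (X 1) = 0 := by
    have : hesse f • D (X 1) = pderiv 0 (pderiv 0 f) •
        (pderiv 0 (pderiv 1 f) • D (X 0) + pderiv 1 (pderiv 1 f) • D (X 1)) -
        pderiv 0 (pderiv 1 f) •
        (pderiv 0 (pderiv 0 f) • D (X 0) + pderiv 0 (pderiv 1 f) • D (X 1)) := by
      rw [hesse]; module
    rw [this, e0, e1]; simp
  have hle : Submodule.span Q (Set.range d) ≤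
      LinearMap.ker (LinearMap.lsmul Q (Ω[Q⁄S]) (Ideal.Quotient.mk I (hesse f))) := by
    rw [Submodule.span_le]
    rintro _ ⟨g, rfl⟩
    obtain ⟨g, rfl⟩ := Ideal.Quotient.mk_surjective g
    change hesse f • D g = 0
    rw [derivation_mvPolynomial_fin_two, smul_add, smul_comm (hesse f), hx,
      smul_comm (hesse f), hy, smul_zero, smul_zero, add_zero]
  rw [KaehlerDifferential.span_range_derivation] at hle
  exact hle (Submodule.mem_top (x := ω))

/-- A quotient of `k[X, Y]` by an ideal containing `f_X` and `f_Y` in which the Hesse determinant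
is invertible is reduced. -/
theorem isReduced_of_hessian_isUnit (f : MvPolynomial (Fin 2) k)
    (I : Ideal (MvPolynomial (Fin 2) k)) (h0 : pderiv 0 f ∈ I) (h1 : pderiv 1 f ∈ I)
    {u : MvPolynomial (Fin 2) k} (hu : u * hessian f - 1 ∈ I) :
    IsReduced (MvPolynomial (Fin 2) k ⧸ I) := by
  let Q := MvPolynomial (Fin 2) k ⧸ I
  have hu1 : Ideal.Quotient.mk I u * Ideal.Quotient.mk I (hesse f) = 1 := by
    rw [← map_one (Ideal.Quotient.mk I), ← map_mul, ← sub_eq_zero, ← map_sub]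
    exact Ideal.Quotient.eq_zero_iff_mem.mpr hu
  -- An invertible element kills all differentials, so the algebra is formally unramified over a
  -- field and therefore reduced.
  have hsub : Subsingleton (Ω[Q⁄k]) := by
    refine subsingleton_of_forall_eq 0 fun ω => ?_
    rw [← one_smul Q ω, ← hu1, mul_smul, hesse_smul_kaehler f I h0 h1, smul_zero]
  have : Algebra.FormallyUnramified k Q := ⟨hsub⟩
  exact Algebra.FormallyUnramified.isReduced_of_field k Q

/-- If the Hesse determinant is invertible modulo `(f, f_X, f_Y)`, then `f` lies in
`(f², f_X, f_Y)`. -/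
theorem exists_sub_mul_sq_mem_critIdeal {f : MvPolynomial (Fin 2) k}
    {u : MvPolynomial (Fin 2) k} (hu : u * hessian f - 1 ∈ singIdeal f) :
    ∃ g, f - g * f ^ 2 ∈ critIdeal f := by
  obtain ⟨α, v, hv, huv⟩ := Ideal.mem_span_insert.mp hu
  set I : Ideal (MvPolynomial (Fin 2) k) := Ideal.span {f ^ 2, pderiv 0 f, pderiv 1 f} with hI
  have hc : critIdeal f ≤ I := Ideal.span_mono (by intro x hx; right; exact hx)
  have hf2 : f ^ 2 ∈ I := Ideal.subset_span (by simp)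
  have hred : IsReduced (MvPolynomial (Fin 2) k ⧸ I) := by
    -- Newton's correction `2u - u²H` of the inverse: it makes the error `-(1 - uH)²`, and since `1
    -- - uH` is a multiple of `f` modulo `(f_X, f_Y)`, the error lies in `(f², f_X, f_Y)`.
    refine isReduced_of_hessian_isUnit f I (hc (Ideal.subset_span (by simp)))
      (hc (Ideal.subset_span (by simp))) (u := 2 * u - u ^ 2 * hessian f) ?_
    have : (2 * u - u ^ 2 * hessian f) * hessian f - 1 =
        (- α ^ 2) * f ^ 2 - (2 * α * f + v) * v := by
      have : u * hessian f = 1 + (α * f + v) := by rw [← huv]; ring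
      linear_combination (-u * hessian f + 1 - (α * f + v)) * this
    rw [this]
    exact Ideal.sub_mem _ (Ideal.mul_mem_left _ _ hf2) (Ideal.mul_mem_left _ _ (hc hv))
  have hmem : f ∈ I := by
    rw [← Ideal.Quotient.eq_zero_iff_mem]
    have : IsNilpotent (Ideal.Quotient.mk I f) := ⟨2, by
      rw [← map_pow, Ideal.Quotient.eq_zero_iff_mem]; exact hf2⟩
    exact this.eq_zero
  obtain ⟨g, w, hw, hgw⟩ := Ideal.mem_span_insert.mp hmem
  have e : f - g * f ^ 2 = w := by linear_combination hgw
  exact ⟨g, e ▸ hw⟩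

end Unramified

/-! ### Fibre dimension and order of vanishing over a field -/

section Field

variable {k : Type*} [Field k] {p q : ℕ}

/-- `dim_k k[X, Y] / (f, f_X, f_Y)`. -/
def singDim (f : MvPolynomial (Fin 2) k) : ℕ :=
  Module.finrank k (MvPolynomial (Fin 2) k ⧸ singIdeal f)

theorem critIdeal_le_singIdeal {S : Type*} [CommRing S] (f : MvPolynomial (Fin 2) S) :
    critIdeal f ≤ singIdeal f :=
  Ideal.span_mono (by intro x hx; right; exact hx)

/-- The projection `k[X, Y] / (f_X, f_Y) → k[X, Y] / (f, f_X, f_Y)`. -/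
def critToSing {S : Type*} [CommRing S] (f : MvPolynomial (Fin 2) S) :
    (MvPolynomial (Fin 2) S ⧸ critIdeal f) →ₐ[S] (MvPolynomial (Fin 2) S ⧸ singIdeal f) :=
  Ideal.Quotient.factorₐ S (critIdeal_le_singIdeal f)

theorem critToSing_surjective {S : Type*} [CommRing S] (f : MvPolynomial (Fin 2) S) :
    Function.Surjective (critToSing f) :=
  Ideal.Quotient.factor_surjective (critIdeal_le_singIdeal f)

theorem critToSing_mk {S : Type*} [CommRing S] (f g : MvPolynomial (Fin 2) S) :
    critToSing f (Ideal.Quotient.mk _ g) = Ideal.Quotient.mk _ g := rfl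

theorem ker_critToSing {S : Type*} [CommRing S] (f : MvPolynomial (Fin 2) S) :
    LinearMap.ker (critToSing f).toLinearMap =
      LinearMap.range (LinearMap.mulLeft S (Ideal.Quotient.mk (critIdeal f) f)) := by
  ext x
  obtain ⟨g, rfl⟩ := Ideal.Quotient.mk_surjective x
  rw [LinearMap.mem_ker, AlgHom.toLinearMap_apply, critToSing_mk, Ideal.Quotient.eq_zero_iff_mem,
    Ideal.mem_span_insert]
  constructor
  · rintro ⟨α, v, hv, rfl⟩
    refine ⟨Ideal.Quotient.mk _ α, ?_⟩
    rw [LinearMap.mulLeft_apply, map_add, Ideal.Quotient.eq_zero_iff_mem.mpr hv, map_mul, mul_comm,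
      add_zero]
  · rintro ⟨y, hy⟩
    obtain ⟨α, rfl⟩ := Ideal.Quotient.mk_surjective y
    refine ⟨α, g - α * f, ?_, by ring⟩
    rw [LinearMap.mulLeft_apply, ← map_mul, eq_comm, ← sub_eq_zero, ← map_sub,
      Ideal.Quotient.eq_zero_iff_mem] at hy
    rwa [mul_comm α]

theorem finrank_crit (hp : 1 < p) (hq : 1 < q) (hpS : IsUnit (p : k)) (hqS : IsUnit (q : k))
    (a : Idx p q → k) :
    Module.finrank k (MvPolynomial (Fin 2) k ⧸ critIdeal (weierstrassPoly a)) =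
      Fintype.card (BasisIdx p q) :=
  Module.finrank_eq_card_basis (critBasis hp hq hpS hqS a)

theorem finite_crit (hp : 1 < p) (hq : 1 < q) {S : Type*} [CommRing S] (hpS : IsUnit (p : S))
    (hqS : IsUnit (q : S)) (a : Idx p q → S) :
    Module.Finite S (MvPolynomial (Fin 2) S ⧸ critIdeal (weierstrassPoly a)) :=
  Module.Finite.of_basis (critBasis hp hq hpS hqS a)

theorem finite_sing (hp : 1 < p) (hq : 1 < q) {S : Type*} [CommRing S] (hpS : IsUnit (p : S))
    (hqS : IsUnit (q : S)) (a : Idx p q → S) :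
    Module.Finite S (MvPolynomial (Fin 2) S ⧸ singIdeal (weierstrassPoly a)) :=
  have := finite_crit hp hq hpS hqS a
  Module.Finite.of_surjective (critToSing (weierstrassPoly a)).toLinearMap
    (critToSing_surjective _)

theorem leftMulMatrix_critBasis {S : Type*} [CommRing S] (hp : 1 < p) (hq : 1 < q)
    (hpS : IsUnit (p : S)) (hqS : IsUnit (q : S)) (a : Idx p q → S) :
    Algebra.leftMulMatrix (critBasis hp hq hpS hqS a)
      (Ideal.Quotient.mk (critIdeal (weierstrassPoly a)) (weierstrassPoly a)) =
      (critMatrix hp hq hpS hqS a).transpose := by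
  ext i j
  rw [Matrix.transpose_apply, Algebra.leftMulMatrix_eq_repr_mul, critMatrix, Matrix.of_apply,
    mul_comm]

theorem finrank_range_mulLeft (hp : 1 < p) (hq : 1 < q) (hpS : IsUnit (p : k))
    (hqS : IsUnit (q : k)) (a : Idx p q → k) :
    Module.finrank k (LinearMap.range (LinearMap.mulLeft k
      (Ideal.Quotient.mk (critIdeal (weierstrassPoly a)) (weierstrassPoly a)))) =
      (critMatrix hp hq hpS hqS a).rank := by
  rw [← Matrix.rank_transpose, ← leftMulMatrix_critBasis, Algebra.leftMulMatrix_apply,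
    Matrix.rank_eq_finrank_range_toLin _ (critBasis hp hq hpS hqS a) (critBasis hp hq hpS hqS a),
    Matrix.toLin_toMatrix]
  rfl

/-- The fibre of `A` is the cokernel of multiplication by `f` on the algebra of critical points, so
this is rank–nullity. -/
theorem singDim_add_rank (hp : 1 < p) (hq : 1 < q) (hpS : IsUnit (p : k)) (hqS : IsUnit (q : k))
    (a : Idx p q → k) :
    singDim (weierstrassPoly a) + (critMatrix hp hq hpS hqS a).rank =
      Fintype.card (BasisIdx p q) := by
  have := finite_crit hp hq hpS hqS a
  have h := LinearMap.finrank_range_add_finrank_ker (critToSing (weierstrassPoly a)).toLinearMap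
  rw [ker_critToSing, finrank_range_mulLeft hp hq hpS hqS, finrank_crit hp hq hpS hqS,
    LinearMap.range_eq_top.mpr (critToSing_surjective _), finrank_top] at h
  exact h

theorem singDim_pos_iff (hp : 1 < p) (hq : 1 < q) (hpS : IsUnit (p : k)) (hqS : IsUnit (q : k))
    (a : Idx p q → k) :
    0 < singDim (weierstrassPoly a) ↔ (critMatrix hp hq hpS hqS a).det = 0 := by
  have h := singDim_add_rank hp hq hpS hqS a
  constructor
  · intro h0
    by_contra hne
    have := Matrix.rank_of_det_ne_zero hne
    omega
  · intro h0
    by_contra hne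
    have h1 : (critMatrix hp hq hpS hqS a).rank = Fintype.card (BasisIdx p q) := by omega
    have h2 : Function.Surjective (critMatrix hp hq hpS hqS a).mulVecLin := by
      rw [← LinearMap.range_eq_top]
      apply Submodule.eq_top_of_finrank_eq
      rw [Module.finrank_fintype_fun_eq_card]
      exact h1
    have h3 : IsUnit (critMatrix hp hq hpS hqS a) :=
      Matrix.mulVec_surjective_iff_isUnit.mp h2
    rw [Matrix.isUnit_iff_isUnit_det, h0] at h3
    exact not_isUnit_zero h3

/-- The pencil of polynomials obtained by adding a variable to the constant term. -/
def shiftConst {S : Type*} [CommRing S] (a : Idx p q → S) : Idx p q → Polynomial S :=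
  fun i => Polynomial.C (a i) + if i.1 = (0, 0) then Polynomial.X else 0

theorem weierstrassPoly_add_const {S : Type*} [CommRing S] (hp : 0 < p) (hq : 0 < q)
    (a : Idx p q → S) (t : S) :
    weierstrassPoly (fun i => a i + if i.1 = (0, 0) then t else 0) = weierstrassPoly a + C t := by
  have h0 : (0, 0) ∈ exponents p q := mem_exponents.mpr (by simpa using Nat.mul_pos hp hq)
  simp only [weierstrassPoly, map_add, add_mul, Finset.sum_add_distrib]
  rw [← add_assoc]
  congr 1
  rw [Finset.sum_eq_single (⟨(0, 0), h0⟩ : Idx p q)]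
  · simp
  · rintro ⟨i, hi⟩ _ hne
    have : i ≠ (0, 0) := fun h => hne (Subtype.ext h)
    simp [this]
  · intro h; exact absurd (Finset.mem_univ _) h

theorem critIdeal_add_C {S : Type*} [CommRing S] (f : MvPolynomial (Fin 2) S) (t : S) :
    critIdeal (f + C t) = critIdeal f := by
  simp [critIdeal]

/-- A change of the constant term leaves `f_X` and `f_Y` alone; the algebra stays the same and only
the multiplier `f` becomes `f + t`. -/
theorem critMatrix_add_const {S : Type*} [CommRing S] (hp : 1 < p) (hq : 1 < q)
    (hpS : IsUnit (p : S)) (hqS : IsUnit (q : S)) (a : Idx p q → S) (t : S) :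
    critMatrix hp hq hpS hqS (fun i => a i + if i.1 = (0, 0) then t else 0) =
      critMatrix hp hq hpS hqS a + Matrix.scalar _ t := by
  refine critMatrix_eq_of_mem hp hq hpS hqS fun i => ?_
  rw [weierstrassPoly_add_const (by omega) (by omega), critIdeal_add_C]
  convert critMatrix_mem hp hq hpS hqS a i using 1
  have : ∀ k : BasisIdx p q, (C : S →+* MvPolynomial (Fin 2) S) ((critMatrix hp hq hpS hqS a + Matrix.scalar (BasisIdx p q) t :
      Matrix (BasisIdx p q) (BasisIdx p q) S) i k) *
      (X 0 ^ (k.1 : ℕ) * X 1 ^ (k.2 : ℕ)) =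
      C (critMatrix hp hq hpS hqS a i k) * (X 0 ^ (k.1 : ℕ) * X 1 ^ (k.2 : ℕ)) +
      if i = k then C t * (X 0 ^ (k.1 : ℕ) * X 1 ^ (k.2 : ℕ)) else 0 := by
    intro k
    rw [Matrix.add_apply, Matrix.scalar_apply, Matrix.diagonal_apply]
    split_ifs <;> simp [add_mul]
  have hsum := Finset.sum_congr rfl fun k (_ : k ∈ Finset.univ) => this k
  rw [hsum, Finset.sum_add_distrib, Finset.sum_ite_eq]
  simp only [Finset.mem_univ, if_true]
  ring

/-- The matrix of the pencil is `M + t`, the characteristic matrix of `-M`. So the determinant is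
monic in `t`, and its order at `0` is an algebraic multiplicity of an eigenvalue. -/
theorem det_critMatrix_shiftConst {S : Type*} [CommRing S] (hp : 1 < p) (hq : 1 < q)
    (hpS : IsUnit (p : S)) (hqS : IsUnit (q : S)) (hpT : IsUnit (p : Polynomial S))
    (hqT : IsUnit (q : Polynomial S)) (a : Idx p q → S) :
    (critMatrix hp hq hpT hqT (shiftConst a)).det = (-(critMatrix hp hq hpS hqS a)).charpoly := by
  have : critMatrix hp hq hpT hqT (shiftConst a) = (critMatrix hp hq hpS hqS a).map Polynomial.C +
      Matrix.scalar _ Polynomial.X := by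
    rw [← critMatrix_map Polynomial.C hp hq hpS hqS hpT hqT, ← critMatrix_add_const]
    rfl
  rw [this, Matrix.charpoly, Matrix.charmatrix]
  congr 1
  rw [map_neg, sub_neg_eq_add, add_comm]
  rfl

/-- From `F = G F²` it follows that `F = Gⁿ Fⁿ⁺¹`, so whatever a power of `F` kills is already
killed by `F`: there are no nontrivial Jordan blocks for `0`. -/
theorem maxGenEigenspace_neg_mulLeft {N : Type*} [CommRing N] [Algebra k N] {F G : N}
    (hFG : F = G * F ^ 2) :
    Module.End.maxGenEigenspace (-LinearMap.mulLeft k F) 0 =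
      LinearMap.ker (LinearMap.mulLeft k F) := by
  have hpow : ∀ (n : ℕ) x, ((-LinearMap.mulLeft k F) ^ n) x = (-F) ^ n * x := by
    intro n
    induction n with
    | zero => intro x; simp
    | succ n ih =>
      intro x
      rw [pow_succ, Module.End.mul_apply, ih, pow_succ]
      simp [mul_assoc]
  apply le_antisymm
  · intro x hx
    rw [Module.End.mem_maxGenEigenspace] at hx
    obtain ⟨n, hn⟩ := hx
    rw [zero_smul, sub_zero, hpow] at hn
    have hn' : F ^ n * x = 0 := by
      rw [neg_pow, mul_assoc] at hn
      exact ((isUnit_one.neg).pow n).mul_right_eq_zero.mp hn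
    have hFn : ∀ n : ℕ, F = G ^ n * F ^ (n + 1) := by
      intro n
      induction n with
      | zero => simp
      | succ n ih =>
        calc F = G * F ^ 2 := hFG
          _ = G * F * F := by ring
          _ = G * (G ^ n * F ^ (n + 1)) * F := by rw [← ih]
          _ = _ := by ring
    rw [LinearMap.mem_ker, LinearMap.mulLeft_apply, hFn n]
    rw [pow_succ', show G ^ n * (F * F ^ n) * x = G ^ n * F * (F ^ n * x) by ring, hn', mul_zero]
  · intro x hx
    rw [Module.End.mem_maxGenEigenspace]
    refine ⟨1, ?_⟩
    rw [LinearMap.mem_ker, LinearMap.mulLeft_apply] at hx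
    simp [hx]

/-- If the Hesse determinant is invertible on the singular locus, then `0` is a root of
`t ↦ Δ(a + t e₀₀)` whose multiplicity is the dimension of `k[X, Y] / (f, f_X, f_Y)`. -/
theorem rootMultiplicity_shiftConst (hp : 1 < p) (hq : 1 < q) (hpS : IsUnit (p : k))
    (hqS : IsUnit (q : k)) (hpT : IsUnit (p : Polynomial k)) (hqT : IsUnit (q : Polynomial k))
    (a : Idx p q → k) {u : MvPolynomial (Fin 2) k}
    (hu : u * hessian (weierstrassPoly a) - 1 ∈ singIdeal (weierstrassPoly a)) :
    (critMatrix hp hq hpT hqT (shiftConst a)).det.rootMultiplicity 0 =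
      singDim (weierstrassPoly a) := by
  have hfin := finite_crit hp hq hpS hqS a
  set F := Ideal.Quotient.mk (critIdeal (weierstrassPoly a)) (weierstrassPoly a) with hF
  obtain ⟨g, hg⟩ := exists_sub_mul_sq_mem_critIdeal hu
  set G := Ideal.Quotient.mk (critIdeal (weierstrassPoly a)) g with hG
  have hFG : F = G * F ^ 2 := by
    rw [← sub_eq_zero, ← Ideal.Quotient.eq_zero_iff_mem.mpr hg, map_sub, map_mul, map_pow]
  set φ : Module.End k (MvPolynomial (Fin 2) k ⧸ critIdeal (weierstrassPoly a)) :=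
    LinearMap.mulLeft k F with hφ
  -- The multiplicity of the root `0` is the dimension of the generalized eigenspace, hence of the
  -- kernel of `φ`, and kernel and cokernel of an endomorphism have equal dimension.
  have hker : (-φ).maxGenEigenspace 0 = LinearMap.ker φ := maxGenEigenspace_neg_mulLeft hFG
  have h1 := LinearMap.finrank_maxGenEigenspace_eq (-φ) 0
  have h2 : (-φ).charpoly = (-(critMatrix hp hq hpS hqS a)).charpoly := by
    rw [← LinearMap.charpoly_toMatrix (-φ) (critBasis hp hq hpS hqS a), map_neg,
      ← Matrix.charpoly_transpose]
    congr 1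
    rw [Matrix.transpose_neg]
    congr 1
    have := leftMulMatrix_critBasis hp hq hpS hqS a
    rw [Algebra.leftMulMatrix_apply] at this
    rw [← Matrix.transpose_transpose (critMatrix hp hq hpS hqS a), ← this]
    rfl
  rw [det_critMatrix_shiftConst hp hq hpS hqS, ← h2, ← h1, hker]
  have h3 := LinearMap.finrank_range_add_finrank_ker φ
  rw [hφ, finrank_range_mulLeft hp hq hpS hqS, finrank_crit hp hq hpS hqS,
    ← singDim_add_rank hp hq hpS hqS a] at h3
  rw [hφ]
  omega

end Field

/-- If the variable occurred, the derivative would be nonzero in characteristic zero and of smaller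
degree in that variable than its divisor `f`. -/
theorem notMem_vars_of_dvd_pderiv {R σ : Type*} [CommRing R] [IsDomain R] [CharZero R]
    {f : MvPolynomial σ R} (i : σ) (h : f ∣ pderiv i f) : i ∉ f.vars := by
  classical
  intro hi
  obtain ⟨m, hm, hmi⟩ := (mem_vars_iff_mem_support i).mp hi
  have hmi' : m i ≠ 0 := by simpa using hmi
  have hne : pderiv i f ≠ 0 := by
    intro h0
    have h1 := coeff_pderiv f (i := i) (m - Finsupp.single i 1)
    rw [h0, coeff_zero] at h1
    have e : m - Finsupp.single i 1 + Finsupp.single i 1 = m := by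
      ext j
      by_cases hj : j = i
      · subst hj; simp; omega
      · simp [Finsupp.single_eq_of_ne hj]
    rw [e] at h1
    have := (mul_eq_zero.mp h1.symm).resolve_left (mem_support_iff.mp hm)
    norm_cast at this
  obtain ⟨g, hg⟩ := h
  have hf0 : f ≠ 0 := by rintro rfl; simp at hm
  have hg0 : g ≠ 0 := by rintro rfl; rw [mul_zero] at hg; exact hne hg
  have h1 : degreeOf i f ≤ degreeOf i (pderiv i f) := by
    rw [hg, degreeOf_mul_eq hf0 hg0]; omega
  have hpos : 0 < degreeOf i f :=
    lt_of_lt_of_le (Nat.pos_of_ne_zero hmi') (monomial_le_degreeOf i hm)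
  have h2 : degreeOf i (pderiv i f) < degreeOf i f := by
    rw [degreeOf_lt_iff hpos]
    intro n hn
    rw [mem_support_iff, coeff_pderiv] at hn
    have := monomial_le_degreeOf i (mem_support_iff.mpr (left_ne_zero_of_mul hn))
    simp at this
    omega
  omega

/-! ### Changing the coefficients of `1`, `X` and `Y` -/

section Affine

variable {S T : Type*} [CommRing S] [CommRing T] {p q : ℕ}

/-- The family with entries `c₀`, `c₁`, `c₂` at the exponents `(0, 0)`, `(1, 0)`, `(0, 1)`. -/
def affineFamily (c : Fin 3 → S) : Idx p q → S := fun i =>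
  (if i.1 = (0, 0) then c 0 else 0) + (if i.1 = (1, 0) then c 1 else 0) +
    (if i.1 = (0, 1) then c 2 else 0)

theorem mem_exponents_zero_zero (hp : 0 < p) (hq : 0 < q) : (0, 0) ∈ exponents p q :=
  mem_exponents.mpr (by simpa using Nat.mul_pos hp hq)

theorem mem_exponents_one_zero (hp : 0 < p) (hq : 1 < q) : (1, 0) ∈ exponents p q :=
  mem_exponents.mpr (by simp only; nlinarith)

theorem mem_exponents_zero_one (hp : 1 < p) (hq : 0 < q) : (0, 1) ∈ exponents p q :=
  mem_exponents.mpr (by simp only; nlinarith)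

/-- The index of the constant coefficient. -/
def idxOne (hp : 1 < p) (hq : 1 < q) : Idx p q :=
  ⟨(0, 0), mem_exponents_zero_zero (by omega) (by omega)⟩

/-- The index of the coefficient of `X`. -/
def idxX (hp : 1 < p) (hq : 1 < q) : Idx p q :=
  ⟨(1, 0), mem_exponents_one_zero (by omega) (by omega)⟩

/-- The index of the coefficient of `Y`. -/
def idxY (hp : 1 < p) (hq : 1 < q) : Idx p q :=
  ⟨(0, 1), mem_exponents_zero_one (by omega) (by omega)⟩

theorem sum_ite_idx {M : Type*} [AddCommMonoid M] (e : ℕ × ℕ) (he : e ∈ exponents p q)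
    (g : Idx p q → M) : ∑ i : Idx p q, (if i.1 = e then g i else 0) = g ⟨e, he⟩ := by
  rw [Finset.sum_eq_single (⟨e, he⟩ : Idx p q)]
  · simp
  · rintro ⟨i, hi⟩ _ hne
    exact if_neg fun h => hne (Subtype.ext h)
  · intro h; exact absurd (Finset.mem_univ _) h

theorem weierstrassPoly_add_affine (hp : 1 < p) (hq : 1 < q) (a : Idx p q → S) (c : Fin 3 → S) :
    weierstrassPoly (fun i => a i + affineFamily c i) =
      weierstrassPoly a + (C (c 0) + C (c 1) * X 0 + C (c 2) * X 1) := by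
  simp only [weierstrassPoly, affineFamily, map_add, add_mul, Finset.sum_add_distrib,
    apply_ite (C : S →+* MvPolynomial (Fin 2) S), map_zero, ite_mul, zero_mul]
  rw [sum_ite_idx (0, 0) (idxOne hp hq).2, sum_ite_idx (1, 0) (idxX hp hq).2,
    sum_ite_idx (0, 1) (idxY hp hq).2]
  simp
  ring

theorem eval_map_C (g : MvPolynomial (Fin 2) S) :
    eval X (map (C : S →+* MvPolynomial (Fin 2) S) g) = g := by
  rw [eval_map, eval₂_eta]

end Affine

/-! ### The parametrization of singular curves by a retraction -/

section Retraction

variable (K : Type*) [Field K] (p q : ℕ)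

/-- The correction terms that kill `F`, `F_X` and `F_Y`. -/
def retractionShift : Fin 3 → PlaneRing K p q :=
  ![-(genericF K p q - X 0 * pderiv 0 (genericF K p q) - X 1 * pderiv 1 (genericF K p q)),
    -pderiv 0 (genericF K p q), -pderiv 1 (genericF K p q)]

/-- The coefficients of the universal singular curve with singular point `(X, Y)`. -/
def retractionCoeff (i : Idx p q) : PlaneRing K p q :=
  C (X i) + affineFamily (retractionShift K p q) i

/-- The homomorphism from `R` that parametrizes the singular curves. -/
def coeffRetraction : CoeffRing K p q →+* PlaneRing K p q :=
  (aeval (R := K) (retractionCoeff K p q)).toRingHom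

/-- The retraction of `R[X, Y]` with kernel `(F, F_X, F_Y)`. -/
def retraction : PlaneRing K p q →+* PlaneRing K p q :=
  (eval X).comp (map (coeffRetraction K p q))

variable {K p q}

theorem coeffRetraction_X (i : Idx p q) :
    coeffRetraction K p q (X i) = retractionCoeff K p q i := by
  simp [coeffRetraction]

theorem coeffRetraction_C (c : K) :
    coeffRetraction K p q (C c) = C (C c) := by
  simp [coeffRetraction]

theorem retraction_C (r : CoeffRing K p q) : retraction K p q (C r) = coeffRetraction K p q r := by
  simp [retraction]

theorem retraction_X (i : Fin 2) : retraction K p q (X i) = X i := by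
  simp [retraction]

/-- Two copies of the plane occur: the outer variables are plane coordinates, while `X`, `Y` inside
the coefficients are the universal point. The added affine term is minus the first-order Taylor
polynomial of `F` at that point, which forces a singularity there. -/
theorem map_coeffRetraction_genericF (hp : 1 < p) (hq : 1 < q) :
    map (coeffRetraction K p q) (genericF K p q) = map C (genericF K p q) +
      (C (retractionShift K p q 0) + C (retractionShift K p q 1) * X 0 +
        C (retractionShift K p q 2) * X 1) := by
  rw [map_genericF, map_genericF, ← weierstrassPoly_add_affine hp hq]
  congr 1
  funext i
  rw [coeffRetraction_X]
  rfl

theorem map_pderiv_zero_genericF (hp : 1 < p) (hq : 1 < q) :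
    map (coeffRetraction K p q) (pderiv 0 (genericF K p q)) =
      map C (pderiv 0 (genericF K p q)) + C (retractionShift K p q 1) := by
  rw [← pderiv_map, map_coeffRetraction_genericF hp hq, ← pderiv_map]
  simp [pderiv_X]

theorem map_pderiv_one_genericF (hp : 1 < p) (hq : 1 < q) :
    map (coeffRetraction K p q) (pderiv 1 (genericF K p q)) =
      map C (pderiv 1 (genericF K p q)) + C (retractionShift K p q 2) := by
  rw [← pderiv_map, map_coeffRetraction_genericF hp hq, ← pderiv_map]
  simp [pderiv_X]

theorem retraction_genericF (hp : 1 < p) (hq : 1 < q) :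
    retraction K p q (genericF K p q) = 0 := by
  rw [retraction, RingHom.comp_apply, map_coeffRetraction_genericF hp hq, map_add, eval_map_C]
  simp [retractionShift]
  ring

theorem retraction_pderiv_zero (hp : 1 < p) (hq : 1 < q) :
    retraction K p q (pderiv 0 (genericF K p q)) = 0 := by
  rw [retraction, RingHom.comp_apply, map_pderiv_zero_genericF hp hq, map_add, eval_map_C]
  simp [retractionShift]

theorem retraction_pderiv_one (hp : 1 < p) (hq : 1 < q) :
    retraction K p q (pderiv 1 (genericF K p q)) = 0 := by
  rw [retraction, RingHom.comp_apply, map_pderiv_one_genericF hp hq, map_add, eval_map_C]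
  simp [retractionShift]

/-- The correction terms are built from `F`, `F_X`, `F_Y`, so modulo these the retraction fixes all
generators of the ring. -/
theorem sub_retraction_mem (g : PlaneRing K p q) :
    g - retraction K p q g ∈ singIdeal (genericF K p q) := by
  rw [← Ideal.Quotient.eq_zero_iff_mem, map_sub, sub_eq_zero]
  have h : (Ideal.Quotient.mk (singIdeal (genericF K p q))) =
      (Ideal.Quotient.mk (singIdeal (genericF K p q))).comp (retraction K p q) := by
    have hF : ∀ g ∈ ({genericF K p q, pderiv 0 (genericF K p q), pderiv 1 (genericF K p q)} :
        Set (PlaneRing K p q)), Ideal.Quotient.mk (singIdeal (genericF K p q)) g = 0 :=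
      fun g hg => Ideal.Quotient.eq_zero_iff_mem.mpr (Ideal.subset_span hg)
    have h0 := hF (genericF K p q) (by simp)
    have h1 := hF (pderiv 0 (genericF K p q)) (by simp)
    have h2 := hF (pderiv 1 (genericF K p q)) (by simp)
    refine MvPolynomial.ringHom_ext' (MvPolynomial.ringHom_ext ?_ ?_) ?_
    · intro c
      simp only [RingHom.comp_apply, retraction_C, coeffRetraction_C]
    · intro i
      simp only [RingHom.comp_apply, retraction_C, coeffRetraction_X, retractionCoeff,
        affineFamily, retractionShift, map_add, apply_ite (Ideal.Quotient.mk (singIdeal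
          (genericF K p q))), map_zero]
      simp [h0, h1, h2]
    · intro i
      rw [RingHom.comp_apply, retraction_X]
  exact RingHom.congr_fun h g

theorem singIdeal_genericF_eq_ker (hp : 1 < p) (hq : 1 < q) :
    singIdeal (genericF K p q) = RingHom.ker (retraction K p q) := by
  apply le_antisymm
  · rw [Ideal.span_le]
    rintro x (rfl | rfl | rfl)
    · exact retraction_genericF hp hq
    · exact retraction_pderiv_zero hp hq
    · exact retraction_pderiv_one hp hq
  · intro g hg
    have := sub_retraction_mem g
    rwa [RingHom.mem_ker.mp hg, sub_zero] at this

/-- The retraction embeds `A` into a polynomial ring over a field, so `A` is a domain. -/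
theorem singIdeal_genericF_isPrime (hp : 1 < p) (hq : 1 < q) :
    (singIdeal (genericF K p q)).IsPrime := by
  rw [singIdeal_genericF_eq_ker hp hq]
  exact RingHom.ker_isPrime _

theorem mem_hypersurfaceIdeal_iff {r : CoeffRing K p q} :
    r ∈ hypersurfaceIdeal K p q ↔ C r ∈ singIdeal (genericF K p q) := by
  rw [hypersurfaceIdeal, RingHom.mem_ker, ← Ideal.Quotient.eq_zero_iff_mem]
  rfl

theorem mem_hypersurfaceIdeal_iff_coeffRetraction (hp : 1 < p) (hq : 1 < q)
    {r : CoeffRing K p q} :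
    r ∈ hypersurfaceIdeal K p q ↔ coeffRetraction K p q r = 0 := by
  rw [mem_hypersurfaceIdeal_iff, singIdeal_genericF_eq_ker hp hq, RingHom.mem_ker, retraction_C]

theorem hypersurfaceIdeal_isPrime (hp : 1 < p) (hq : 1 < q) :
    (hypersurfaceIdeal K p q).IsPrime := by
  have := singIdeal_genericF_isPrime (K := K) hp hq
  have h : hypersurfaceIdeal K p q = (singIdeal (genericF K p q)).comap C := by
    ext r; exact mem_hypersurfaceIdeal_iff
  rw [h]
  exact Ideal.IsPrime.comap _

/-- An affine correction does not change second derivatives. -/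
theorem retraction_hesse (hp : 1 < p) (hq : 1 < q) :
    retraction K p q (hesse (genericF K p q)) = hesse (genericF K p q) := by
  rw [retraction, RingHom.comp_apply, map_hesse, map_coeffRetraction_genericF hp hq]
  have : hesse (map C (genericF K p q) +
      (C (retractionShift K p q 0) + C (retractionShift K p q 1) * X 0 +
        C (retractionShift K p q 2) * X 1)) = hesse (map C (genericF K p q)) := by
    simp [hesse, pderiv_X]
  rw [this, ← map_hesse, eval_map_C]

/-- The special curve `Y^p - X^q` has Hesse determinant `-pq(p-1)(q-1)` at `(1,1)`. -/
theorem hesse_genericF_ne_zero [CharZero K] (hp : 1 < p) (hq : 1 < q) :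
    hesse (genericF K p q) ≠ 0 := by
  intro h
  have h1 : hesse (weierstrassPoly (fun _ : Idx p q => (0 : K))) = 0 := by
    have := map_genericF (p := p) (q := q) (eval (fun _ => (0 : K)))
    simp only [eval_X] at this
    rw [← this, ← map_hesse, h, map_zero]
  have h2 : weierstrassPoly (fun _ : Idx p q => (0 : K)) = X 1 ^ p - X 0 ^ q := by
    simp [weierstrassPoly]
  rw [h2] at h1
  have h3 := congrArg (eval (fun _ => (1 : K))) h1
  simp [hesse, pderiv_X] at h3
  omega

theorem hesse_notMem_singIdeal [CharZero K] (hp : 1 < p) (hq : 1 < q) :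
    hesse (genericF K p q) ∉ singIdeal (genericF K p q) := by
  rw [singIdeal_genericF_eq_ker hp hq, RingHom.mem_ker, retraction_hesse hp hq]
  exact hesse_genericF_ne_zero hp hq

theorem derivation_coeffRetraction (D : Derivation K (PlaneRing K p q) (PlaneRing K p q))
    (r : CoeffRing K p q) :
    D (coeffRetraction K p q r) =
      ∑ i, coeffRetraction K p q (pderiv i r) * D (retractionCoeff K p q i) := by
  classical
  induction r using MvPolynomial.induction_on with
  | C c =>
    rw [coeffRetraction_C]
    simp only [pderiv_C, map_zero, zero_mul, Finset.sum_const_zero]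
    have hc : (C (C c) : PlaneRing K p q) = algebraMap K (PlaneRing K p q) c :=
      (IsScalarTower.algebraMap_apply K (CoeffRing K p q) (PlaneRing K p q) c).symm
    rw [hc, D.map_algebraMap]
  | add f g hf hg => simp only [map_add, hf, hg, add_mul, Finset.sum_add_distrib]
  | mul_X f j hf =>
    have h1 : ∀ i, coeffRetraction K p q (pderiv i (f * X j)) * D (retractionCoeff K p q i) =
        retractionCoeff K p q j * (coeffRetraction K p q (pderiv i f) *
          D (retractionCoeff K p q i)) +
        if j = i then coeffRetraction K p q f * D (retractionCoeff K p q i) else 0 := by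
      intro i
      rw [pderiv_mul, map_add, map_mul, coeffRetraction_X, pderiv_X, map_mul, Pi.single_apply]
      by_cases h : j = i
      · rw [if_pos h, if_pos h, map_one]; ring
      · rw [if_neg h, if_neg h, map_zero]; ring
    rw [Finset.sum_congr rfl fun i _ => h1 i, Finset.sum_add_distrib, ← Finset.mul_sum, ← hf,
      Finset.sum_ite_eq, if_pos (Finset.mem_univ j), map_mul, D.leibniz, coeffRetraction_X,
      smul_eq_mul, smul_eq_mul, add_comm]

/-- A derivation over `R` kills the coefficients `A_{νμ}`, so the chain rule retains only the three
corrected ones. -/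
theorem derivation_retraction_of_mem (hp : 1 < p) (hq : 1 < q)
    (D : Derivation (CoeffRing K p q) (PlaneRing K p q) (PlaneRing K p q)) (r : CoeffRing K p q) :
    D (coeffRetraction K p q r) =
      coeffRetraction K p q (pderiv (idxOne hp hq) r) * D (retractionShift K p q 0) +
      coeffRetraction K p q (pderiv (idxX hp hq) r) * D (retractionShift K p q 1) +
      coeffRetraction K p q (pderiv (idxY hp hq) r) * D (retractionShift K p q 2) := by
  have h := derivation_coeffRetraction (D.restrictScalars K) r
  rw [Derivation.restrictScalars_apply] at h
  rw [h]
  simp only [Derivation.restrictScalars_apply, retractionCoeff, affineFamily, map_add,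
    derivation_C, zero_add, apply_ite D, map_zero, mul_add, mul_ite, mul_zero,
    Finset.sum_add_distrib]
  rw [sum_ite_idx (0, 0) (idxOne hp hq).2, sum_ite_idx (1, 0) (idxX hp hq).2,
    sum_ite_idx (0, 1) (idxY hp hq).2]
  rfl

/-- On the hypersurface of singular curves the partial derivatives of an equation `r` satisfy
`∂r/∂A₁₀ = X ∂r/∂A₀₀` and `∂r/∂A₀₁ = Y ∂r/∂A₀₀`. -/
theorem coeffRetraction_pderiv_of_mem [CharZero K] (hp : 1 < p) (hq : 1 < q)
    {r : CoeffRing K p q} (hr : r ∈ hypersurfaceIdeal K p q) :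
    coeffRetraction K p q (pderiv (idxX hp hq) r) =
        X 0 * coeffRetraction K p q (pderiv (idxOne hp hq) r) ∧
      coeffRetraction K p q (pderiv (idxY hp hq) r) =
        X 1 * coeffRetraction K p q (pderiv (idxOne hp hq) r) := by
  have h0 := (mem_hypersurfaceIdeal_iff_coeffRetraction hp hq).mp hr
  -- The equation pulls back to zero along the parametrization. Differentiating by `X` and `Y` shows
  -- that the Hesse matrix kills `(r₁₀ - X r₀₀, r₀₁ - Y r₀₀)`, and its determinant is a nonzero
  -- element of a domain.
  have hx := derivation_retraction_of_mem hp hq (pderiv 0) r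
  have hy := derivation_retraction_of_mem hp hq (pderiv 1) r
  rw [h0, map_zero] at hx hy
  have hH := hesse_genericF_ne_zero (K := K) hp hq
  simp only [retractionShift, Matrix.cons_val_zero, Matrix.cons_val_one, Matrix.cons_val,
    map_neg, map_sub, pderiv_mul, pderiv_X_self, pderiv_comm,
    pderiv_X_of_ne (show (0 : Fin 2) ≠ 1 by decide),
    pderiv_X_of_ne (show (1 : Fin 2) ≠ 0 by decide)] at hx hy
  constructor
  · rw [← sub_eq_zero]
    refine (mul_eq_zero.mp ?_).resolve_left hH
    rw [hesse]
    linear_combination (pderiv 1 (pderiv 1 (genericF K p q))) * hx -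
      (pderiv 0 (pderiv 1 (genericF K p q))) * hy
  · rw [← sub_eq_zero]
    refine (mul_eq_zero.mp ?_).resolve_left hH
    rw [hesse]
    linear_combination (pderiv 0 (pderiv 0 (genericF K p q))) * hy -
      (pderiv 0 (pderiv 1 (genericF K p q))) * hx

/-- A polynomial free of `A₀₀`, `A₁₀`, `A₀₁` is fixed by the retraction. -/
theorem coeffRetraction_of_notMem_vars (hp : 1 < p) (hq : 1 < q) {r : CoeffRing K p q}
    (h0 : idxOne hp hq ∉ r.vars) (h1 : idxX hp hq ∉ r.vars) (h2 : idxY hp hq ∉ r.vars) :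
    coeffRetraction K p q r = C r := by
  refine hom_congr_vars (f₁ := coeffRetraction K p q) (f₂ := C) ?_ ?_ rfl
  · ext c
    simp [coeffRetraction_C]
  · intro i hi _
    rw [coeffRetraction_X, retractionCoeff, affineFamily, if_neg, if_neg, if_neg]
    · simp
    · intro h; exact h2 ((Subtype.ext h : i = idxY hp hq) ▸ hi)
    · intro h; exact h1 ((Subtype.ext h : i = idxX hp hq) ▸ hi)
    · intro h; exact h0 ((Subtype.ext h : i = idxOne hp hq) ▸ hi)

/-- A generator of the ideal of the hypersurface does not divide its derivative with respect to
the constant coefficient. -/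
theorem pderiv_generator_notMem [CharZero K] (hp : 1 < p) (hq : 1 < q) {r : CoeffRing K p q}
    (hr0 : r ≠ 0) (hr : hypersurfaceIdeal K p q = Ideal.span {r}) :
    pderiv (idxOne hp hq) r ∉ hypersurfaceIdeal K p q := by
  intro h
  have hmem : r ∈ hypersurfaceIdeal K p q := by rw [hr]; exact Ideal.mem_span_singleton_self r
  have hd := coeffRetraction_pderiv_of_mem hp hq hmem
  have h00 := (mem_hypersurfaceIdeal_iff_coeffRetraction hp hq).mp h
  rw [h00, mul_zero, mul_zero, ← mem_hypersurfaceIdeal_iff_coeffRetraction hp hq,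
    ← mem_hypersurfaceIdeal_iff_coeffRetraction hp hq, hr, Ideal.mem_span_singleton,
    Ideal.mem_span_singleton] at hd
  rw [hr, Ideal.mem_span_singleton] at h
  -- Now `r` divides its derivatives in all three corrected directions, so it contains none of these
  -- variables. The parametrization then leaves `r` unchanged, although it must kill it.
  have := coeffRetraction_of_notMem_vars hp hq (notMem_vars_of_dvd_pderiv _ h)
    (notMem_vars_of_dvd_pderiv _ hd.1) (notMem_vars_of_dvd_pderiv _ hd.2)
  rw [(mem_hypersurfaceIdeal_iff_coeffRetraction hp hq).mp hmem, eq_comm, C_eq_zero] at this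
  exact hr0 this

end Retraction

/-! ### Irreducibility of the discriminant -/

section Discriminant

variable {S T : Type*} [CommRing S] [CommRing T] {p q : ℕ}

/-- In `A` the matrix `M` kills the vector of basis monomials. Multiplying by the adjugate shows
that `det M` kills each of them, in particular the monomial `1`. -/
theorem C_det_critMatrix_mem (hp : 1 < p) (hq : 1 < q) (hpS : IsUnit (p : S))
    (hqS : IsUnit (q : S)) (a : Idx p q → S) :
    C (critMatrix hp hq hpS hqS a).det ∈ singIdeal (weierstrassPoly a) := by
  set I := singIdeal (weierstrassPoly a) with hI
  let φ : S →+* MvPolynomial (Fin 2) S ⧸ I := (Ideal.Quotient.mk I).comp C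
  let v : BasisIdx p q → MvPolynomial (Fin 2) S ⧸ I :=
    fun k => Ideal.Quotient.mk I (X 0 ^ (k.1 : ℕ) * X 1 ^ (k.2 : ℕ))
  have h1 : ((critMatrix hp hq hpS hqS a).map φ).mulVec v = 0 := by
    funext i
    have h := critIdeal_le_singIdeal _ (critMatrix_mem hp hq hpS hqS a i)
    have h2 : ∑ k : BasisIdx p q, C (critMatrix hp hq hpS hqS a i k) *
        (X 0 ^ (k.1 : ℕ) * X 1 ^ (k.2 : ℕ)) ∈ I := by
      have h3 : X 0 ^ (i.1 : ℕ) * X 1 ^ (i.2 : ℕ) * weierstrassPoly a ∈ I :=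
        Ideal.mul_mem_left _ _ (Ideal.subset_span (by simp))
      have := Ideal.sub_mem _ h3 h
      rwa [sub_sub_cancel] at this
    rw [← Ideal.Quotient.eq_zero_iff_mem, map_sum] at h2
    rw [Matrix.mulVec, dotProduct, Pi.zero_apply, ← h2]
    refine Finset.sum_congr rfl fun k _ => ?_
    rw [map_mul]
    rfl
  have h2 := congrArg (((critMatrix hp hq hpS hqS a).map φ).adjugate.mulVec) h1
  rw [Matrix.mulVec_mulVec, Matrix.adjugate_mul, Matrix.mulVec_zero, Matrix.smul_mulVec,
    Matrix.one_mulVec] at h2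
  have h3 := congrFun h2 (⟨0, by omega⟩, ⟨0, by omega⟩)
  have h4 : v (⟨0, by omega⟩, ⟨0, by omega⟩) = 1 := by simp [v]
  rw [Pi.smul_apply, h4, smul_eq_mul, mul_one, Pi.zero_apply] at h3
  rw [← Ideal.Quotient.eq_zero_iff_mem, ← h3]
  exact RingHom.map_det φ _

theorem C_disc_mem (K : Type*) [Field K] [CharZero K] (hp : 1 < p) (hq : 1 < q) :
    C (disc K p q) ∈ singIdeal (genericF K p q) := by
  rw [disc_eq_det K hp hq]
  exact C_det_critMatrix_mem hp hq _ _ _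

theorem isUnit_natCast_of_ringHom {K : Type*} [Field K] [CharZero K]
    (σ : CoeffRing K p q →+* T) {n : ℕ} (hn : 0 < n) : IsUnit (n : T) := by
  have := (isUnit_natCast_of_algebra K (S := CoeffRing K p q) hn).map σ
  simpa using this

variable {K : Type*} [Field K] [CharZero K] {k : Type*} [Field k]

/-- The fibre of `A` over a point is nonzero if and only if the point lies on the hypersurface. -/
theorem singDim_pos_iff_le_ker (hp : 1 < p) (hq : 1 < q) (σ : CoeffRing K p q →+* k) :
    0 < singDim (weierstrassPoly (fun i => σ (X i))) ↔
      hypersurfaceIdeal K p q ≤ RingHom.ker σ := by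
  have hpk : IsUnit (p : k) := isUnit_natCast_of_ringHom σ (by omega)
  have hqk : IsUnit (q : k) := isUnit_natCast_of_ringHom σ (by omega)
  constructor
  · intro h r hr
    rw [RingHom.mem_ker]
    by_contra hne
    have h1 := map_mem_singIdeal σ (mem_hypersurfaceIdeal_iff.mp hr)
    rw [map_C, map_genericF] at h1
    have h2 : singIdeal (weierstrassPoly (fun i => σ (X i))) = ⊤ :=
      Ideal.eq_top_of_isUnit_mem _ h1 ((isUnit_iff_ne_zero.mpr hne).map C)
    rw [singDim, h2] at h
    have : Subsingleton (MvPolynomial (Fin 2) k ⧸ (⊤ : Ideal (MvPolynomial (Fin 2) k))) :=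
      Ideal.Quotient.subsingleton_iff.mpr rfl
    rw [Module.finrank_zero_of_subsingleton] at h
    exact lt_irrefl _ h
  · intro h
    rw [singDim_pos_iff hp hq hpk hqk, ← map_disc K σ hp hq hpk hqk]
    exact h (mem_hypersurfaceIdeal_iff.mpr (C_disc_mem K hp hq))

/-- The ring homomorphism `r ↦ r(a + t e₀₀)` for the point `a` given by `σ`. -/
def pencilHom (σ : CoeffRing K p q →+* k) : CoeffRing K p q →+* Polynomial k :=
  eval₂Hom ((Polynomial.C.comp σ).comp C) (shiftConst fun i => σ (X i))

omit [CharZero K] in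
theorem pencilHom_X (σ : CoeffRing K p q →+* k) (i : Idx p q) :
    pencilHom σ (X i) = shiftConst (fun i => σ (X i)) i := by
  simp [pencilHom]

omit [CharZero K] in
theorem eval_zero_pencilHom (σ : CoeffRing K p q →+* k) (r : CoeffRing K p q) :
    (pencilHom σ r).eval 0 = σ r := by
  have : (Polynomial.evalRingHom (0 : k)).comp (pencilHom σ) = σ := by
    refine MvPolynomial.ringHom_ext ?_ ?_
    · intro c; simp [pencilHom]
    · intro i
      rw [RingHom.comp_apply, pencilHom_X, shiftConst]
      split_ifs <;> simp
  exact RingHom.congr_fun this r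

omit [CharZero K] in
theorem derivative_pencilHom (hp : 1 < p) (hq : 1 < q) (σ : CoeffRing K p q →+* k)
    (r : CoeffRing K p q) :
    Polynomial.derivative (pencilHom σ r) = pencilHom σ (pderiv (idxOne hp hq) r) := by
  classical
  induction r using MvPolynomial.induction_on with
  | C c => simp [pencilHom]
  | add f g hf hg => simp only [map_add, hf, hg]
  | mul_X f j hf =>
    have hX : Polynomial.derivative (pencilHom σ (X j)) =
        pencilHom σ (pderiv (idxOne hp hq) (X j)) := by
      rw [pencilHom_X, shiftConst, pderiv_X]
      by_cases h : j = idxOne hp hq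
      · subst h
        simp [idxOne]
      · rw [Pi.single_apply, if_neg h, if_neg]
        · simp
        · intro h'; exact h (Subtype.ext h')
    rw [map_mul, Polynomial.derivative_mul, hf, hX, pderiv_mul, map_add, map_mul, map_mul]

theorem isUnit_natCast_polynomial {n : ℕ} (h : IsUnit (n : k)) : IsUnit (n : Polynomial k) := by
  simpa using h.map Polynomial.C

/-- The order of vanishing of the discriminant along the line in direction `e₀₀` is the dimension
of the fibre of `A`, provided that the fibre is unramified. -/
theorem rootMultiplicity_pencilHom_disc (hp : 1 < p) (hq : 1 < q) (σ : CoeffRing K p q →+* k)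
    {u : MvPolynomial (Fin 2) k}
    (hu : u * hessian (weierstrassPoly fun i => σ (X i)) - 1 ∈
      singIdeal (weierstrassPoly fun i => σ (X i))) :
    (pencilHom σ (disc K p q)).rootMultiplicity 0 =
      singDim (weierstrassPoly fun i => σ (X i)) ∧ pencilHom σ (disc K p q) ≠ 0 := by
  have hpk : IsUnit (p : k) := isUnit_natCast_of_ringHom σ (by omega)
  have hqk : IsUnit (q : k) := isUnit_natCast_of_ringHom σ (by omega)
  have hpT : IsUnit (p : Polynomial k) := isUnit_natCast_polynomial hpk
  have hqT : IsUnit (q : Polynomial k) := isUnit_natCast_polynomial hqk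
  have h1 : pencilHom σ (disc K p q) =
      (critMatrix hp hq hpT hqT (shiftConst fun i => σ (X i))).det := by
    rw [map_disc K (pencilHom σ) hp hq hpT hqT]
    congr 2
    funext i
    exact pencilHom_X σ i
  refine ⟨h1 ▸ rootMultiplicity_shiftConst hp hq hpk hqk hpT hqT _ hu, ?_⟩
  rw [h1, det_critMatrix_shiftConst hp hq hpk hqk]
  exact (Matrix.charpoly_monic _).ne_zero

/-- At a point whose fibre is unramified of degree one, the discriminant has a nonvanishing
derivative with respect to the constant coefficient. -/
theorem map_pderiv_disc_ne_zero (hp : 1 < p) (hq : 1 < q) (σ : CoeffRing K p q →+* k)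
    {u : MvPolynomial (Fin 2) k}
    (hu : u * hessian (weierstrassPoly fun i => σ (X i)) - 1 ∈
      singIdeal (weierstrassPoly fun i => σ (X i)))
    (h1 : singDim (weierstrassPoly fun i => σ (X i)) = 1) :
    σ (pderiv (idxOne hp hq) (disc K p q)) ≠ 0 := by
  obtain ⟨h2, h3⟩ := rootMultiplicity_pencilHom_disc hp hq σ hu
  rw [h1] at h2
  intro h0
  have h4 : (pencilHom σ (disc K p q)).IsRoot 0 := by
    rw [← Polynomial.rootMultiplicity_pos h3, h2]; exact Nat.one_pos
  have := (Polynomial.one_lt_rootMultiplicity_iff_isRoot h3).mpr ⟨h4, by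
    rw [derivative_pencilHom hp hq, Polynomial.IsRoot, eval_zero_pencilHom, h0]⟩
  omega

/-- At the generic point of the hypersurface the discriminant vanishes to order one. -/
theorem pderiv_disc_notMem (hp : 1 < p) (hq : 1 < q) {r : CoeffRing K p q}
    (hr0 : r ≠ 0) (hr : hypersurfaceIdeal K p q = Ideal.span {r}) :
    pderiv (idxOne hp hq) (disc K p q) ∉ hypersurfaceIdeal K p q := by
  have hprime := singIdeal_genericF_isPrime (K := K) hp hq
  -- The generic singular curve is considered over the fraction field of `A`, where its singular
  -- point is visible as the class of `(X, Y)`.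
  let B := PlaneRing K p q ⧸ singIdeal (genericF K p q)
  let k := FractionRing B
  let ψ : PlaneRing K p q →+* k := (algebraMap B k).comp (Ideal.Quotient.mk _)
  have hψ : ∀ g, ψ g = 0 ↔ g ∈ singIdeal (genericF K p q) := by
    intro g
    rw [← Ideal.Quotient.eq_zero_iff_mem]
    exact map_eq_zero_iff _ (IsFractionRing.injective B k)
  let σ : CoeffRing K p q →+* k := ψ.comp C
  have hσ : ∀ r, σ r = 0 ↔ r ∈ hypersurfaceIdeal K p q := by
    intro r
    rw [mem_hypersurfaceIdeal_iff]
    exact hψ (C r)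
  let z : Fin 2 → k := fun i => ψ (X i)
  have hev : ∀ g : PlaneRing K p q, eval z (map σ g) = ψ g := by
    intro g
    have : (eval z).comp (map σ) = ψ := by
      refine MvPolynomial.ringHom_ext ?_ ?_
      · intro c; simp [σ]
      · intro i; simp [z]
    exact RingHom.congr_fun this g
  set f := weierstrassPoly (fun i => σ (X i)) with hf
  have hmapF : map σ (genericF K p q) = f := map_genericF σ
  set s := pderiv (idxOne hp hq) r with hs
  have hs0 : σ s ≠ 0 := fun h => pderiv_generator_notMem hp hq hr0 hr ((hσ s).mp h)
  have hrm : r ∈ hypersurfaceIdeal K p q := by rw [hr]; exact Ideal.mem_span_singleton_self r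
  have hd := coeffRetraction_pderiv_of_mem hp hq hrm
  -- In `A` one has `X s = r₁₀` and `Y s = r₀₁` with `s = r₀₀` nonzero. Dividing by `s` in the fibre
  -- fixes both coordinates, so the fibre is the single reduced point `z`.
  have hXmem : ∀ i : Fin 2, X i - C (z i) ∈ singIdeal f := by
    have key : ∀ (i : Fin 2) (t : CoeffRing K p q),
        coeffRetraction K p q t = X i * coeffRetraction K p q s → X i - C (z i) ∈ singIdeal f := by
      intro i t ht
      have h1 : X i * C s - C t ∈ singIdeal (genericF K p q) := by
        rw [singIdeal_genericF_eq_ker hp hq, RingHom.mem_ker, map_sub, map_mul, retraction_C,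
          retraction_C, retraction_X, ht, sub_self]
      have h2 : σ t = z i * σ s := by
        have := (hψ _).mpr h1
        rw [map_sub, map_mul, sub_eq_zero] at this
        exact this.symm
      have h3 := map_mem_singIdeal σ h1
      rw [hmapF, map_sub, map_mul, map_X, map_C, map_C, h2] at h3
      have h4 := Ideal.mul_mem_left _ (C (σ s)⁻¹) h3
      have h5 : C (σ s)⁻¹ * (X i * C (σ s) - C (z i * σ s)) = X i - C (z i) := by
        have : (C (σ s)⁻¹ * C (σ s) : MvPolynomial (Fin 2) k) = 1 := by
          rw [← C_mul, inv_mul_cancel₀ hs0, C_1]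
        rw [C_mul]
        linear_combination (X i - C (z i)) * this
      rwa [h5] at h4
    intro i
    fin_cases i
    · exact key 0 _ hd.1
    · exact key 1 _ hd.2
  have hgmem : ∀ g : MvPolynomial (Fin 2) k, g - C (eval z g) ∈ singIdeal f := by
    intro g
    rw [← Ideal.Quotient.eq_zero_iff_mem, map_sub, sub_eq_zero]
    have : Ideal.Quotient.mk (singIdeal f) =
        ((Ideal.Quotient.mk (singIdeal f)).comp C).comp (eval z) := by
      refine MvPolynomial.ringHom_ext ?_ ?_
      · intro c; simp
      · intro i
        have := Ideal.Quotient.eq_zero_iff_mem.mpr (hXmem i)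
        rw [map_sub, sub_eq_zero] at this
        simp [this]
    exact RingHom.congr_fun this g
  have h1 : singDim f = 1 := by
    apply le_antisymm
    · refine finrank_le_one (1 : MvPolynomial (Fin 2) k ⧸ singIdeal f) fun w => ?_
      obtain ⟨g, rfl⟩ := Ideal.Quotient.mk_surjective w
      refine ⟨eval z g, ?_⟩
      have := Ideal.Quotient.eq_zero_iff_mem.mpr (hgmem g)
      rw [map_sub, sub_eq_zero] at this
      rw [this, ← map_one (Ideal.Quotient.mk (singIdeal f)), smul_mk_eq, map_one, mul_one]
    · refine (singDim_pos_iff_le_ker hp hq σ).mpr fun r hr => ?_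
      exact (hσ r).mpr hr
  -- The value at `z` is the class of the generic Hesse determinant in `A`, which is nonzero.
  have hh : eval z (hessian f) ≠ 0 := by
    rw [hessian_eq_hesse, ← hmapF, ← map_hesse, hev, Ne, hψ]
    exact hesse_notMem_singIdeal hp hq
  have hu : C (eval z (hessian f))⁻¹ * hessian f - 1 ∈ singIdeal f := by
    have := Ideal.mul_mem_left _ (C (eval z (hessian f))⁻¹) (hgmem (hessian f))
    rwa [mul_sub, ← C_mul, inv_mul_cancel₀ hh, C_1] at this
  have := map_pderiv_disc_ne_zero hp hq σ hu h1
  rwa [Ne, hσ] at this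

/-- The curve `Y^p - X^q + 1 = 0` is smooth: its partial derivatives vanish together only at the
origin, which is not on it. So the fibre of `A` at this point is zero. -/
theorem disc_ne_zero (hp : 1 < p) (hq : 1 < q) : disc K p q ≠ 0 := by
  intro h
  have h1 := (singDim_pos_iff hp hq (isUnit_natCast_of_algebra K (by omega))
    (isUnit_natCast_of_algebra K (by omega))
    (fun i : Idx p q => (0 : K) + if i.1 = (0, 0) then (1 : K) else 0)).mpr (by
      have := map_disc K (eval (fun i : Idx p q => (0 : K) + if i.1 = (0, 0) then (1 : K) else 0))
        hp hq (isUnit_natCast_of_algebra K (by omega)) (isUnit_natCast_of_algebra K (by omega))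
      rw [h, map_zero] at this
      simp only [eval_X] at this
      exact this.symm)
  rw [weierstrassPoly_add_const (by omega) (by omega)] at h1
  set f := weierstrassPoly (fun _ : Idx p q => (0 : K)) + C 1 with hf
  have hf' : f = X 1 ^ p - X 0 ^ q + 1 := by simp [hf, weierstrassPoly]
  have hx : X 0 ^ (q - 1) ∈ singIdeal f := by
    have : pderiv 0 f ∈ singIdeal f := Ideal.subset_span (by simp)
    have h2 := Ideal.mul_mem_left _ (C (-(q : K)⁻¹)) this
    convert h2 using 1
    have hq0 : (C (q : K)⁻¹ * C (q : K) : MvPolynomial (Fin 2) K) = 1 := by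
      rw [← C_mul, inv_mul_cancel₀ (by exact_mod_cast (by omega : q ≠ 0)), C_1]
    rw [map_natCast] at hq0
    rw [hf']
    simp [pderiv_X]
    linear_combination -(X 0 ^ (q - 1)) * hq0
  have hy : X 1 ^ (p - 1) ∈ singIdeal f := by
    have : pderiv 1 f ∈ singIdeal f := Ideal.subset_span (by simp)
    have h2 := Ideal.mul_mem_left _ (C ((p : K)⁻¹)) this
    convert h2 using 1
    have hq0 : (C (p : K)⁻¹ * C (p : K) : MvPolynomial (Fin 2) K) = 1 := by
      rw [← C_mul, inv_mul_cancel₀ (by exact_mod_cast (by omega : p ≠ 0)), C_1]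
    rw [map_natCast] at hq0
    rw [hf']
    simp [pderiv_X]
    linear_combination -(X 1 ^ (p - 1)) * hq0
  have hone : (1 : MvPolynomial (Fin 2) K) ∈ singIdeal f := by
    have h3 : f ∈ singIdeal f := Ideal.subset_span (by simp)
    have h4 := Ideal.sub_mem _ (Ideal.add_mem _ h3 (Ideal.mul_mem_left _ (X 0) hx))
      (Ideal.mul_mem_left _ (X 1) hy)
    convert h4 using 1
    have e1 : (X 0 * X 0 ^ (q - 1) : MvPolynomial (Fin 2) K) = X 0 ^ q := by
      rw [← pow_succ']; congr 1; omega
    have e2 : (X 1 * X 1 ^ (p - 1) : MvPolynomial (Fin 2) K) = X 1 ^ p := by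
      rw [← pow_succ']; congr 1; omega
    rw [e1, e2, hf']
    ring
  have h2 : singIdeal f = ⊤ := (Ideal.eq_top_iff_one _).mpr hone
  rw [singDim, h2] at h1
  have : Subsingleton (MvPolynomial (Fin 2) K ⧸ (⊤ : Ideal (MvPolynomial (Fin 2) K))) :=
    Ideal.Quotient.subsingleton_iff.mpr rfl
  rw [Module.finrank_zero_of_subsingleton] at h1
  exact lt_irrefl _ h1

/-- Every prime factor of the discriminant divides all elements of the ideal of the hypersurface. -/
theorem hypersurfaceIdeal_le_span_of_dvd_disc (hp : 1 < p) (hq : 1 < q) {r : CoeffRing K p q}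
    (hr : Prime r) (hd : r ∣ disc K p q) : hypersurfaceIdeal K p q ≤ Ideal.span {r} := by
  have hprime : (Ideal.span {r}).IsPrime := (Ideal.span_singleton_prime hr.ne_zero).mpr hr
  let B := CoeffRing K p q ⧸ Ideal.span {r}
  let σ : CoeffRing K p q →+* FractionRing B :=
    (algebraMap B (FractionRing B)).comp (Ideal.Quotient.mk _)
  have hσ : RingHom.ker σ = Ideal.span {r} := by
    ext g
    rw [RingHom.mem_ker, ← Ideal.Quotient.eq_zero_iff_mem]
    exact map_eq_zero_iff _ (IsFractionRing.injective B (FractionRing B))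
  -- At the generic point of `V(r)` the discriminant vanishes, hence the fibre of `A` is nonzero and
  -- the point lies on `ℋ`.
  rw [← hσ, ← singDim_pos_iff_le_ker hp hq, singDim_pos_iff hp hq
    (isUnit_natCast_of_ringHom σ (by omega)) (isUnit_natCast_of_ringHom σ (by omega)),
    ← map_disc K σ hp hq, ← RingHom.mem_ker, hσ, Ideal.mem_span_singleton]
  exact hd

theorem disc_mem_hypersurfaceIdeal (hp : 1 < p) (hq : 1 < q) :
    disc K p q ∈ hypersurfaceIdeal K p q :=
  mem_hypersurfaceIdeal_iff.mpr (C_disc_mem K hp hq)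

/-- The discriminant is irreducible and generates the ideal of the hypersurface. -/
theorem irreducible_disc_and_hypersurfaceIdeal_eq (hp : 1 < p) (hq : 1 < q) :
    Irreducible (disc K p q) ∧ hypersurfaceIdeal K p q = Ideal.span {disc K p q} := by
  have hP := hypersurfaceIdeal_isPrime (K := K) hp hq
  have hne : hypersurfaceIdeal K p q ≠ ⊥ := fun h => by
    have := disc_mem_hypersurfaceIdeal (K := K) hp hq
    rw [h] at this
    exact disc_ne_zero hp hq this
  -- The prime ideal `𝔮` contains `Δ`, hence one of its prime factors; this factor then generates
  -- `𝔮`.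
  have hex : ∃ r : CoeffRing K p q, Prime r ∧ r ∣ disc K p q ∧ r ∈ hypersurfaceIdeal K p q := by
    obtain ⟨s, hs, hsd⟩ := UniqueFactorizationMonoid.exists_prime_factors _
      (disc_ne_zero (K := K) hp hq)
    have h1 : s.prod ∈ hypersurfaceIdeal K p q := by
      obtain ⟨u, hu⟩ := hsd.symm
      rw [← hu]
      exact Ideal.mul_mem_right _ _ (disc_mem_hypersurfaceIdeal hp hq)
    obtain ⟨r, hr, hrm⟩ := (Ideal.IsPrime.multiset_prod_mem_iff_exists_mem hP s).mp h1
    exact ⟨r, hs r hr, (Multiset.dvd_prod hr).trans hsd.dvd, hrm⟩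
  obtain ⟨r, hr, hrd, hrm⟩ := hex
  have hqr : hypersurfaceIdeal K p q = Ideal.span {r} :=
    le_antisymm (hypersurfaceIdeal_le_span_of_dvd_disc hp hq hr hrd)
      (by rwa [Ideal.span_singleton_le_iff_mem])
  have hder := pderiv_disc_notMem hp hq hr.ne_zero hqr
  obtain ⟨h, hh⟩ := hrd
  -- If `r²` divided `Δ`, then `r` would divide `∂Δ/∂A₀₀`, against the simple vanishing at the
  -- generic point.
  have hnd : ¬ r ∣ h := by
    rintro ⟨g, rfl⟩
    apply hder
    rw [hh, hqr, Ideal.mem_span_singleton]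
    simp only [pderiv_mul]
    exact ⟨pderiv (idxOne hp hq) r * g + (pderiv (idxOne hp hq) r * g +
      r * pderiv (idxOne hp hq) g), by ring⟩
  -- Any further prime factor `t` also satisfies `𝔮 ⊆ (t)`, so it divides `r`, is associated to it,
  -- and makes `r` a double factor.
  have hunit : IsUnit h := by
    by_contra hu
    have hh0 : h ≠ 0 := by rintro rfl; exact hnd (dvd_zero _)
    obtain ⟨t, ht, hth⟩ := WfDvdMonoid.exists_irreducible_factor hu hh0
    have h1 := hypersurfaceIdeal_le_span_of_dvd_disc hp hq ht.prime
      (hth.trans ⟨r, by rw [hh, mul_comm]⟩) hrm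
    rw [Ideal.mem_span_singleton] at h1
    exact hnd ((ht.associated_of_dvd hr.irreducible h1).symm.dvd.trans hth)
  have hass : Associated r (disc K p q) := ⟨hunit.unit, by rw [hh]; rfl⟩
  refine ⟨hass.irreducible hr.irreducible, ?_⟩
  rw [hqr, Ideal.span_singleton_eq_span_singleton]
  exact hass

end Discriminant

/-! ### Rank and nonvanishing minors -/

section Minors

variable {k : Type*} [Field k] {m n : Type*} [Fintype m] [Fintype n]

theorem exists_linearIndependent_rows (A : Matrix m n k) {r : ℕ} (h : r ≤ A.rank) :
    ∃ f : Fin r → m, LinearIndependent k (A.submatrix f id).row := by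
  obtain ⟨F, hF, -, hli⟩ := Submodule.exists_fun_fin_finrank_span_eq k (Set.range A.row)
  rw [Matrix.rank_eq_finrank_span_row] at h
  choose f hf using hF
  refine ⟨fun i => f (Fin.castLE h i), ?_⟩
  have : (A.submatrix (fun i => f (Fin.castLE h i)) id).row = F ∘ Fin.castLE h := by
    funext i
    rw [Function.comp_apply, ← hf]
    rfl
  rw [this]
  exact hli.comp _ (Fin.castLE_injective h)

/-- A matrix of rank at least `r` has a nonvanishing minor of size `r`. -/
theorem exists_submatrix_det_ne_zero (A : Matrix m n k) {r : ℕ} (h : r ≤ A.rank) :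
    ∃ (f : Fin r → m) (g : Fin r → n), (A.submatrix f g).det ≠ 0 := by
  obtain ⟨f, hf⟩ := exists_linearIndependent_rows A h
  have h1 : (A.submatrix f id).transpose.rank = r := by
    rw [Matrix.rank_transpose, hf.rank_matrix, Fintype.card_fin]
  obtain ⟨g, hg⟩ := exists_linearIndependent_rows (A.submatrix f id).transpose h1.ge
  refine ⟨f, g, ?_⟩
  have h2 := (Matrix.isUnit_iff_isUnit_det _).mp (Matrix.linearIndependent_rows_iff_isUnit.mp hg)
  rw [← Matrix.det_transpose]
  exact h2.ne_zero

end Minors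

/-! ### Fitting ideals and fibre length -/

section Fitting

variable {S : Type*} [CommRing S] {p q : ℕ}

theorem row_relation (hp : 1 < p) (hq : 1 < q) (hpS : IsUnit (p : S)) (hqS : IsUnit (q : S))
    (a : Idx p q → S) (i : BasisIdx p q) :
    ∑ k : BasisIdx p q, critMatrix hp hq hpS hqS a i k •
      Ideal.Quotient.mk (singIdeal (weierstrassPoly a))
        (X 0 ^ (k.1 : ℕ) * X 1 ^ (k.2 : ℕ)) = 0 := by
  have h := critIdeal_le_singIdeal _ (critMatrix_mem hp hq hpS hqS a i)
  have h2 : ∑ k : BasisIdx p q, C (critMatrix hp hq hpS hqS a i k) *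
      (X 0 ^ (k.1 : ℕ) * X 1 ^ (k.2 : ℕ)) ∈ singIdeal (weierstrassPoly a) := by
    have h3 : X 0 ^ (i.1 : ℕ) * X 1 ^ (i.2 : ℕ) * weierstrassPoly a ∈
        singIdeal (weierstrassPoly a) :=
      Ideal.mul_mem_left _ _ (Ideal.subset_span (by simp))
    have := Ideal.sub_mem _ h3 h
    rwa [sub_sub_cancel] at this
  rw [← Ideal.Quotient.eq_zero_iff_mem, map_sum] at h2
  rw [← h2]
  refine Finset.sum_congr rfl fun k _ => ?_
  rw [smul_mk_eq, ← map_mul]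

/-- The relations between the monomials in `A` are the combinations of the rows of the matrix of
multiplication by `F`. -/
theorem exists_vecMul_of_relation (hp : 1 < p) (hq : 1 < q) (hpS : IsUnit (p : S))
    (hqS : IsUnit (q : S)) (a : Idx p q → S) (v : BasisIdx p q → S)
    (hv : ∑ k : BasisIdx p q, v k • Ideal.Quotient.mk (singIdeal (weierstrassPoly a))
        (X 0 ^ (k.1 : ℕ) * X 1 ^ (k.2 : ℕ)) = 0) :
    ∃ w : BasisIdx p q → S, v = Matrix.vecMul w (critMatrix hp hq hpS hqS a) := by
  set b := critBasis hp hq hpS hqS a with hb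
  set F := Ideal.Quotient.mk (critIdeal (weierstrassPoly a)) (weierstrassPoly a) with hF
  have h1 : ∑ k, v k • b k ∈ LinearMap.ker (critToSing (weierstrassPoly a)).toLinearMap := by
    rw [LinearMap.mem_ker, map_sum, ← hv]
    refine Finset.sum_congr rfl fun k _ => ?_
    rw [map_smul, hb, critBasis_apply]
    rfl
  rw [ker_critToSing] at h1
  obtain ⟨y, hy⟩ := h1
  refine ⟨b.repr y, ?_⟩
  have h2 : ∀ i, b i * F = ∑ k, critMatrix hp hq hpS hqS a i k • b k := fun i => by
    conv_lhs => rw [← b.sum_repr (b i * F)]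
    rfl
  have h3 : ∑ k, v k • b k = ∑ k, Matrix.vecMul (b.repr y) (critMatrix hp hq hpS hqS a) k • b k := by
    rw [← hy, LinearMap.mulLeft_apply, ← hF, mul_comm]
    conv_lhs => rw [← b.sum_repr y]
    rw [Finset.sum_mul]
    simp only [smul_mul_assoc, h2, Finset.smul_sum, Matrix.vecMul, dotProduct, Finset.sum_smul,
      smul_smul]
    rw [Finset.sum_comm]
  funext k
  have h4 := congrArg (fun z => b.repr z k) h3
  simpa only [b.repr_sum_self] using h4

variable {K : Type*} [Field K] [CharZero K] {k : Type*} [Field k]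

/-- The `l`-th Fitting ideal does not vanish at a point if and only if the dimension of the fibre of
`A` is at most `l`. -/
theorem fittingA_le_ker_iff (hp : 1 < p) (hq : 1 < q) (σ : CoeffRing K p q →+* k) (l : ℕ) :
    fittingA K p q l ≤ RingHom.ker σ ↔ l < singDim (weierstrassPoly fun i => σ (X i)) := by
  have hpk : IsUnit (p : k) := isUnit_natCast_of_ringHom σ (by omega)
  have hqk : IsUnit (q : k) := isUnit_natCast_of_ringHom σ (by omega)
  have hpR : IsUnit (p : CoeffRing K p q) := isUnit_natCast_of_algebra K (by omega)
  have hqR : IsUnit (q : CoeffRing K p q) := isUnit_natCast_of_algebra K (by omega)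
  set M := critMatrix hp hq hpR hqR (fun i : Idx p q => (X i : CoeffRing K p q)) with hM
  have hMσ : critMatrix hp hq hpk hqk (fun i => σ (X i)) = M.map σ :=
    critMatrix_map σ hp hq hpR hqR hpk hqk _
  have hdim := singDim_add_rank hp hq hpk hqk (fun i => σ (X i))
  rw [hMσ] at hdim
  -- The subtraction is truncated: for `l` at least the number of generators the minor is the empty
  -- determinant `1` and the condition on the rank is void, so the equivalence still holds.
  have key : (∃ d ∈ fittingA K p q l, σ d ≠ 0) ↔
      Fintype.card (BasisIdx p q) - l ≤ (M.map σ).rank := by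
    constructor
    · rintro ⟨d, hd, hne⟩
      by_contra hlt
      suffices h : fittingA K p q l ≤ RingHom.ker σ from hne (h hd)
      rw [fittingA, fittingIdeal, Ideal.span_le]
      rintro _ ⟨v, g, hv, rfl⟩
      by_contra hne
      have hne' : σ (Matrix.of fun k j => v k (g j)).det ≠ 0 := hne
      rw [RingHom.map_det] at hne'
      -- All relations are combinations of rows of `M`, so each minor comes from a matrix product
      -- with right factor `M`, whose rank bounds the size of a minor that survives at the point.
      choose w hw using fun i => exists_vecMul_of_relation hp hq hpR hqR _ (v i) (hv i)
      have h1 : σ.mapMatrix (Matrix.of fun k j => v k (g j)) =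
          (((Matrix.of w).map σ) * (M.map σ)).submatrix id g := by
        rw [← Matrix.map_mul]
        ext i j
        simp only [RingHom.mapMatrix_apply, Matrix.map_apply, Matrix.of_apply,
          Matrix.submatrix_apply, id]
        congr 1
        exact congrFun (hw i) (g j)
      have h2 := Matrix.rank_of_det_ne_zero hne'
      rw [h1, Fintype.card_fin] at h2
      have h3 := (Matrix.rank_submatrix_le (((Matrix.of w).map σ) * (M.map σ)) id g).trans
        (Matrix.rank_mul_le_right _ _)
      omega
    · intro h
      obtain ⟨f, g, hfg⟩ := exists_submatrix_det_ne_zero (M.map σ) h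
      refine ⟨(Matrix.of fun k j => M (f k) (g j)).det,
        Ideal.subset_span ⟨fun k => M (f k), g, fun k => ?_, rfl⟩, ?_⟩
      · exact row_relation hp hq hpR hqR _ (f k)
      · rw [RingHom.map_det]
        exact hfg
  constructor
  · intro h
    by_contra hlt
    obtain ⟨d, hd, hne⟩ := key.mpr (by omega)
    exact hne (h hd)
  · intro h
    by_contra hle
    obtain ⟨d, hd, hne⟩ := SetLike.not_le_iff_exists.mp hle
    have := key.mp ⟨d, hd, hne⟩
    omega

end Fitting

/-! ### The unramified locus -/

section Nodal

variable {K : Type*} [Field K] {p q : ℕ}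

/-- The hypothesis `hσ` expresses that every element of `k` is a fraction of values of `σ`. It holds
for residue fields (`residueField_fraction`) and for evaluation at closed points. -/
theorem exists_clear_denominators {R k τ : Type*} [CommRing R] [Field k] (σ : R →+* k)
    (hσ : ∀ z : k, ∃ r s, σ s ≠ 0 ∧ σ s * z = σ r) (g : MvPolynomial τ k) :
    ∃ s G, σ s ≠ 0 ∧ map σ G = C (σ s) * g := by
  induction g using MvPolynomial.induction_on with
  | C c =>
    obtain ⟨r, s, hs, h⟩ := hσ c
    exact ⟨s, C r, hs, by rw [map_C, ← h, C_mul]⟩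
  | add f g hf hg =>
    obtain ⟨s, G, hs, h⟩ := hf
    obtain ⟨s', G', hs', h'⟩ := hg
    refine ⟨s * s', C s' * G + C s * G', by rw [map_mul]; exact mul_ne_zero hs hs', ?_⟩
    simp only [map_add, map_mul, map_C, h, h']
    ring
  | mul_X f i hf =>
    obtain ⟨s, G, hs, h⟩ := hf
    refine ⟨s, G * X i, hs, ?_⟩
    rw [map_mul, h, map_X, mul_assoc]

theorem exists_clear_denominators_ideal {R k τ : Type*} [CommRing R] [Field k] (σ : R →+* k)
    (hσ : ∀ z : k, ∃ r s, σ s ≠ 0 ∧ σ s * z = σ r) (J : Ideal (MvPolynomial τ R))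
    {g : MvPolynomial τ k} (hg : g ∈ J.map (map σ)) :
    ∃ s, ∃ G ∈ J, σ s ≠ 0 ∧ map σ G = C (σ s) * g := by
  refine Submodule.span_induction
    (p := fun g _ => ∃ s, ∃ G ∈ J, σ s ≠ 0 ∧ map σ G = C (σ s) * g) ?_ ?_ ?_ ?_ hg
  · rintro _ ⟨G, hG, rfl⟩
    exact ⟨1, G, hG, by simp, by simp⟩
  · exact ⟨1, 0, J.zero_mem, by simp, by simp⟩
  · rintro x y _ _ ⟨s, G, hG, hs, h⟩ ⟨s', G', hG', hs', h'⟩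
    refine ⟨s * s', C s' * G + C s * G', J.add_mem (J.mul_mem_left _ hG) (J.mul_mem_left _ hG'),
      by rw [map_mul]; exact mul_ne_zero hs hs', ?_⟩
    simp only [map_add, map_mul, map_C, h, h']
    ring
  · rintro a x _ ⟨s, G, hG, hs, h⟩
    obtain ⟨s', A, hs', h'⟩ := exists_clear_denominators σ hσ a
    refine ⟨s' * s, A * G, J.mul_mem_left _ hG, by rw [map_mul]; exact mul_ne_zero hs' hs, ?_⟩
    simp only [map_mul, h, h', smul_eq_mul]
    ring

/-- If a finite algebra `R[τ] / J` has an empty fibre over a point, then `J` contains an element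
of `R` that does not vanish at that point. -/
theorem exists_C_mem_of_map_eq_top {R k τ : Type*} [CommRing R] [Field k] (σ : R →+* k)
    (hσ : ∀ z : k, ∃ r s, σ s ≠ 0 ∧ σ s * z = σ r) (J : Ideal (MvPolynomial τ R))
    [Module.Finite R (MvPolynomial τ R ⧸ J)] (hJ : J.map (map σ) = ⊤) :
    ∃ r, C r ∈ J ∧ σ r ≠ 0 := by
  obtain ⟨s, G, hG, hs, h⟩ := exists_clear_denominators_ideal σ hσ J
    (g := 1) (by rw [hJ]; exact Submodule.mem_top)
  rw [mul_one] at h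
  -- `G` lies in `J` and reduces to the constant `σ s`, so multiplication by `s` maps `Q` into `(ker
  -- σ)Q`. The determinant trick gives a monic `P` with `P(s)` zero on `Q` and `P(s)` congruent to a
  -- power of `s` modulo `ker σ`.
  have h1 : C s - G ∈ (RingHom.ker σ).map (C : R →+* MvPolynomial τ R) := by
    rw [← MvPolynomial.ker_map, RingHom.mem_ker, map_sub, h, map_C, sub_self]
  let Q := MvPolynomial τ R ⧸ J
  have h2 : LinearMap.range (algebraMap R (Module.End R Q) s) ≤
      RingHom.ker σ • (⊤ : Submodule R Q) := by
    rintro _ ⟨y, rfl⟩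
    obtain ⟨g, rfl⟩ := Ideal.Quotient.mk_surjective y
    have h3 : (algebraMap R (Module.End R Q) s) (Ideal.Quotient.mk J g) =
        Ideal.Quotient.mk J ((C s - G) * g) := by
      rw [Module.algebraMap_end_apply, sub_mul, map_sub, Ideal.Quotient.eq_zero_iff_mem.mpr
        (J.mul_mem_right g hG), sub_zero, ← smul_eq_C_mul]
      rfl
    rw [h3]
    have h4 : (C s - G) * g ∈ (RingHom.ker σ).map (algebraMap R (MvPolynomial τ R)) :=
      Ideal.mul_mem_right _ _ h1
    have h5 : (C s - G) * g ∈ RingHom.ker σ • (⊤ : Submodule R (MvPolynomial τ R)) := by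
      rw [Ideal.smul_top_eq_map]
      exact h4
    have h6 := Submodule.mem_map_of_mem (f := (Ideal.Quotient.mkₐ R J).toLinearMap) h5
    rw [Submodule.map_smul''] at h6
    exact Submodule.smul_mono le_rfl le_top h6
  obtain ⟨P, hP, -, hcoeff, haeval⟩ :=
    LinearMap.exists_monic_and_natDegree_eq_and_coeff_mem_pow_and_aeval_eq_zero R _ _ h2
  refine ⟨P.eval s, ?_, ?_⟩
  · rw [Polynomial.aeval_algebraMap_apply_eq_algebraMap_eval] at haeval
    have := LinearMap.congr_fun haeval (1 : Q)
    rw [Module.algebraMap_end_apply, LinearMap.zero_apply] at this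
    rw [← Ideal.Quotient.eq_zero_iff_mem, ← this, ← map_one (Ideal.Quotient.mk J)]
    rw [← mul_one (C (P.eval s)), ← smul_eq_C_mul]
    rfl
  · have h3 : σ (P.eval s) = σ s ^ P.natDegree := by
      rw [Polynomial.eval_eq_sum_range, map_sum, Finset.sum_range_succ, Finset.sum_eq_zero,
        zero_add, map_mul, hP.coeff_natDegree, map_one, one_mul, map_pow]
      intro i hi
      have hi' := Finset.mem_range.mp hi
      have : P.coeff i ∈ RingHom.ker σ :=
        Ideal.pow_le_self (by omega) (hcoeff i)
      rw [map_mul, RingHom.mem_ker.mp this, zero_mul]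
    rw [h3]
    exact pow_ne_zero _ hs

theorem smul_kaehler_eq_zero {S : Type*} [CommRing S] (f : MvPolynomial (Fin 2) S)
    (I : Ideal (MvPolynomial (Fin 2) S)) (h0 : pderiv 0 f ∈ I) (h1 : pderiv 1 f ∈ I) {r : S}
    (hr : C r ∈ I ⊔ Ideal.span {hesse f}) (ω : Ω[(MvPolynomial (Fin 2) S ⧸ I)⁄S]) :
    r • ω = 0 := by
  obtain ⟨y, hy, z, hz, hyz⟩ := Submodule.mem_sup.mp hr
  obtain ⟨g, rfl⟩ := Ideal.mem_span_singleton'.mp hz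
  rw [← algebraMap_smul (MvPolynomial (Fin 2) S ⧸ I) r ω]
  have h1 : algebraMap S (MvPolynomial (Fin 2) S ⧸ I) r =
      Ideal.Quotient.mk I g * Ideal.Quotient.mk I (hesse f) := by
    change Ideal.Quotient.mk _ (C r) = _
    rw [← hyz, map_add, Ideal.Quotient.eq_zero_iff_mem.mpr hy, zero_add, map_mul]
  rw [h1, mul_smul, hesse_smul_kaehler f I h0 ‹_›, smul_zero]

/-- Differentials of `A` evaluated along a vector in the kernel of the Hesse matrix at a point. -/
theorem annihilator_mul_eq_zero {L : Type*} [Field L] (θ : PlaneRing K p q →+* L)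
    (hθ : ∀ g ∈ singIdeal (genericF K p q), θ g = 0) (u v : L)
    (h0 : θ (pderiv 0 (pderiv 0 (genericF K p q))) * u +
      θ (pderiv 0 (pderiv 1 (genericF K p q))) * v = 0)
    (h1 : θ (pderiv 0 (pderiv 1 (genericF K p q))) * u +
      θ (pderiv 1 (pderiv 1 (genericF K p q))) * v = 0)
    {r : CoeffRing K p q}
    (hr : r ∈ Module.annihilator (CoeffRing K p q) (Ω[SingAlg K p q⁄CoeffRing K p q])) :
    θ (C r) * u = 0 ∧ θ (C r) * v = 0 := by
  let J := singIdeal (genericF K p q)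
  let θ' : SingAlg K p q →+* L := Ideal.Quotient.lift J θ hθ
  have hθ' : ∀ g, θ' (Ideal.Quotient.mk J g) = θ g := fun g => Ideal.Quotient.lift_mk J θ hθ
  let _ : Algebra (SingAlg K p q) L := θ'.toAlgebra
  let _ : Algebra (CoeffRing K p q) L := (θ.comp C).toAlgebra
  have : IsScalarTower (CoeffRing K p q) (SingAlg K p q) L := 
    ⟨fun r z w => by
      obtain ⟨g, rfl⟩ := Ideal.Quotient.mk_surjective z
      change θ' (Ideal.Quotient.mk J (r • g)) * w = θ (C r) * (θ' (Ideal.Quotient.mk J g) * w)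
      rw [hθ', hθ', smul_eq_C_mul, map_mul, mul_assoc]⟩
  -- The directional derivative along `(u, v)` at the point `θ`. It descends to `A`: the gradient of
  -- `F` vanishes at `θ`, and those of `F_X`, `F_Y` are orthogonal to `(u, v)` by `h0`, `h1`.
  let d0 : PlaneRing K p q → L := fun g => θ (pderiv 0 g) * u + θ (pderiv 1 g) * v
  have hd0mul : ∀ f g, d0 (f * g) = θ f * d0 g + θ g * d0 f := by
    intro f g
    simp only [d0, pderiv_mul, map_add, map_mul]
    ring
  have hd0add : ∀ f g, d0 (f + g) = d0 f + d0 g := by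
    intro f g
    simp only [d0, map_add]
    ring
  have hd0J : ∀ g ∈ J, d0 g = 0 := by
    intro g hg
    obtain ⟨α, w, hw, rfl⟩ := Ideal.mem_span_insert.mp hg
    obtain ⟨β, γ, rfl⟩ := Ideal.mem_span_pair.mp hw
    have e0 := hθ (genericF K p q) (Ideal.subset_span (by simp))
    have e1 := hθ (pderiv 0 (genericF K p q)) (Ideal.subset_span (by simp))
    have e2 := hθ (pderiv 1 (genericF K p q)) (Ideal.subset_span (by simp))
    simp only [hd0add, hd0mul, e0, e1, e2, zero_mul, add_zero]
    simp only [d0, e1, e2, pderiv_comm, h0, h1]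
    ring
  have hd0C : ∀ r : CoeffRing K p q, d0 (C r) = 0 := by
    intro r
    simp [d0]
  let δ : SingAlg K p q → L := fun a => d0 (Ideal.Quotient.mk_surjective a).choose
  have hδ : ∀ g, δ (Ideal.Quotient.mk J g) = d0 g := by
    intro g
    have hg := (Ideal.Quotient.mk_surjective (Ideal.Quotient.mk J g)).choose_spec
    have h := hd0J _ ((Ideal.Quotient.mk_eq_mk_iff_sub_mem _ _).mp hg)
    have h' : d0 (Ideal.Quotient.mk_surjective (Ideal.Quotient.mk J g)).choose =
        d0 ((Ideal.Quotient.mk_surjective (Ideal.Quotient.mk J g)).choose - g) + d0 g := by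
      rw [← hd0add, sub_add_cancel]
    rw [h, zero_add] at h'
    exact h'
  let δl : SingAlg K p q →ₗ[CoeffRing K p q] L :=
    { toFun := δ
      map_add' := by
        intro x y
        obtain ⟨f, rfl⟩ := Ideal.Quotient.mk_surjective x
        obtain ⟨g, rfl⟩ := Ideal.Quotient.mk_surjective y
        rw [← map_add, hδ, hδ, hδ, hd0add]
      map_smul' := by
        intro c x
        obtain ⟨f, rfl⟩ := Ideal.Quotient.mk_surjective x
        rw [smul_mk_eq, ← map_mul, hδ, hδ, hd0mul, hd0C, mul_zero, add_zero, Algebra.smul_def]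
        rfl }
  let D : Derivation (CoeffRing K p q) (SingAlg K p q) L :=
    { toLinearMap := δl
      map_one_eq_zero' := by
        change δ 1 = 0
        rw [← map_one (Ideal.Quotient.mk J), hδ, ← C_1, hd0C]
      leibniz' := by
        intro x y
        obtain ⟨f, rfl⟩ := Ideal.Quotient.mk_surjective x
        obtain ⟨g, rfl⟩ := Ideal.Quotient.mk_surjective y
        change δ _ = _ • δ _ + _ • δ _
        rw [← map_mul, hδ, hδ, hδ, hd0mul, Algebra.smul_def, Algebra.smul_def]
        rfl }
  have key : ∀ g, θ (C r) * d0 g = 0 := by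
    intro g
    have h := Module.mem_annihilator.mp hr
      (KaehlerDifferential.D (CoeffRing K p q) (SingAlg K p q) (Ideal.Quotient.mk J g))
    have h' := congrArg ((D.liftKaehlerDifferential).restrictScalars (CoeffRing K p q)) h
    rw [map_smul, map_zero, LinearMap.restrictScalars_apply,
      Derivation.liftKaehlerDifferential_comp_D, Algebra.smul_def] at h'
    rw [← hδ]
    exact h'
  refine ⟨?_, ?_⟩
  · have := key (X 0)
    simpa [d0, pderiv_X] using this
  · have := key (X 1)
    simpa [d0, pderiv_X] using this

variable [CharZero K] {k : Type*} [Field k]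

/-- `A` is unramified at a point if and only if the Hesse determinant is invertible on the fibre. -/
theorem not_annihilator_le_ker_iff (hp : 1 < p) (hq : 1 < q) (σ : CoeffRing K p q →+* k)
    (hσ : ∀ z : k, ∃ r s, σ s ≠ 0 ∧ σ s * z = σ r) :
    ¬ Module.annihilator (CoeffRing K p q) (Ω[SingAlg K p q⁄CoeffRing K p q]) ≤ RingHom.ker σ ↔
      ∃ u, u * hessian (weierstrassPoly fun i => σ (X i)) - 1 ∈
        singIdeal (weierstrassPoly fun i => σ (X i)) := by
  set f := weierstrassPoly fun i => σ (X i) with hf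
  have hmapF : map σ (genericF K p q) = f := map_genericF σ
  constructor
  · intro h
    obtain ⟨r, hr, hne⟩ := SetLike.not_le_iff_exists.mp h
    by_contra hno
    -- If the Hesse determinant is not invertible on the fibre, it vanishes at a closed point with
    -- residue field `L`. A kernel vector of the Hesse matrix there is a nonzero tangent vector of
    -- the fibre, so no annihilator of the differentials can survive at the point.
    have hI : singIdeal f ⊔ Ideal.span {hessian f} ≠ ⊤ := by
      intro htop
      have h1 : (1 : MvPolynomial (Fin 2) k) ∈ singIdeal f ⊔ Ideal.span {hessian f} := by
        rw [htop]; exact Submodule.mem_top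
      obtain ⟨y, hy, z, hz, hyz⟩ := Submodule.mem_sup.mp h1
      obtain ⟨u, rfl⟩ := Ideal.mem_span_singleton'.mp hz
      refine hno ⟨u, ?_⟩
      rw [← hyz, sub_add_cancel_right]
      exact neg_mem hy
    obtain ⟨𝔪, hmax, hle⟩ := Ideal.exists_le_maximal _ hI
    let L := MvPolynomial (Fin 2) k ⧸ 𝔪
    let _ : Field L := Ideal.Quotient.field 𝔪
    let θ : PlaneRing K p q →+* L := (Ideal.Quotient.mk 𝔪).comp (map σ)
    have hθ : ∀ g ∈ singIdeal (genericF K p q), θ g = 0 := by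
      intro g hg
      have := map_mem_singIdeal σ hg
      rw [hmapF] at this
      exact Ideal.Quotient.eq_zero_iff_mem.mpr (hle (Ideal.mem_sup_left this))
    let H : Matrix (Fin 2) (Fin 2) L :=
      !![θ (pderiv 0 (pderiv 0 (genericF K p q))), θ (pderiv 0 (pderiv 1 (genericF K p q)));
        θ (pderiv 0 (pderiv 1 (genericF K p q))), θ (pderiv 1 (pderiv 1 (genericF K p q)))]
    have hdet : H.det = 0 := by
      have h1 : θ (hesse (genericF K p q)) = 0 := by
        change Ideal.Quotient.mk 𝔪 (map σ (hesse (genericF K p q))) = 0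
        rw [map_hesse, hmapF]
        exact Ideal.Quotient.eq_zero_iff_mem.mpr
          (hle (Ideal.mem_sup_right (Ideal.mem_span_singleton_self _)))
      rw [hesse, map_sub, map_mul, map_pow] at h1
      rw [Matrix.det_fin_two_of, ← h1]
      ring
    obtain ⟨w, hw0, hw⟩ := Matrix.exists_mulVec_eq_zero_iff.mpr hdet
    have hw1 := congrFun hw 0
    have hw2 := congrFun hw 1
    simp only [H, Matrix.mulVec, dotProduct, Fin.sum_univ_two, Matrix.of_apply, Matrix.cons_val_zero,
      Matrix.cons_val_one, Matrix.cons_val', Pi.zero_apply, Matrix.cons_val_fin_one] at hw1 hw2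
    obtain ⟨hu, hv⟩ := annihilator_mul_eq_zero θ hθ (w 0) (w 1) hw1 hw2 hr
    have hr0 : θ (C r) ≠ 0 := by
      have h1 : σ r ≠ 0 := hne
      have h2 : IsUnit (θ (C r)) := by
        change IsUnit (Ideal.Quotient.mk 𝔪 (map σ (C r)))
        rw [map_C]
        exact ((isUnit_iff_ne_zero.mpr h1).map C).map (Ideal.Quotient.mk 𝔪)
      exact h2.ne_zero
    apply hw0
    funext i
    fin_cases i
    · exact (mul_eq_zero.mp hu).resolve_left hr0
    · exact (mul_eq_zero.mp hv).resolve_left hr0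
  · rintro ⟨u, hu⟩ hle
    set J := singIdeal (genericF K p q) ⊔ Ideal.span {hesse (genericF K p q)} with hJ
    have hfin : Module.Finite (CoeffRing K p q) (PlaneRing K p q ⧸ J) := by
      have : Module.Finite (CoeffRing K p q)
          (PlaneRing K p q ⧸ singIdeal (genericF K p q)) := finite_sing hp hq (isUnit_natCast_of_algebra K (by omega))
        (isUnit_natCast_of_algebra K (by omega)) (fun i : Idx p q => (X i : CoeffRing K p q))
      exact Module.Finite.of_surjective (Ideal.Quotient.factorₐ (CoeffRing K p q)
        (le_sup_left : singIdeal (genericF K p q) ≤ J)).toLinearMap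
        (Ideal.Quotient.factor_surjective le_sup_left)
    -- The locus in `Spec A` where the Hesse determinant vanishes is finite over `R` and misses the
    -- point. Hence an element of `R` in `J` survives there, and all of `J` annihilates the
    -- differentials.
    have htop : J.map (map σ) = ⊤ := by
      have h1 : singIdeal f ≤ J.map (map σ) := by
        rw [Ideal.span_le]
        have h2 : ∀ g ∈ singIdeal (genericF K p q), map σ g ∈ J.map (map σ) :=
          fun g hg => Ideal.mem_map_of_mem _ (Ideal.mem_sup_left hg)
        rintro x (rfl | rfl | rfl)
        · rw [← hmapF]; exact h2 _ (Ideal.subset_span (by simp))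
        · rw [← hmapF, pderiv_map]; exact h2 _ (Ideal.subset_span (by simp))
        · rw [← hmapF, pderiv_map]; exact h2 _ (Ideal.subset_span (by simp))
      have h3 : hessian f ∈ J.map (map σ) := by
        rw [hessian_eq_hesse, ← hmapF, ← map_hesse]
        exact Ideal.mem_map_of_mem _ (Ideal.mem_sup_right (Ideal.mem_span_singleton_self _))
      rw [Ideal.eq_top_iff_one]
      have := Ideal.sub_mem _ (Ideal.mul_mem_left _ u h3) (h1 hu)
      rwa [sub_sub_cancel] at this
    obtain ⟨r, hrJ, hr⟩ := exists_C_mem_of_map_eq_top σ hσ J htop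
    apply hr
    apply hle
    rw [Module.mem_annihilator]
    intro ω
    exact smul_kaehler_eq_zero (genericF K p q) _ (Ideal.subset_span (by simp))
      (Ideal.subset_span (by simp)) hrJ ω

end Nodal

/-! ### Hypersurfaces in regular local rings -/

section Regular

open IsLocalRing

variable {R : Type*} [CommRing R] [IsLocalRing R] [IsNoetherianRing R]

omit [IsNoetherianRing R] in
theorem isLocalRing_quotient_span_singleton {x : R} (hx : x ∈ maximalIdeal R) :
    IsLocalRing (R ⧸ Ideal.span {x}) := by
  have : Nontrivial (R ⧸ Ideal.span {x}) :=
    Ideal.Quotient.nontrivial_iff.mpr fun h => (maximalIdeal.isMaximal R).ne_top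
      (top_le_iff.mp (h ▸ (Ideal.span_singleton_le_iff_mem _).mpr hx))
  exact .of_surjective' (Ideal.Quotient.mk _) Ideal.Quotient.mk_surjective

omit [IsNoetherianRing R] in
theorem map_mk_maximalIdeal {x : R} [IsLocalRing (R ⧸ Ideal.span {x})] :
    (maximalIdeal R).map (Ideal.Quotient.mk (Ideal.span {x})) =
      maximalIdeal (R ⧸ Ideal.span {x}) := by
  exact IsLocalRing.map_maximalIdeal_of_surjective _ Ideal.Quotient.mk_surjective

omit [IsNoetherianRing R] in
/-- An element of `𝔪 ∖ 𝔪²` can replace a member of a given finite system of generators of `𝔪`. -/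
theorem exists_maximalIdeal_eq_span_insert {s : Finset R}
    (hs : maximalIdeal R = Ideal.span (s : Set R)) {x : R} (hx : x ∈ maximalIdeal R)
    (hx2 : x ∉ maximalIdeal R ^ 2) :
    ∃ t : Finset R, t.card + 1 = s.card ∧ maximalIdeal R = Ideal.span (insert x (t : Set R)) := by
  classical
  obtain ⟨c, hc⟩ : ∃ c : R → R, ∑ g ∈ s, c g * g = x := by
    have : x ∈ Ideal.span (s : Set R) := hs ▸ hx
    exact Submodule.mem_span_finset'.mp this |>.elim fun f hf =>
      ⟨fun g => if h : g ∈ s then f ⟨g, h⟩ else 0, by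
        rw [← hf, ← Finset.sum_coe_sort]
        exact Finset.sum_congr rfl fun g _ => by simp⟩
  have hmem : ∀ g ∈ s, g ∈ maximalIdeal R := fun g hg => hs ▸ Ideal.subset_span hg
  obtain ⟨g, hg, hu⟩ : ∃ g ∈ s, IsUnit (c g) := by
    by_contra! hno
    apply hx2
    rw [← hc, pow_two]
    exact Ideal.sum_mem _ fun g hg => Ideal.mul_mem_mul (hno g hg) (hmem g hg)
  refine ⟨s.erase g, Finset.card_erase_add_one hg, le_antisymm ?_ ?_⟩
  · rw [hs, Ideal.span_le]
    intro y hy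
    by_cases h : y = g
    · subst h
      have h1 : c y * y = x - ∑ z ∈ s.erase y, c z * z := by
        rw [← hc, ← Finset.add_sum_erase s _ hg, add_sub_cancel_right]
      have h2 : c y * y ∈ Ideal.span (insert x ((s.erase y : Finset R) : Set R)) := by
        rw [h1]
        exact Ideal.sub_mem _ (Ideal.subset_span (by simp)) (Ideal.sum_mem _ fun z hz =>
          Ideal.mul_mem_left _ _ (Ideal.subset_span (Set.mem_insert_of_mem _ hz)))
      exact (Ideal.unit_mul_mem_iff_mem _ hu).mp h2
    · exact Ideal.subset_span (Set.mem_insert_of_mem _ (Finset.mem_coe.mpr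
        (Finset.mem_erase.mpr ⟨h, hy⟩)))
  · rw [Ideal.span_le]
    rintro y (rfl | hy)
    · exact hx
    · exact hmem y (Finset.mem_of_mem_erase hy)

/-- By exchange, `x` belongs to a minimal system of generators of the maximal ideal, and modulo `x`
this member drops out. -/
theorem spanFinrank_maximalIdeal_quotient_add_one_le {x : R} (hx : x ∈ maximalIdeal R)
    (hx2 : x ∉ maximalIdeal R ^ 2) [IsLocalRing (R ⧸ Ideal.span {x})] :
    (maximalIdeal (R ⧸ Ideal.span {x})).spanFinrank + 1 ≤ (maximalIdeal R).spanFinrank := by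
  classical
  obtain ⟨s, hs, hspan⟩ := Submodule.FG.exists_span_finset_card_eq_spanFinrank
    (maximalIdeal R).fg_of_isNoetherianRing
  obtain ⟨t, ht, hspan'⟩ := exists_maximalIdeal_eq_span_insert hspan.symm hx hx2
  have h1 : maximalIdeal (R ⧸ Ideal.span {x}) =
      Ideal.span ((t.image (Ideal.Quotient.mk (Ideal.span {x})) : Finset _) : Set _) := by
    rw [← map_mk_maximalIdeal, hspan', Ideal.map_span, Set.image_insert_eq,
      Ideal.Quotient.eq_zero_iff_mem.mpr (Ideal.mem_span_singleton_self x), Ideal.span_insert_zero,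
      Finset.coe_image]
  rw [← hs, ← ht, add_le_add_iff_right, h1]
  refine (Submodule.spanFinrank_span_le_ncard_of_finite (Finset.finite_toSet _)).trans ?_
  rw [Set.ncard_coe_finset]
  exact Finset.card_image_le

theorem ringKrullDim_le_quotient_add_one {x : R} (hx : x ∈ maximalIdeal R) :
    ringKrullDim R ≤ ringKrullDim (R ⧸ Ideal.span {x}) + 1 := by
  have := ringKrullDim_le_ringKrullDim_quotient_add_card ({x} : Finset R) (by
    rw [IsLocalRing.ringJacobson_eq_maximalIdeal]
    simpa using hx)
  rwa [Finset.coe_singleton, Finset.card_singleton, Nat.cast_one] at this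

/-- The quotient of a regular local ring by an element of `𝔪 ∖ 𝔪²` is regular. -/
theorem isRegularLocalRing_quotient_of_notMem_sq {R : Type*} [CommRing R] [IsRegularLocalRing R] {x : R}
    (hx : x ∈ maximalIdeal R) (hx2 : x ∉ maximalIdeal R ^ 2) :
    IsRegularLocalRing (R ⧸ Ideal.span {x}) := by
  have := isLocalRing_quotient_span_singleton hx
  apply IsRegularLocalRing.of_spanFinrank_maximalIdeal_le
  have h1 := spanFinrank_maximalIdeal_quotient_add_one_le hx hx2
  have h2 := ringKrullDim_le_quotient_add_one hx
  rw [← (isRegularLocalRing_iff R).mp ‹_›] at h2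
  have h3 : (((maximalIdeal (R ⧸ Ideal.span {x})).spanFinrank + 1 : ℕ) : WithBot ℕ∞) ≤
      ringKrullDim (R ⧸ Ideal.span {x}) + 1 := le_trans (by exact_mod_cast h1) h2
  push_cast at h3
  exact ENat.WithBot.add_le_add_one_right_iff.mp h3

/-- The quotient of a Noetherian local domain by a nonzero element of `𝔪²` is not regular. -/
theorem not_isRegularLocalRing_quotient_of_mem_sq [IsDomain R] {x : R} (hx0 : x ≠ 0)
    (hx2 : x ∈ maximalIdeal R ^ 2) : ¬ IsRegularLocalRing (R ⧸ Ideal.span {x}) := by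
  classical
  intro hreg
  have hx : x ∈ maximalIdeal R := Ideal.pow_le_self two_ne_zero hx2
  have hdim := ringKrullDim_quotient_succ_le_of_nonZeroDivisor (mem_nonZeroDivisors_of_ne_zero hx0)
  rw [← (isRegularLocalRing_iff _).mp hreg] at hdim
  obtain ⟨s, hs, hspan⟩ := Submodule.FG.exists_span_finset_card_eq_spanFinrank
    (maximalIdeal (R ⧸ Ideal.span {x})).fg_of_isNoetherianRing
  -- Lift a minimal system of generators from the quotient. Since `x ∈ 𝔪²`, Nakayama shows that the
  -- lifts already generate `𝔪`: the embedding dimension does not drop, whereas the Krull dimension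
  -- does.
  choose f hf using (Ideal.Quotient.mk_surjective (I := Ideal.span {x}))
  set t := s.image f with ht
  have ht' : (Ideal.span (t : Set R)).map (Ideal.Quotient.mk (Ideal.span {x})) =
      (maximalIdeal R).map (Ideal.Quotient.mk (Ideal.span {x})) := by
    rw [map_mk_maximalIdeal, ← hspan, Ideal.map_span, ht, Finset.coe_image, Set.image_image]
    simp only [hf, Set.image_id']
  have hle : maximalIdeal R ≤ Ideal.span (t : Set R) ⊔ maximalIdeal R • maximalIdeal R := by
    intro y hy
    have h1 : Ideal.Quotient.mk (Ideal.span {x}) y ∈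
        (Ideal.span (t : Set R)).map (Ideal.Quotient.mk (Ideal.span {x})) :=
      ht' ▸ Ideal.mem_map_of_mem _ hy
    obtain ⟨z, hz, hzy⟩ := (Ideal.mem_map_iff_of_surjective _ Ideal.Quotient.mk_surjective).mp h1
    have h2 : y - z ∈ Ideal.span {x} := (Ideal.Quotient.mk_eq_mk_iff_sub_mem _ _).mp hzy.symm
    rw [← add_sub_cancel z y]
    refine Submodule.add_mem_sup hz ?_
    rw [smul_eq_mul, ← pow_two]
    exact (Ideal.span_singleton_le_iff_mem _).mpr hx2 h2
  have hle' := Submodule.le_of_le_smul_of_le_jacobson_bot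
    (maximalIdeal R).fg_of_isNoetherianRing (IsLocalRing.maximalIdeal_le_jacobson ⊥) hle
  have heq : Ideal.span (t : Set R) = maximalIdeal R := by
    refine le_antisymm ?_ hle'
    intro y hy
    have h1 : Ideal.Quotient.mk (Ideal.span {x}) y ∈
        (maximalIdeal R).map (Ideal.Quotient.mk (Ideal.span {x})) :=
      ht' ▸ Ideal.mem_map_of_mem _ hy
    obtain ⟨z, hz, hzy⟩ := (Ideal.mem_map_iff_of_surjective _ Ideal.Quotient.mk_surjective).mp h1
    have h2 : y - z ∈ Ideal.span {x} := (Ideal.Quotient.mk_eq_mk_iff_sub_mem _ _).mp hzy.symm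
    rw [← add_sub_cancel z y]
    exact Ideal.add_mem _ hz ((Ideal.span_singleton_le_iff_mem _).mpr hx h2)
  have h3 : (maximalIdeal R).spanFinrank ≤ s.card := by
    rw [← heq]
    refine (Submodule.spanFinrank_span_le_ncard_of_finite (Finset.finite_toSet _)).trans ?_
    rw [Set.ncard_coe_finset]
    exact Finset.card_image_le
  have h4 := ringKrullDim_le_spanFinrank_maximalIdeal R
  have h5 : ((s.card + 1 : ℕ) : WithBot ℕ∞) ≤ (s.card : ℕ) := by
    rw [hs] at h3 ⊢
    push_cast
    exact hdim.trans (h4.trans (by exact_mod_cast h3))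
  have : s.card + 1 ≤ s.card := by exact_mod_cast h5
  omega

end Regular

/-! ### Regular local rings are domains -/

section Domain

open IsLocalRing

/-- Induction on the embedding dimension. Prime avoidance yields `x ∈ 𝔪` outside `𝔪²` and all
minimal primes; `R/(x)` is regular of smaller dimension, so `(x)` is prime, and a minimal prime
below it vanishes by Nakayama. -/
theorem isDomain_of_spanFinrank_eq (n : ℕ) : ∀ (R : Type*) [CommRing R] [IsRegularLocalRing R],
    (maximalIdeal R).spanFinrank = n → IsDomain R := by
  induction n with
  | zero =>
    intro R _ _ h
    have hbot : maximalIdeal R = ⊥ :=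
      (Submodule.spanFinrank_eq_zero_iff_eq_bot (maximalIdeal R).fg_of_isNoetherianRing).mp h
    exact (IsLocalRing.isField_iff_maximalIdeal_eq.mpr hbot).isDomain
  | succ n ih =>
    intro R _ _ h
    have hdim := (isRegularLocalRing_iff R).mp ‹_›
    rw [h] at hdim
    have hfg := (maximalIdeal R).fg_of_isNoetherianRing
    have hjac := IsLocalRing.maximalIdeal_le_jacobson (⊥ : Ideal R)
    have hfin := minimalPrimes.finite_of_isNoetherianRing R
    obtain ⟨x, hx, hxn⟩ : ∃ x ∈ maximalIdeal R,
        x ∉ maximalIdeal R ^ 2 ∧ ∀ P ∈ minimalPrimes R, x ∉ P := by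
      by_contra! hno
      -- Prime avoidance tolerates two ideals that need not be prime; `𝔪²` fills both places.
      have hsub : (maximalIdeal R : Set R) ⊆ (maximalIdeal R ^ 2 : Ideal R) ∪
          (maximalIdeal R ^ 2 : Ideal R) ∪ ⋃ P ∈ (hfin.toFinset : Set (Ideal R)), (P : Set R) := by
        intro x hx
        by_cases hx2 : x ∈ maximalIdeal R ^ 2
        · exact Or.inl (Or.inl hx2)
        · obtain ⟨P, hP, hxP⟩ := hno x hx hx2
          exact Or.inr (Set.mem_biUnion (by simpa using hP) hxP)
      have hsq : ¬ maximalIdeal R ≤ maximalIdeal R ^ 2 := by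
        intro hle
        rw [pow_two] at hle
        have := Submodule.eq_bot_of_le_smul_of_le_jacobson_bot _ _ hfg hle hjac
        rw [(Submodule.spanFinrank_eq_zero_iff_eq_bot hfg).mpr this] at h
        omega
      rcases (Ideal.subset_union_prime' (s := hfin.toFinset) (f := fun P : Ideal R => P)
        (a := maximalIdeal R ^ 2) (b := maximalIdeal R ^ 2)
        (fun P hP => ((hfin.mem_toFinset).mp hP).1.1)).mp hsub with h1 | h1 | ⟨P, hP, h1⟩
      · exact hsq h1
      · exact hsq h1
      · have hP' := (hfin.mem_toFinset).mp hP
        have hPp : P.IsPrime := hP'.1.1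
        have hPm : P = maximalIdeal R := le_antisymm (IsLocalRing.le_maximalIdeal hPp.ne_top) h1
        rw [hPm, ← Ideal.height_eq_zero_iff] at hP'
        rw [← IsLocalRing.maximalIdeal_height_eq_ringKrullDim, hP'] at hdim
        have : n + 1 = 0 := by exact_mod_cast hdim
        omega
    have hloc := isLocalRing_quotient_span_singleton hx
    have hreg := isRegularLocalRing_quotient_of_notMem_sq hx hxn.1
    have hrank : (maximalIdeal (R ⧸ Ideal.span {x})).spanFinrank = n := by
      have h1 := spanFinrank_maximalIdeal_quotient_add_one_le hx hxn.1
      have h2 := ringKrullDim_le_quotient_add_one hx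
      rw [← hdim, ← (isRegularLocalRing_iff _).mp hreg] at h2
      have h3 : n + 1 ≤ (maximalIdeal (R ⧸ Ideal.span {x})).spanFinrank + 1 := by
        exact_mod_cast h2
      omega
    have hdom := ih _ hrank
    have hprime : (Ideal.span {x}).IsPrime := (Ideal.Quotient.isDomain_iff_prime _).mp hdom
    obtain ⟨P, hP, hPx⟩ := Ideal.exists_minimalPrimes_le (I := (⊥ : Ideal R)) (J := Ideal.span {x})
      bot_le
    have hPp : P.IsPrime := hP.1.1
    -- An element of `P ⊆ (x)` has the form `z x`, and `x ∉ P` forces `z ∈ P`; thus `P = xP`.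
    have hPle : P ≤ maximalIdeal R • P := by
      intro y hy
      obtain ⟨z, rfl⟩ := Ideal.mem_span_singleton'.mp (hPx hy)
      rw [smul_eq_mul, mul_comm z x]
      exact Ideal.mul_mem_mul hx ((hPp.mem_or_mem hy).resolve_right (hxn.2 P hP))
    have hPbot := Submodule.eq_bot_of_le_smul_of_le_jacobson_bot _ _
      P.fg_of_isNoetherianRing hPle hjac
    have : (⊥ : Ideal R).IsPrime := hPbot ▸ hPp
    exact IsDomain.of_bot_isPrime R

theorem isDomain_of_isRegularLocalRing (R : Type*) [CommRing R] [IsRegularLocalRing R] :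
    IsDomain R :=
  isDomain_of_spanFinrank_eq _ R rfl

end Domain

/-! ### Regularity of power series rings and series of order one -/

section PowerSeries

open IsLocalRing

/-- The new variable together with generators of `𝔪` generates the maximal ideal, so the embedding
dimension grows by at most one, while the Krull dimension grows by at least one. -/
theorem isRegularLocalRing_powerSeries (R : Type*) [CommRing R] [IsRegularLocalRing R] :
    IsRegularLocalRing (PowerSeries R) := by
  classical
  apply IsRegularLocalRing.of_spanFinrank_maximalIdeal_le
  refine le_trans ?_ ringKrullDim_succ_le_ringKrullDim_powerseries
  rw [← (isRegularLocalRing_iff R).mp ‹_›]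
  obtain ⟨s, hs, hspan⟩ := Submodule.FG.exists_span_finset_card_eq_spanFinrank
    (maximalIdeal R).fg_of_isNoetherianRing
  have hle : maximalIdeal (PowerSeries R) =
      Ideal.span ((insert PowerSeries.X (s.image PowerSeries.C) : Finset (PowerSeries R)) :
        Set (PowerSeries R)) := by
    apply le_antisymm
    · intro f hf
      rw [Finset.coe_insert, Finset.coe_image]
      have h1 : PowerSeries.constantCoeff f ∈ maximalIdeal R := by
        rw [mem_maximalIdeal, mem_nonunits_iff] at hf ⊢
        exact fun h => hf (PowerSeries.isUnit_iff_constantCoeff.mpr h)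
      rw [← hspan] at h1
      have h2 := Ideal.mem_map_of_mem PowerSeries.C h1
      change _ ∈ (Ideal.span (s : Set R)).map PowerSeries.C at h2
      rw [Ideal.map_span] at h2
      have h3 : f - PowerSeries.C (PowerSeries.constantCoeff f) ∈ Ideal.span {PowerSeries.X} := by
        rw [Ideal.mem_span_singleton, PowerSeries.X_dvd_iff]
        simp
      rw [← sub_add_cancel f (PowerSeries.C (PowerSeries.constantCoeff f))]
      exact Ideal.add_mem _ (Ideal.span_mono (by simp) h3) (Ideal.span_mono (by simp) h2)
    · rw [Ideal.span_le]
      intro f hf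
      rw [SetLike.mem_coe, mem_maximalIdeal, mem_nonunits_iff, PowerSeries.isUnit_iff_constantCoeff]
      rcases Finset.mem_insert.mp (Finset.mem_coe.mp hf) with rfl | hf
      · simp
      · obtain ⟨g, hg, rfl⟩ := Finset.mem_image.mp hf
        rw [PowerSeries.constantCoeff_C]
        have : g ∈ maximalIdeal R := hspan ▸ Ideal.subset_span hg
        exact this
  have h2 : (maximalIdeal (PowerSeries R)).spanFinrank ≤ s.card + 1 := by
    rw [hle]
    refine (Submodule.spanFinrank_span_le_ncard_of_finite (Finset.finite_toSet _)).trans ?_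
    rw [Set.ncard_coe_finset]
    exact (Finset.card_insert_le _ _).trans (by gcongr; exact Finset.card_image_le)
  rw [← hs]
  exact_mod_cast h2

theorem isRegularLocalRing_mvPowerSeries (σ R : Type*) [Finite σ] [CommRing R]
    [IsRegularLocalRing R] : IsRegularLocalRing (MvPowerSeries σ R) := by
  induction σ using Finite.induction_empty_option with
  | of_equiv e H =>
    have := H
    exact .of_ringEquiv (MvPowerSeries.renameEquiv R e).toRingEquiv
  | h_empty => exact .of_ringEquiv (MvPowerSeries.isEmptyEquiv PEmpty R).symm.toRingEquiv
  | @h_option τ _ IH =>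
    have := isRegularLocalRing_powerSeries (MvPowerSeries τ R)
    exact .of_ringEquiv (MvPowerSeries.optionEquivLeft τ R).symm.toRingEquiv

theorem coeff_single_eq_zero_of_mem_sq {σ k : Type*} [Field k] {f : MvPowerSeries σ k}
    (hf : f ∈ maximalIdeal (MvPowerSeries σ k) ^ 2) (i : σ) :
    MvPowerSeries.coeff (Finsupp.single i 1) f = 0 := by
  rw [pow_two] at hf
  have hc : ∀ g ∈ maximalIdeal (MvPowerSeries σ k), 1 ≤ g.order := fun g hg => by
    rw [MvPowerSeries.one_le_order_iff_constCoeff_eq_zero]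
    by_contra h
    exact hg (MvPowerSeries.isUnit_iff_constantCoeff.mpr (isUnit_iff_ne_zero.mpr h))
  refine Submodule.mul_induction_on hf (fun a ha b hb => ?_) fun a b ha hb => ?_
  · refine MvPowerSeries.coeff_of_lt_order (lt_of_lt_of_le ?_
      ((add_le_add (hc a ha) (hc b hb)).trans MvPowerSeries.le_order_mul))
    simp only [Finsupp.degree_single, Nat.cast_one]
    exact_mod_cast Nat.lt_succ_self 1
  · rw [map_add, ha, hb, add_zero]

/-- A power series of order one with a nonzero linear part generates a prime ideal with regular
quotient. -/
theorem isRegularLocalRing_quotient_mvPowerSeries {σ k : Type*} [Finite σ] [Field k]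
    {f : MvPowerSeries σ k} (h0 : MvPowerSeries.constantCoeff f = 0) {i : σ}
    (hi : MvPowerSeries.coeff (Finsupp.single i 1) f ≠ 0) :
    IsRegularLocalRing (MvPowerSeries σ k ⧸ Ideal.span {f}) := by
  have := isRegularLocalRing_mvPowerSeries σ k
  refine isRegularLocalRing_quotient_of_notMem_sq ?_ fun h => hi (coeff_single_eq_zero_of_mem_sq h i)
  rw [mem_maximalIdeal, mem_nonunits_iff, MvPowerSeries.isUnit_iff_constantCoeff, h0]
  simp

/-- The quotient is regular and hence a domain; no factorization theory for power series is needed.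
-/
theorem prime_mvPowerSeries {σ k : Type*} [Finite σ] [Field k]
    {f : MvPowerSeries σ k} (h0 : MvPowerSeries.constantCoeff f = 0) {i : σ}
    (hi : MvPowerSeries.coeff (Finsupp.single i 1) f ≠ 0) : Prime f := by
  have := isRegularLocalRing_quotient_mvPowerSeries h0 hi
  have := isDomain_of_isRegularLocalRing (MvPowerSeries σ k ⧸ Ideal.span {f})
  refine (Ideal.span_singleton_prime ?_).mp ((Ideal.Quotient.isDomain_iff_prime _).mp this)
  rintro rfl
  simp at hi

end PowerSeries

/-! ### Determinants of matrices of corank at least two -/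

section Rank

variable {ι k : Type*} [Fintype ι] [DecidableEq ι] [Field k]

theorem rank_updateRow_le (A : Matrix ι ι k) (i : ι) (r : ι → k) :
    (A.updateRow i r).rank ≤ A.rank + 1 := by
  have h : A.updateRow i r = A + Matrix.vecMulVec (Pi.single i 1) (r - A i) := by
    ext a b
    by_cases h : a = i
    · subst h
      simp [Matrix.vecMulVec_apply]
    · simp [Matrix.vecMulVec_apply, h]
  rw [h, Matrix.rank, Matrix.mulVecLin_add]
  refine (Submodule.finrank_mono (LinearMap.range_add_le _ _)).trans ?_
  refine (Submodule.finrank_add_le_finrank_add_finrank _ _).trans ?_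
  exact Nat.add_le_add_left (Matrix.rank_vecMulVec_le _ _) _

/-- An entry of the adjugate is the determinant after replacing one row, and this raises the rank by
at most one. -/
theorem adjugate_eq_zero_of_rank (A : Matrix ι ι k) (h : A.rank + 1 < Fintype.card ι) :
    A.adjugate = 0 := by
  ext i j
  rw [Matrix.adjugate_apply, Matrix.zero_apply]
  by_contra hne
  have h1 := Matrix.rank_of_det_ne_zero hne
  have h2 := rank_updateRow_le A j (Pi.single i 1)
  omega

theorem exists_clear_denominators_vector {R : Type*} [CommRing R] (σ : R →+* k)
    (hσ : ∀ z : k, ∃ r s, σ s ≠ 0 ∧ σ s * z = σ r) (v : ι → k) :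
    ∃ (w : ι → R) (c : k), c ≠ 0 ∧ ∀ i, σ (w i) = c * v i := by
  choose r s hs h using hσ
  refine ⟨fun i => r (v i) * ∏ j ∈ Finset.univ.erase i, s (v j), ∏ j, σ (s (v j)),
    Finset.prod_ne_zero_iff.mpr fun j _ => hs _, fun i => ?_⟩
  rw [map_mul, ← h, map_prod, ← Finset.mul_prod_erase _ _ (Finset.mem_univ i)]
  ring

/-- If the reduction of a square matrix modulo a prime ideal has corank at least two, then its
determinant has order at least two at this prime. -/
theorem exists_mul_det_mem_sq {R : Type*} [CommRing R] (σ : R →+* k)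
    (hσ : ∀ z : k, ∃ r s, σ s ≠ 0 ∧ σ s * z = σ r) (A : Matrix ι ι R)
    (h : (A.map σ).rank + 1 < Fintype.card ι) :
    ∃ s, σ s ≠ 0 ∧ s * A.det ∈ RingHom.ker σ ^ 2 := by
  have hadj : ∀ i j, A.adjugate i j ∈ RingHom.ker σ := fun i j => by
    have h1 := adjugate_eq_zero_of_rank _ h
    have h2 : σ.mapMatrix A.adjugate = 0 := by
      rw [RingHom.map_adjugate]; exact h1
    exact congrFun (congrFun h2 i) j
  have hdet : (A.map σ).det = 0 := by
    by_contra hne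
    have := Matrix.rank_of_det_ne_zero hne
    omega
  -- A left kernel vector of the reduction, cleared of denominators, gives `w` with `wA` in `ker σ`.
  -- The adjugate has entries in `ker σ` too, and `(wA) adj A = det A · w` puts `wᵢ det A` into the
  -- square.
  obtain ⟨v, hv0, hv⟩ := Matrix.exists_vecMul_eq_zero_iff.mpr hdet
  obtain ⟨w, c, hc, hw⟩ := exists_clear_denominators_vector σ hσ v
  obtain ⟨i, hi⟩ := Function.ne_iff.mp hv0
  refine ⟨w i, by rw [hw]; exact mul_ne_zero hc hi, ?_⟩
  have h1 : ∀ j, Matrix.vecMul w A j ∈ RingHom.ker σ := fun j => by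
    have h2 := congrFun hv j
    rw [RingHom.mem_ker, Matrix.vecMul, dotProduct, map_sum]
    simp only [map_mul, hw, mul_assoc]
    rw [← Finset.mul_sum]
    simp only [Matrix.vecMul, dotProduct, Matrix.map_apply] at h2
    rw [h2, Pi.zero_apply, mul_zero]
  have h3 : w i * A.det = ∑ j, Matrix.vecMul w A j * A.adjugate j i := by
    have h4 : Matrix.vecMul (Matrix.vecMul w A) A.adjugate i = A.det * w i := by
      rw [Matrix.vecMul_vecMul, Matrix.mul_adjugate, Matrix.vecMul_smul, Matrix.vecMul_one]
      rfl
    rw [mul_comm, ← h4]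
    rfl
  rw [h3, pow_two]
  exact Ideal.sum_mem _ fun j _ => Ideal.mul_mem_mul (h1 j) (hadj j i)

end Rank

/-! ### The strata by fibre length and the regular points -/

section Loci

variable {K : Type*} [Field K] [CharZero K] {p q : ℕ} {k : Type*} [Field k]

theorem mem_nodalLocus_iff (hp : 1 < p) (hq : 1 < q) (σ : CoeffRing K p q →+* k)
    (hσ : ∀ z : k, ∃ r s, σ s ≠ 0 ∧ σ s * z = σ r) {x : PrimeSpectrum (CoeffRing K p q)}
    (hx : RingHom.ker σ = x.asIdeal) :
    x ∈ nodalLocus K p q ↔ 0 < singDim (weierstrassPoly fun i => σ (X i)) ∧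
      ∃ u, u * hessian (weierstrassPoly fun i => σ (X i)) - 1 ∈
        singIdeal (weierstrassPoly fun i => σ (X i)) := by
  rw [← not_annihilator_le_ker_iff hp hq σ hσ, singDim_pos_iff_le_ker hp hq, hx]
  rfl

/-- By the Fitting criterion, `U_l` consists of the unramified points of `ℋ` with fibre length at
most `l`, so the difference fixes the length. -/
theorem mem_exactLocus_iff (hp : 1 < p) (hq : 1 < q) (σ : CoeffRing K p q →+* k)
    (hσ : ∀ z : k, ∃ r s, σ s ≠ 0 ∧ σ s * z = σ r) {x : PrimeSpectrum (CoeffRing K p q)}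
    (hx : RingHom.ker σ = x.asIdeal) {l : ℕ} (hl : 1 ≤ l) :
    x ∈ exactLocus K p q l ↔ singDim (weierstrassPoly fun i => σ (X i)) = l ∧
      ∃ u, u * hessian (weierstrassPoly fun i => σ (X i)) - 1 ∈
        singIdeal (weierstrassPoly fun i => σ (X i)) := by
  have hF : ∀ m, x ∈ PrimeSpectrum.zeroLocus (fittingA K p q m : Set (CoeffRing K p q)) ↔
      m < singDim (weierstrassPoly fun i => σ (X i)) := fun m => by
    rw [← fittingA_le_ker_iff hp hq σ m, hx]
    rfl
  have hA : ∀ m, x ∈ atMostLocus K p q (m + 1) ↔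
      x ∈ nodalLocus K p q ∧ ¬ m + 1 < singDim (weierstrassPoly fun i => σ (X i)) := fun m => by
    rw [← hF]
    rfl
  obtain ⟨m, rfl⟩ := Nat.exists_eq_add_of_le' hl
  rw [exactLocus, Set.mem_sdiff, hA, mem_nodalLocus_iff hp hq σ hσ hx]
  cases m with
  | zero =>
    -- For `l = 1` the removed set `U_0` is empty; the lower bound on the length comes from lying on
    -- `ℋ`.
    have h0 : x ∉ atMostLocus K p q (0 + 1 - 1) := fun h => h
    refine ⟨fun h => ⟨?_, h.1.1.2⟩, fun h => ⟨⟨⟨?_, h.2⟩, ?_⟩, h0⟩⟩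
    · have := h.1.1.1
      have := h.1.2
      omega
    all_goals omega
  | succ m =>
    rw [Nat.add_sub_cancel, hA, mem_nodalLocus_iff hp hq σ hσ hx]
    constructor
    · rintro ⟨⟨h1, h2⟩, h3⟩
      refine ⟨?_, h1.2⟩
      by_contra hne
      exact h3 ⟨h1, by omega⟩
    · rintro ⟨h1, h2⟩
      exact ⟨⟨⟨by omega, h2⟩, by omega⟩, fun h => h.2 (by omega)⟩

theorem residueField_fraction {R : Type*} [CommRing R] (I : Ideal R) [I.IsPrime]
    (z : I.ResidueField) : ∃ r s, algebraMap R I.ResidueField s ≠ 0 ∧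
      algebraMap R I.ResidueField s * z = algebraMap R I.ResidueField r := by
  obtain ⟨y, rfl⟩ := IsLocalRing.residue_surjective z
  obtain ⟨⟨r, s⟩, h⟩ := IsLocalization.surj I.primeCompl y
  refine ⟨r, s, fun h0 => s.2 (Ideal.algebraMap_residueField_eq_zero.mp h0), ?_⟩
  have h2 := congrArg (IsLocalRing.residue (Localization.AtPrime I)) h
  rw [map_mul] at h2
  rw [mul_comm]
  exact h2

theorem mem_maximalIdeal_sq_iff {R : Type*} [CommRing R] [IsDomain R] (I : Ideal R) [I.IsPrime]
    (z : R) : algebraMap R (Localization.AtPrime I) z ∈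
      IsLocalRing.maximalIdeal (Localization.AtPrime I) ^ 2 ↔ ∃ s ∉ I, s * z ∈ I ^ 2 := by
  rw [← Localization.AtPrime.map_eq_maximalIdeal, ← Ideal.map_pow,
    IsLocalization.mem_map_algebraMap_iff I.primeCompl]
  constructor
  · rintro ⟨⟨y, s⟩, h⟩
    refine ⟨s, s.2, ?_⟩
    rw [← map_mul] at h
    have := IsLocalization.injective (Localization.AtPrime I) I.primeCompl_le_nonZeroDivisors h
    rw [mul_comm, this]
    exact y.2
  · rintro ⟨s, hs, h⟩
    exact ⟨⟨⟨_, h⟩, ⟨s, hs⟩⟩, by rw [← map_mul, mul_comm]⟩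

theorem pderiv_mem_of_mem_sq {τ S : Type*} [CommRing S] (I : Ideal (MvPolynomial τ S)) (i : τ)
    {f : MvPolynomial τ S} (hf : f ∈ I ^ 2) : pderiv i f ∈ I := by
  rw [pow_two] at hf
  refine Submodule.mul_induction_on hf (fun a ha b hb => ?_) fun a b ha hb => ?_
  · rw [pderiv_mul]
    exact I.add_mem (I.mul_mem_left _ hb) (I.mul_mem_right _ ha)
  · rw [map_add]
    exact I.add_mem ha hb

/-- The points with a fibre of length one are the regular points of the nodal locus. -/
theorem exactLocus_one_eq (hp : 1 < p) (hq : 1 < q) : exactLocus K p q 1 =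
    {x ∈ nodalLocus K p q | IsRegularLocalRing (LocalRingAt K p q x)} := by
  ext x
  set σ := algebraMap (CoeffRing K p q) x.asIdeal.ResidueField with hσdef
  have hσ := residueField_fraction x.asIdeal
  have hx : RingHom.ker σ = x.asIdeal := x.asIdeal.ker_algebraMap_residueField
  rw [mem_exactLocus_iff hp hq σ hσ hx le_rfl, Set.mem_ofPred_eq,
    mem_nodalLocus_iff hp hq σ hσ hx]
  set d := singDim (weierstrassPoly fun i => σ (X i)) with hd
  let L := Localization.AtPrime x.asIdeal
  have hI : (hypersurfaceIdeal K p q).map (algebraMap _ L) =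
      Ideal.span {algebraMap _ L (disc K p q)} := by
    rw [(irreducible_disc_and_hypersurfaceIdeal_eq hp hq).2, Ideal.map_span, Set.image_singleton]
  have hreg : IsRegularLocalRing (LocalRingAt K p q x) ↔
      IsRegularLocalRing (L ⧸ Ideal.span {algebraMap _ L (disc K p q)}) := by
    rw [← hI]
  rw [hreg]
  have hmem : 0 < d → disc K p q ∈ x.asIdeal := fun h => by
    rw [← hx]
    exact (singDim_pos_iff_le_ker hp hq σ).mp h (disc_mem_hypersurfaceIdeal hp hq)
  constructor
  · rintro ⟨h1, u, hu⟩
    refine ⟨⟨by omega, u, hu⟩, isRegularLocalRing_quotient_of_notMem_sq ?_ ?_⟩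
    · rw [← Localization.AtPrime.map_eq_maximalIdeal]
      exact Ideal.mem_map_of_mem _ (hmem (by omega))
    · rw [mem_maximalIdeal_sq_iff]
      rintro ⟨s, hs, h⟩
      -- Differentiating `sΔ ∈ 𝔭²` gives `s ∂Δ ∈ 𝔭`, because `Δ ∈ 𝔭`. This contradicts the simple
      -- zero of `Δ` along the constant coefficient.
      have h2 := pderiv_mem_of_mem_sq _ (idxOne hp hq) h
      rw [pderiv_mul] at h2
      have h3 := (Ideal.add_mem_iff_right _ (Ideal.mul_mem_left _ _ (hmem (by omega)))).mp h2
      have h4 := (x.2.mem_or_mem h3).resolve_left hs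
      rw [← hx] at h4
      exact map_pderiv_disc_ne_zero hp hq σ hu h1 h4
  · rintro ⟨⟨h1, u, hu⟩, hr⟩
    refine ⟨?_, u, hu⟩
    by_contra hne
    refine not_isRegularLocalRing_quotient_of_mem_sq ?_ ?_ hr
    · intro h0
      exact disc_ne_zero hp hq (IsLocalization.injective L
        x.asIdeal.primeCompl_le_nonZeroDivisors (h0.trans (map_zero _).symm))
    · rw [mem_maximalIdeal_sq_iff, ← hx]
      have hpk : IsUnit (p : x.asIdeal.ResidueField) := isUnit_natCast_of_ringHom σ (by omega)
      have hqk : IsUnit (q : x.asIdeal.ResidueField) := isUnit_natCast_of_ringHom σ (by omega)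
      have hpR : IsUnit (p : CoeffRing K p q) := isUnit_natCast_of_algebra K (by omega)
      have hqR : IsUnit (q : CoeffRing K p q) := isUnit_natCast_of_algebra K (by omega)
      have hrank := singDim_add_rank hp hq hpk hqk (fun i => σ (X i))
      rw [critMatrix_map σ hp hq hpR hqR hpk hqk (fun i : Idx p q => (X i : CoeffRing K p q)),
        ← hd] at hrank
      have hdet := disc_eq_det K hp hq
      rw [genericMatrix] at hdet
      rw [hdet]
      -- A positive fibre length different from one means that `M` has corank at least two at the
      -- point.
      exact exists_mul_det_mem_sq σ hσ (critMatrix hp hq hpR hqR _) (by omega)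

end Loci

/-! ### Singular points over an algebraically closed field -/

section Nullstellensatz

variable {K : Type*} [Field K]

theorem aeval_apply_eq_eval {τ : Type*} (P : τ → K) (g : MvPolynomial τ K) :
    aeval P g = eval P g :=
  DFunLike.congr_fun (coe_aeval_eq_eval P) g

theorem eval_eq_zero_of_mem_singIdeal {f : MvPolynomial (Fin 2) K} {P : Fin 2 → K}
    (hP : P ∈ singularPoints f) {g : MvPolynomial (Fin 2) K} (hg : g ∈ singIdeal f) :
    eval P g = 0 := by
  have h : singIdeal f ≤ RingHom.ker (eval P) := by
    rw [Ideal.span_le]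
    rintro x (rfl | rfl | rfl)
    · exact hP.1
    · exact hP.2.1
    · exact hP.2.2
  exact h hg

theorem mem_singularPoints_of_le {f : MvPolynomial (Fin 2) K} {P : Fin 2 → K}
    (h : ∀ g ∈ singIdeal f, eval P g = 0) : P ∈ singularPoints f :=
  ⟨h _ (Ideal.subset_span (by simp)), h _ (Ideal.subset_span (by simp)),
    h _ (Ideal.subset_span (by simp))⟩

/-- The Hesse determinant is invertible modulo `(f, f_X, f_Y)` if and only if all singular points
are nodes. -/
theorem exists_hessian_inverse_iff [IsAlgClosed K] (f : MvPolynomial (Fin 2) K) :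
    (∃ u, u * hessian f - 1 ∈ singIdeal f) ↔ singularPoints f = nodes f := by
  constructor
  · rintro ⟨u, hu⟩
    refine Set.Subset.antisymm (fun P hP => ⟨hP, fun h => ?_⟩) fun P hP => hP.1
    have := eval_eq_zero_of_mem_singIdeal hP hu
    rw [map_sub, map_mul, h, mul_zero, map_one, zero_sub, neg_eq_zero] at this
    exact one_ne_zero this
  · intro h
    by_contra hno
    have hI : singIdeal f ⊔ Ideal.span {hessian f} ≠ ⊤ := by
      intro htop
      have h1 : (1 : MvPolynomial (Fin 2) K) ∈ singIdeal f ⊔ Ideal.span {hessian f} := by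
        rw [htop]; exact Submodule.mem_top
      obtain ⟨y, hy, z, hz, hyz⟩ := Submodule.mem_sup.mp h1
      obtain ⟨u, rfl⟩ := Ideal.mem_span_singleton'.mp hz
      refine hno ⟨u, ?_⟩
      rw [← hyz, sub_add_cancel_right]
      exact neg_mem hy
    obtain ⟨𝔪, hmax, hle⟩ := Ideal.exists_le_maximal _ hI
    obtain ⟨P, rfl⟩ := isMaximal_iff_eq_vanishingIdeal_singleton.mp hmax
    have hv : ∀ g ∈ singIdeal f ⊔ Ideal.span {hessian f}, eval P g = 0 := fun g hg => by
      have := (mem_vanishingIdeal_singleton_iff P g).mp (hle hg)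
      rwa [aeval_apply_eq_eval] at this
    have hP : P ∈ singularPoints f :=
      mem_singularPoints_of_le fun g hg => hv g (Ideal.mem_sup_left hg)
    rw [h] at hP
    exact hP.2 (hv _ (Ideal.mem_sup_right (Ideal.mem_span_singleton_self _)))

/-- Evaluation at a singular point. -/
def evalSing (f : MvPolynomial (Fin 2) K) (P : singularPoints f) :
    (MvPolynomial (Fin 2) K ⧸ singIdeal f) →ₐ[K] K :=
  Ideal.Quotient.liftₐ _ (aeval P.1) fun g hg => by
    rw [aeval_apply_eq_eval]
    exact eval_eq_zero_of_mem_singIdeal P.2 hg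

theorem evalSing_mk (f : MvPolynomial (Fin 2) K) (P : singularPoints f)
    (g : MvPolynomial (Fin 2) K) :
    evalSing f P (Ideal.Quotient.mk _ g) = eval P.1 g := by
  exact aeval_apply_eq_eval P.1 g

/-- Dedekind: distinct characters are independent. This yields finiteness of the singular set and
one of the two inequalities for its size. -/
theorem linearIndependent_evalSing (f : MvPolynomial (Fin 2) K) :
    LinearIndependent K fun P => (evalSing f P).toLinearMap := by
  have hinj : Function.Injective fun P : singularPoints f => (evalSing f P).toRingHom.toMonoidHom := by
    intro P P' h
    ext i
    have := DFunLike.congr_fun h (Ideal.Quotient.mk _ (X i))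
    change evalSing f P _ = evalSing f P' _ at this
    simpa only [evalSing_mk, eval_X] using this
  have h := (linearIndependent_monoidHom (MvPolynomial (Fin 2) K ⧸ singIdeal f) K).comp _ hinj
  exact LinearIndependent.of_comp (LinearMap.ltoFun K (MvPolynomial (Fin 2) K ⧸ singIdeal f) K K) h

theorem finite_singularPoints (f : MvPolynomial (Fin 2) K)
    [Module.Finite K (MvPolynomial (Fin 2) K ⧸ singIdeal f)] : (singularPoints f).Finite :=
  (linearIndependent_evalSing f).finite

/-- If all singularities are nodes, then their number is the dimension of `K[X, Y]/(f, f_X, f_Y)`. -/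
theorem encard_nodes_eq [IsAlgClosed K] [CharZero K] (f : MvPolynomial (Fin 2) K)
    [Module.Finite K (MvPolynomial (Fin 2) K ⧸ singIdeal f)]
    (h : singularPoints f = nodes f) : (nodes f).encard = singDim f := by
  have hfin := finite_singularPoints f
  have := hfin.fintype
  have hred : IsReduced (MvPolynomial (Fin 2) K ⧸ singIdeal f) := by
    obtain ⟨u, hu⟩ := (exists_hessian_inverse_iff f).mpr h
    exact isReduced_of_hessian_isUnit f _ (Ideal.subset_span (by simp))
      (Ideal.subset_span (by simp)) hu
  rw [← h, ← Set.coe_fintypeCard, Nat.cast_inj]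
  apply le_antisymm
  · have := (linearIndependent_evalSing f).fintype_card_le_finrank
    rwa [Subspace.dual_finrank_eq] at this
  · let Φ : (MvPolynomial (Fin 2) K ⧸ singIdeal f) →ₗ[K] (singularPoints f → K) :=
      LinearMap.pi fun P => (evalSing f P).toLinearMap
    have hΦ : Function.Injective Φ := by
      rw [injective_iff_map_eq_zero]
      intro z hz
      obtain ⟨g, rfl⟩ := Ideal.Quotient.mk_surjective z
      -- Since the fibre is reduced, the ideal is radical, and by the Nullstellensatz a function
      -- vanishing at all singular points is zero.
      rw [Ideal.Quotient.eq_zero_iff_mem,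
        ← ((Ideal.isRadical_iff_quotient_reduced _).mpr hred).radical,
        ← vanishingIdeal_zeroLocus_eq_radical (K := K), mem_vanishingIdeal_iff]
      intro P hP
      have hPs : P ∈ singularPoints f := mem_singularPoints_of_le fun g hg => by
        rw [← aeval_apply_eq_eval]
        exact hP g hg
      rw [aeval_apply_eq_eval, ← evalSing_mk f ⟨P, hPs⟩]
      exact congrFun hz ⟨P, hPs⟩
    have := LinearMap.finrank_le_finrank_of_injective hΦ
    rwa [Module.finrank_fintype_fun_eq_card] at this

end Nullstellensatz

/-! ### Closed points of the strata -/

section Points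

variable {K : Type*} [Field K] [IsAlgClosed K] [CharZero K] {p q : ℕ}

omit [IsAlgClosed K] [CharZero K] in
theorem ker_eval_eq (a : Idx p q → K) :
    RingHom.ker (eval a) = (closedPoint K p q a).asIdeal := by
  ext g
  rw [RingHom.mem_ker]
  change _ ↔ g ∈ vanishingIdeal K {a}
  rw [mem_vanishingIdeal_singleton_iff, aeval_apply_eq_eval]

omit [IsAlgClosed K] in
theorem closedPoint_mem_exactLocus_iff' (hp : 1 < p) (hq : 1 < q) {l : ℕ} (hl : 1 ≤ l)
    (a : Idx p q → K) : closedPoint K p q a ∈ exactLocus K p q l ↔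
      singDim (weierstrassPoly a) = l ∧
      ∃ u, u * hessian (weierstrassPoly a) - 1 ∈ singIdeal (weierstrassPoly a) := by
  have hX : (fun i => eval a (X i : CoeffRing K p q)) = a := funext fun i => eval_X i
  rw [mem_exactLocus_iff hp hq (eval a) (fun z => ⟨C z, 1, by simp, by simp⟩) (ker_eval_eq a) hl, hX]

omit [IsAlgClosed K] in
theorem finite_sing_weierstrassPoly (hp : 1 < p) (hq : 1 < q) (a : Idx p q → K) :
    Module.Finite K (MvPolynomial (Fin 2) K ⧸ singIdeal (weierstrassPoly a)) :=
  finite_sing hp hq (isUnit_natCast_of_algebra K (by omega))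
    (isUnit_natCast_of_algebra K (by omega)) a

/-- The closed points of `ℋ^l_{pq}` are the curves whose singularities are exactly `l` nodes. -/
theorem closedPoint_mem_exactLocus_iff (hp : 1 < p) (hq : 1 < q) {l : ℕ} (hl : 1 ≤ l)
    (a : Idx p q → K) : closedPoint K p q a ∈ exactLocus K p q l ↔
      singularPoints (curvePoly a) = nodes (curvePoly a) ∧ (nodes (curvePoly a)).encard = l := by
  have := finite_sing_weierstrassPoly hp hq a
  rw [closedPoint_mem_exactLocus_iff' hp hq hl, exists_hessian_inverse_iff, curvePoly_eq, and_comm]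
  refine and_congr_right fun h => ?_
  rw [encard_nodes_eq _ h, Nat.cast_inj]

end Points

/-! ### First-order Taylor expansion -/

section Taylor

variable {S ι : Type*} [CommRing S] [Fintype ι]

omit [Fintype ι] in
theorem eval_sub_eval_mem (I : Ideal S) {z z' : ι → S} (h : ∀ i, z' i - z i ∈ I)
    (g : MvPolynomial ι S) : eval z' g - eval z g ∈ I := by
  have hz : (Ideal.Quotient.mk I) ∘ z' = (Ideal.Quotient.mk I) ∘ z :=
    funext fun i => (Ideal.Quotient.mk_eq_mk_iff_sub_mem _ _).mpr (h i)
  have h1 : ∀ w : ι → S, Ideal.Quotient.mk I (eval w g) =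
      eval₂ ((Ideal.Quotient.mk I).comp (RingHom.id S)) (Ideal.Quotient.mk I ∘ w) g := fun w =>
    eval₂_comp_left (Ideal.Quotient.mk I) (RingHom.id S) w g
  rw [← Ideal.Quotient.mk_eq_mk_iff_sub_mem, h1, h1, hz]

/-- Taylor expansion of a polynomial to first order. -/
theorem eval_sub_eval_sub_sum_mem_sq (I : Ideal S) {z z' : ι → S} (h : ∀ i, z' i - z i ∈ I)
    (g : MvPolynomial ι S) :
    eval z' g - eval z g - ∑ i, eval z (pderiv i g) * (z' i - z i) ∈ I ^ 2 := by
  classical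
  induction g using MvPolynomial.induction_on with
  | C c => simp
  | add f g hf hg =>
    have : eval z' (f + g) - eval z (f + g) - ∑ i, eval z (pderiv i (f + g)) * (z' i - z i) =
        (eval z' f - eval z f - ∑ i, eval z (pderiv i f) * (z' i - z i)) +
        (eval z' g - eval z g - ∑ i, eval z (pderiv i g) * (z' i - z i)) := by
      simp only [map_add, add_mul, Finset.sum_add_distrib]
      ring
    rw [this]
    exact Ideal.add_mem _ hf hg
  | mul_X f i hf =>
    have h1 : ∑ j, eval z (pderiv j (f * X i)) * (z' j - z j) =
        z i * ∑ j, eval z (pderiv j f) * (z' j - z j) + eval z f * (z' i - z i) := by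
      have h2 : ∀ j, eval z (pderiv j (f * X i)) * (z' j - z j) =
          z i * (eval z (pderiv j f) * (z' j - z j)) +
            if i = j then eval z f * (z' j - z j) else 0 := fun j => by
        rw [pderiv_mul, pderiv_X, Pi.single_apply]
        split_ifs with hij
        · subst hij
          simp only [map_add, map_mul, eval_X, map_one]
          ring
        · simp only [map_add, map_mul, eval_X, map_zero]
          ring
      rw [Finset.sum_congr rfl fun j _ => h2 j, Finset.sum_add_distrib, ← Finset.mul_sum,
        Finset.sum_ite_eq, if_pos (Finset.mem_univ i)]
    have : eval z' (f * X i) - eval z (f * X i) - ∑ j, eval z (pderiv j (f * X i)) * (z' j - z j) =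
        (eval z' f - eval z f) * (z' i - z i) +
        z i * (eval z' f - eval z f - ∑ j, eval z (pderiv j f) * (z' j - z j)) := by
      rw [h1]
      simp only [map_mul, eval_X]
      ring
    rw [this]
    refine Ideal.add_mem _ ?_ (Ideal.mul_mem_left _ _ hf)
    rw [pow_two]
    exact Ideal.mul_mem_mul (eval_sub_eval_mem I h f) (h i)

end Taylor

/-! ### Order filtration and Hensel's lemma for power series -/

section Order

variable {τ : Type*} (k : Type*) [Field k]

/-- The ideal of power series of order at least `n`. -/
def orderIdeal (τ : Type*) (n : ℕ) : Ideal (MvPowerSeries τ k) where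
  carrier := {f | (n : ℕ∞) ≤ f.order}
  zero_mem' := by simp
  add_mem' := fun ha hb => (le_min ha hb).trans MvPowerSeries.min_order_le_add
  smul_mem' := fun c f hf => by
    change (n : ℕ∞) ≤ (c * f).order
    exact (le_add_left hf).trans MvPowerSeries.le_order_mul

variable {k}

theorem mem_orderIdeal {n : ℕ} {f : MvPowerSeries τ k} :
    f ∈ orderIdeal k τ n ↔ ∀ d : τ →₀ ℕ, d.degree < n → MvPowerSeries.coeff d f = 0 :=
  ⟨fun h d hd => MvPowerSeries.coeff_of_lt_order
    (lt_of_lt_of_le (by exact_mod_cast hd) (show (n : ℕ∞) ≤ f.order from h)),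
    fun h => MvPowerSeries.nat_le_order h⟩

theorem orderIdeal_antitone {m n : ℕ} (h : m ≤ n) : orderIdeal k τ n ≤ orderIdeal k τ m :=
  fun _ hf => mem_orderIdeal.mpr fun d hd => mem_orderIdeal.mp hf d (hd.trans_le h)

theorem mul_mem_orderIdeal {m n : ℕ} {f g : MvPowerSeries τ k} (hf : f ∈ orderIdeal k τ m)
    (hg : g ∈ orderIdeal k τ n) : f * g ∈ orderIdeal k τ (m + n) := by
  change ((m + n : ℕ) : ℕ∞) ≤ _
  push_cast
  exact (add_le_add hf hg).trans MvPowerSeries.le_order_mul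

theorem orderIdeal_sq_le (n : ℕ) : orderIdeal k τ n ^ 2 ≤ orderIdeal k τ (n + n) := by
  rw [pow_two, Ideal.mul_le]
  exact fun _ hf _ hg => mul_mem_orderIdeal hf hg

theorem eq_zero_of_forall_mem_orderIdeal {f : MvPowerSeries τ k}
    (h : ∀ n, f ∈ orderIdeal k τ n) : f = 0 := by
  ext d
  exact mem_orderIdeal.mp (h (d.degree + 1)) d (Nat.lt_succ_self _)

theorem mem_orderIdeal_one {f : MvPowerSeries τ k} :
    f ∈ orderIdeal k τ 1 ↔ MvPowerSeries.constantCoeff f = 0 := by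
  rw [← MvPowerSeries.one_le_order_iff_constCoeff_eq_zero]
  rfl

/-- A sequence of power series whose differences have growing order converges. -/
theorem exists_limit (z : ℕ → MvPowerSeries τ k)
    (h : ∀ n, z (n + 1) - z n ∈ orderIdeal k τ (n + 1)) :
    ∃ w, ∀ n, w - z n ∈ orderIdeal k τ (n + 1) := by
  have hmono : ∀ n m, n ≤ m → z m - z n ∈ orderIdeal k τ (n + 1) := by
    intro n m hnm
    induction m, hnm using Nat.le_induction with
    | base => simp
    | succ m hm ih =>
      rw [← sub_add_sub_cancel]
      exact Ideal.add_mem _ (orderIdeal_antitone (by omega) (h m)) ih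
  -- The coefficients of degree `n` no longer change after the `n`-th member of the sequence.
  let w : MvPowerSeries τ k := fun d => MvPowerSeries.coeff d (z d.degree)
  refine ⟨w, fun n => mem_orderIdeal.mpr fun d hd => ?_⟩
  have h1 := mem_orderIdeal.mp (hmono d.degree n (by omega)) d (Nat.lt_succ_self _)
  rw [map_sub, sub_eq_zero] at h1
  rw [map_sub, h1, sub_eq_zero]
  rfl

/-- Hensel's lemma for systems of polynomial equations over a ring of power series. -/
theorem exists_eval_eq_zero {ι : Type*} [Fintype ι] [DecidableEq ι]
    (g : ι → MvPolynomial ι (MvPowerSeries τ k)) (z₀ : ι → MvPowerSeries τ k)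
    (h₀ : ∀ i, eval z₀ (g i) ∈ orderIdeal k τ 1) (N : Matrix ι ι (MvPowerSeries τ k))
    (hN : ∀ i l, ∑ j, N i j * eval z₀ (pderiv l (g j)) - (1 : Matrix ι ι _) i l ∈
      orderIdeal k τ 1) (hNu : IsUnit N) :
    ∃ z, (∀ i, z i - z₀ i ∈ orderIdeal k τ 1) ∧ ∀ i, eval z (g i) = 0 := by
  -- Simplified Newton iteration: `N` inverts the Jacobian at the starting point modulo order one
  -- and stays fixed. Each step improves the order of the error by one.
  let Ψ : (ι → MvPowerSeries τ k) → ι → MvPowerSeries τ k :=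
    fun z i => z i - ∑ j, N i j * eval z (g j)
  have hcontr : ∀ n ≥ 1, ∀ z w : ι → MvPowerSeries τ k, (∀ i, z i - z₀ i ∈ orderIdeal k τ 1) →
      (∀ i, w i - z i ∈ orderIdeal k τ n) → ∀ i, Ψ w i - Ψ z i ∈ orderIdeal k τ (n + 1) := by
    intro n hn z w hz hw i
    have h1 : Ψ w i - Ψ z i =
        - ∑ j, N i j * (eval w (g j) - eval z (g j) - ∑ l, eval z (pderiv l (g j)) * (w l - z l))
        - ∑ l, (∑ j, N i j * eval z (pderiv l (g j)) - (1 : Matrix ι ι _) i l) * (w l - z l) := by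
      have e1 : ∑ l, (1 : Matrix ι ι (MvPowerSeries τ k)) i l * (w l - z l) = w i - z i := by
        simp [Matrix.one_apply]
      have e2 : ∑ j, N i j * ∑ l, eval z (pderiv l (g j)) * (w l - z l) =
          ∑ l, (∑ j, N i j * eval z (pderiv l (g j))) * (w l - z l) := by
        simp only [Finset.mul_sum, Finset.sum_mul]
        rw [Finset.sum_comm]
        simp only [mul_assoc]
      simp only [mul_sub, sub_mul, Finset.sum_sub_distrib, Ψ] at e1 e2 ⊢
      linear_combination - e1 - e2
    rw [h1]
    refine Ideal.sub_mem _ (neg_mem (Ideal.sum_mem _ fun j _ => Ideal.mul_mem_left _ _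
      (orderIdeal_antitone (show n + 1 ≤ n + n by omega) (orderIdeal_sq_le n
        (eval_sub_eval_sub_sum_mem_sq _ hw (g j)))))) (Ideal.sum_mem _ fun l _ => ?_)
    rw [add_comm n 1]
    refine mul_mem_orderIdeal ?_ (hw l)
    have h2 : ∑ j, N i j * eval z (pderiv l (g j)) - (1 : Matrix ι ι _) i l =
        ∑ j, N i j * (eval z (pderiv l (g j)) - eval z₀ (pderiv l (g j))) +
        (∑ j, N i j * eval z₀ (pderiv l (g j)) - (1 : Matrix ι ι _) i l) := by
      simp only [mul_sub, Finset.sum_sub_distrib]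
      ring
    rw [h2]
    exact Ideal.add_mem _ (Ideal.sum_mem _ fun j _ => Ideal.mul_mem_left _ _
      (eval_sub_eval_mem _ hz _)) (hN i l)
  let z : ℕ → ι → MvPowerSeries τ k := fun n => Ψ^[n] z₀
  have hzs : ∀ n, z (n + 1) = Ψ (z n) := fun n => Function.iterate_succ_apply' Ψ n z₀
  have hz : ∀ n, (∀ i, z n i - z₀ i ∈ orderIdeal k τ 1) ∧
      ∀ i, z (n + 1) i - z n i ∈ orderIdeal k τ (n + 1) := by
    intro n
    induction n with
    | zero =>
      refine ⟨fun i => by simp [z], fun i => ?_⟩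
      rw [hzs]
      change z₀ i - ∑ j, N i j * eval z₀ (g j) - z₀ i ∈ _
      rw [sub_sub_cancel_left]
      exact neg_mem (Ideal.sum_mem _ fun j _ => Ideal.mul_mem_left _ _ (h₀ j))
    | succ n ih =>
      refine ⟨fun i => ?_, fun i => ?_⟩
      · rw [← sub_add_sub_cancel _ (z n i)]
        exact Ideal.add_mem _ (orderIdeal_antitone (by omega) (ih.2 i)) (ih.1 i)
      · rw [hzs (n + 1)]
        nth_rw 2 [hzs n]
        exact hcontr (n + 1) (by omega) _ _ ih.1 ih.2 i
  choose w hw using fun i => exists_limit (fun n => z n i) fun n => (hz n).2 i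
  have hw0 : ∀ i, w i - z₀ i ∈ orderIdeal k τ 1 := fun i => hw i 0
  have hfix : ∀ i, Ψ w i = w i := by
    intro i
    rw [← sub_eq_zero]
    refine eq_zero_of_forall_mem_orderIdeal fun n => ?_
    have h1 := hcontr (n + 1) (by omega) (z n) w (hz n).1 (fun i => hw i n) i
    rw [← hzs] at h1
    have h2 := hw i (n + 1)
    have h3 : Ψ w i - w i = (Ψ w i - z (n + 1) i) - (w i - z (n + 1) i) := by ring
    rw [h3]
    exact Ideal.sub_mem _ (orderIdeal_antitone (by omega) h1) (orderIdeal_antitone (by omega) h2)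
  refine ⟨w, hw0, ?_⟩
  have h1 : N.mulVec (fun j => eval w (g j)) = 0 := by
    funext i
    have := hfix i
    change w i - ∑ j, N i j * eval w (g j) = w i at this
    rw [sub_eq_self] at this
    exact this
  have h2 := Matrix.mulVec_injective_of_isUnit hNu (h1.trans (Matrix.mulVec_zero N).symm)
  exact fun i => congrFun h2 i

end Order

/-! ### Critical values over the completion -/

section CriticalValue

variable {K : Type*} [Field K] {p q : ℕ}

theorem toCompletion_X (a : Idx p q → K) (i : Idx p q) :
    toCompletion a (X i) = MvPowerSeries.X i + MvPowerSeries.C (a i) := by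
  rw [toCompletion, aeval_X]

theorem toCompletion_C (a : Idx p q → K) (c : K) : toCompletion a (C c) = MvPowerSeries.C c := by
  rw [toCompletion, aeval_C]
  rfl

theorem constantCoeff_toCompletion (a : Idx p q → K) :
    MvPowerSeries.constantCoeff.comp (toCompletion a : CoeffRing K p q →+* CompletedRing K p q) =
      eval a := by
  refine ringHom_ext (fun c => ?_) fun i => ?_
  · change MvPowerSeries.constantCoeff (toCompletion a (C c)) = eval a (C c)
    rw [toCompletion_C, MvPowerSeries.constantCoeff_C, eval_C]
  · simp [toCompletion_X]

theorem constantCoeff_eval_map (a : Idx p q → K) (P : Fin 2 → K) (G : PlaneRing K p q) :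
    MvPowerSeries.constantCoeff (eval (fun i => (MvPowerSeries.C (P i) : CompletedRing K p q))
      (map (toCompletion a : CoeffRing K p q →+* CompletedRing K p q) G)) =
      eval P (map (eval a) G) := by
  have h : (MvPowerSeries.constantCoeff.comp
      (eval (fun i => (MvPowerSeries.C (P i) : CompletedRing K p q)))).comp
      (map (toCompletion a : CoeffRing K p q →+* CompletedRing K p q)) =
      (eval P).comp (map (eval a)) := by
    refine ringHom_ext (fun c => ?_) fun i => ?_
    · simpa using DFunLike.congr_fun (constantCoeff_toCompletion a) c
    · simp
  exact DFunLike.congr_fun h G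

/-- `F` is linear in its coefficients `T + a`; at the fixed point `P` the part from `a` is `F(a, P)
= 0`, and only the part linear in `T` remains. -/
theorem eval_map_genericF (a : Idx p q → K) {P : Fin 2 → K} (hP : eval P (curvePoly a) = 0) :
    eval (fun i => (MvPowerSeries.C (P i) : CompletedRing K p q))
      (map (toCompletion a : CoeffRing K p q →+* CompletedRing K p q) (genericF K p q)) =
      nodeForm p q P := by
  rw [map_genericF, weierstrassPoly, nodeForm]
  rw [curvePoly_eq, weierstrassPoly] at hP
  have h := congrArg (MvPowerSeries.C : K →+* CompletedRing K p q) hP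
  simp only [map_add, map_sub, map_pow, map_sum, map_mul, eval_X, eval_C, map_zero,
    RingHom.coe_coe, toCompletion_X, add_mul, Finset.sum_add_distrib] at h ⊢
  rw [← sub_eq_zero, ← h, ← sub_eq_zero]
  have h1 : ∀ i : Idx p q, (MvPowerSeries.X i : CompletedRing K p q) *
      MvPowerSeries.C (P 0) ^ i.1.1 * MvPowerSeries.C (P 1) ^ i.1.2 =
      MvPowerSeries.C (P 0) ^ i.1.1 * MvPowerSeries.C (P 1) ^ i.1.2 * MvPowerSeries.X i :=
    fun i => by ring
  simp only [h1]
  ring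

/-- Over each node the universal curve has a critical point with coordinates in the completion; the
value of the universal equation at this point is a power series whose linear part is the linear
form of the node, and it divides the discriminant. -/
theorem exists_criticalValue [CharZero K] (hp : 1 < p) (hq : 1 < q) (a : Idx p q → K)
    {P : Fin 2 → K} (hP : P ∈ nodes (curvePoly a)) :
    ∃ D : CompletedRing K p q, D - nodeForm p q P ∈ orderIdeal K (Idx p q) 2 ∧
      D ∣ toCompletion a (disc K p q) := by
  set τ : CoeffRing K p q →+* CompletedRing K p q :=
    (toCompletion a : CoeffRing K p q →+* CompletedRing K p q) with hτ
  set F := genericF K p q with hF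
  let z₀ : Fin 2 → CompletedRing K p q := fun i => MvPowerSeries.C (P i)
  -- The Jacobian of the system `F_X = F_Y = 0` at `P` is the Hesse matrix, invertible because `P`
  -- is a node. Its constant inverse serves as `N` in Hensel's lemma.
  let H : Matrix (Fin 2) (Fin 2) K :=
    Matrix.of fun j l => eval P (pderiv l (pderiv j (curvePoly a)))
  have hH : H.det ≠ 0 := by
    have := hP.2
    rw [Matrix.det_fin_two]
    simp only [hessian, map_sub, map_mul, map_pow] at this
    simp only [H, Matrix.of_apply]
    rwa [pderiv_comm (curvePoly a), ← pow_two]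
  have hHu : IsUnit H.det := isUnit_iff_ne_zero.mpr hH
  have hcurve : ∀ i, pderiv i (map τ F) = map τ (pderiv i F) := fun i => pderiv_map
  obtain ⟨z, hz, hcrit⟩ := exists_eval_eq_zero (fun i => pderiv i (map τ F)) z₀ (fun i => by
      rw [mem_orderIdeal_one, hcurve, constantCoeff_eval_map, ← pderiv_map]
      have := hP.1
      fin_cases i
      · exact this.2.1
      · exact this.2.2)
    ((MvPowerSeries.C : K →+* CompletedRing K p q).mapMatrix H⁻¹) (fun i l => by
      rw [mem_orderIdeal_one, map_sub, map_sum]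
      have h1 : ∀ j, MvPowerSeries.constantCoeff
          ((MvPowerSeries.C : K →+* CompletedRing K p q).mapMatrix H⁻¹ i j *
            eval z₀ (pderiv l (pderiv j (map τ F)))) = H⁻¹ i j * H j l := fun j => by
        rw [hcurve, pderiv_map, map_mul, constantCoeff_eval_map, ← pderiv_map, ← pderiv_map]
        rfl
      have h2 : MvPowerSeries.constantCoeff ((1 : Matrix (Fin 2) (Fin 2) (CompletedRing K p q)) i l)
          = (1 : Matrix (Fin 2) (Fin 2) K) i l := by
        rw [Matrix.one_apply, Matrix.one_apply]
        split_ifs <;> simp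
      rw [Finset.sum_congr rfl fun j _ => h1 j, h2, ← Matrix.mul_apply,
        Matrix.nonsing_inv_mul H hHu, sub_self])
    (((Matrix.isUnit_nonsing_inv_iff.mpr ((Matrix.isUnit_iff_isUnit_det H).mpr hHu))).map _)
  refine ⟨eval z (map τ F), ?_, ?_⟩
  -- Expanding at the critical point `z` there is no linear term, so the values of `F` at `z` and at
  -- the constant point `P` agree up to order two.
  · have h1 := eval_sub_eval_sub_sum_mem_sq (orderIdeal K (Idx p q) 1) (z := z) (z' := z₀)
      (fun i => by rw [← neg_sub]; exact neg_mem (hz i)) (map τ F)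
    simp only [hcrit, zero_mul, Finset.sum_const_zero, sub_zero] at h1
    have h2 := orderIdeal_sq_le 1 h1
    rw [eval_map_genericF a hP.1.1] at h2
    rw [← neg_sub]
    exact neg_mem h2
  -- Evaluation at `z` kills `F_X` and `F_Y`, and `Δ` lies in `(F, F_X, F_Y)`; so its image is a
  -- multiple of the critical value.
  · let θ : PlaneRing K p q →+* CompletedRing K p q := (eval z).comp (map τ)
    have hle : singIdeal F ≤ (Ideal.span {eval z (map τ F)}).comap θ := by
      rw [Ideal.span_le]
      have h0 : ∀ i, θ (pderiv i F) = 0 := fun i => by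
        rw [← hcrit i, hcurve]
        rfl
      rintro x (rfl | rfl | rfl)
      · exact Ideal.mem_span_singleton_self _
      · rw [SetLike.mem_coe, Ideal.mem_comap, h0]; exact Ideal.zero_mem _
      · rw [SetLike.mem_coe, Ideal.mem_comap, h0]; exact Ideal.zero_mem _
    have h1 := hle ((mem_hypersurfaceIdeal_iff).mp (disc_mem_hypersurfaceIdeal hp hq))
    rw [Ideal.mem_comap, Ideal.mem_span_singleton] at h1
    have h2 : θ (C (disc K p q)) = toCompletion a (disc K p q) := by
      change eval z (map τ (C _)) = _
      rw [map_C, eval_C]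
      rfl
    rwa [h2] at h1

end CriticalValue

/-! ### Consequences of the linear part of a critical value -/

section LinearPart

variable {K : Type*} [Field K] {p q : ℕ}

theorem coeff_single_nodeForm (P : Fin 2 → K) (i : Idx p q) :
    MvPowerSeries.coeff (Finsupp.single i 1) (nodeForm p q P) = P 0 ^ i.1.1 * P 1 ^ i.1.2 := by
  classical
  rw [nodeForm, map_sum, Finset.sum_eq_single i]
  · rw [MvPowerSeries.coeff_C_mul, MvPowerSeries.coeff_index_single_self_X, mul_one]
  · intro j _ hj
    rw [MvPowerSeries.coeff_C_mul, MvPowerSeries.coeff_index_single_X, if_neg hj.symm, mul_zero]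
  · simp

theorem coeff_nodeForm_of_degree_ne_one (P : Fin 2 → K) {d : Idx p q →₀ ℕ} (hd : d.degree ≠ 1) :
    MvPowerSeries.coeff d (nodeForm p q P) = 0 := by
  classical
  rw [nodeForm, map_sum]
  refine Finset.sum_eq_zero fun i _ => ?_
  rw [MvPowerSeries.coeff_C_mul, MvPowerSeries.coeff_X, if_neg, mul_zero]
  rintro rfl
  exact hd (by simp)

variable {D : CompletedRing K p q} {P : Fin 2 → K}
  (hD : D - nodeForm p q P ∈ orderIdeal K (Idx p q) 2)

include hD

theorem coeff_eq_coeff_nodeForm {d : Idx p q →₀ ℕ} (hd : d.degree ≤ 1) :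
    MvPowerSeries.coeff d D = MvPowerSeries.coeff d (nodeForm p q P) := by
  have := mem_orderIdeal.mp hD d (by omega)
  rwa [map_sub, sub_eq_zero] at this

theorem coeff_single_criticalValue (i : Idx p q) :
    MvPowerSeries.coeff (Finsupp.single i 1) D = P 0 ^ i.1.1 * P 1 ^ i.1.2 := by
  rw [coeff_eq_coeff_nodeForm hD (by simp), coeff_single_nodeForm]

theorem constantCoeff_criticalValue : MvPowerSeries.constantCoeff D = 0 := by
  rw [← MvPowerSeries.coeff_zero_eq_constantCoeff_apply, coeff_eq_coeff_nodeForm hD (by simp),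
    coeff_nodeForm_of_degree_ne_one _ (by simp)]

theorem coeff_idxOne_criticalValue (hp : 1 < p) (hq : 1 < q) :
    MvPowerSeries.coeff (Finsupp.single (idxOne hp hq) 1) D = 1 := by
  rw [coeff_single_criticalValue hD]
  simp [idxOne]

theorem prime_criticalValue (hp : 1 < p) (hq : 1 < q) : Prime D :=
  prime_mvPowerSeries (constantCoeff_criticalValue hD) (i := idxOne hp hq)
    (by rw [coeff_idxOne_criticalValue hD]; exact one_ne_zero)

theorem isRegularLocalRing_quotient_criticalValue (hp : 1 < p) (hq : 1 < q) :
    IsRegularLocalRing (CompletedRing K p q ⧸ Ideal.span {D}) :=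
  isRegularLocalRing_quotient_mvPowerSeries (constantCoeff_criticalValue hD) (i := idxOne hp hq)
    (by rw [coeff_idxOne_criticalValue hD]; exact one_ne_zero)

theorem order_criticalValue (hp : 1 < p) (hq : 1 < q) : MvPowerSeries.order D = 1 := by
  refine le_antisymm ?_ ?_
  · refine (MvPowerSeries.order_le (d := Finsupp.single (idxOne hp hq) 1) ?_).trans (by simp)
    rw [coeff_idxOne_criticalValue hD]
    exact one_ne_zero
  · rw [MvPowerSeries.one_le_order_iff_constCoeff_eq_zero, constantCoeff_criticalValue hD]

theorem homogeneousComponent_criticalValue :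
    MvPowerSeries.homogeneousComponent 1 D = nodeForm p q P := by
  classical
  ext d
  rw [MvPowerSeries.coeff_homogeneousComponent]
  split_ifs with h
  · exact coeff_eq_coeff_nodeForm hD h.le
  · rw [coeff_nodeForm_of_degree_ne_one _ h]

theorem coeff_single_mul_criticalValue (g : CompletedRing K p q) (i : Idx p q) :
    MvPowerSeries.coeff (Finsupp.single i 1) (g * D) =
      MvPowerSeries.constantCoeff g * (P 0 ^ i.1.1 * P 1 ^ i.1.2) := by
  have h1 : (g - MvPowerSeries.C (MvPowerSeries.constantCoeff g)) * D ∈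
      orderIdeal K (Idx p q) (1 + 1) := by
    refine mul_mem_orderIdeal ?_ ?_
    · rw [mem_orderIdeal_one]; simp
    · rw [mem_orderIdeal_one]; exact constantCoeff_criticalValue hD
  have h2 := mem_orderIdeal.mp h1 (Finsupp.single i 1) (by simp)
  rw [sub_mul, map_sub, sub_eq_zero] at h2
  rw [h2, MvPowerSeries.coeff_C_mul, coeff_single_criticalValue hD]

theorem tangentSpace_criticalValue : tangentSpace (Ideal.span {D}) =
    {t | ∑ i : Idx p q, P 0 ^ i.1.1 * P 1 ^ i.1.2 * t i = 0} := by
  ext t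
  constructor
  · intro h
    have := h D (Ideal.mem_span_singleton_self D)
    simp only [coeff_single_criticalValue hD] at this
    exact this
  · intro h f hf
    obtain ⟨g, rfl⟩ := Ideal.mem_span_singleton'.mp hf
    simp only [coeff_single_mul_criticalValue hD, mul_assoc]
    rw [← Finset.mul_sum]
    have h' : ∑ i : Idx p q, P 0 ^ i.1.1 * P 1 ^ i.1.2 * t i = 0 := h
    simp only [mul_assoc] at h'
    rw [h', mul_zero]

/-- Divisibility makes the linear parts proportional. The coefficients at `1`, `X`, `Y` are `1, ξ,
η`, so the factor is `1` and the point is recovered. -/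
theorem eq_of_dvd_criticalValue (hp : 1 < p) (hq : 1 < q) {D' : CompletedRing K p q}
    {P' : Fin 2 → K} (hD' : D' - nodeForm p q P' ∈ orderIdeal K (Idx p q) 2) (h : D ∣ D') :
    P = P' := by
  obtain ⟨g, rfl⟩ := h
  have hc : ∀ i : Idx p q, MvPowerSeries.constantCoeff g * (P 0 ^ i.1.1 * P 1 ^ i.1.2) =
      P' 0 ^ i.1.1 * P' 1 ^ i.1.2 := fun i => by
    rw [← coeff_single_mul_criticalValue hD, ← coeff_single_criticalValue hD', mul_comm]
  have h0 := hc (idxOne hp hq)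
  have h1 := hc (idxX hp hq)
  have h2 := hc (idxY hp hq)
  simp only [idxOne, idxX, idxY, pow_zero, pow_one, mul_one, one_mul] at h0 h1 h2
  rw [h0, one_mul] at h1 h2
  funext i
  fin_cases i
  · exact h1
  · exact h2

end LinearPart

/-! ### The order of the discriminant along the constant coefficient -/

section Multiplicity

variable {K : Type*} [Field K] {p q : ℕ}

/-- The coefficient of a pure power of a variable is read off on the corresponding axis. -/
theorem coeff_aeval_axis {τ : Type*} [DecidableEq τ] (i₀ : τ) (g : MvPolynomial τ K) (n : ℕ) :
    (aeval (fun i => if i = i₀ then (Polynomial.X : Polynomial K) else 0) g).coeff n =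
      g.coeff (Finsupp.single i₀ n) := by
  induction g using MvPolynomial.induction_on' with
  | add f g hf hg => rw [map_add, Polynomial.coeff_add, hf, hg, coeff_add]
  | monomial d c =>
    rw [aeval_monomial, coeff_monomial, Polynomial.algebraMap_eq, Polynomial.coeff_C_mul]
    by_cases hd : ∃ i ∈ d.support, i ≠ i₀
    · obtain ⟨i, hi, hne⟩ := hd
      rw [Finsupp.prod, Finset.prod_eq_zero hi, Polynomial.coeff_zero, mul_zero, if_neg]
      · rintro rfl
        exact (Finsupp.mem_support_iff.mp hi) (by simp [hne.symm])
      · rw [if_neg hne, zero_pow (Finsupp.mem_support_iff.mp hi)]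
    · push Not at hd
      obtain ⟨m, rfl⟩ : ∃ m, d = Finsupp.single i₀ m := ⟨d i₀, by
        ext i
        by_cases hi : i = i₀
        · subst hi; simp
        · rw [Finsupp.single_apply, if_neg (Ne.symm hi)]
          by_contra h0
          exact hi (hd i (Finsupp.mem_support_iff.mpr h0))⟩
      rw [Finsupp.prod_single_index (by simp), if_pos rfl, Polynomial.coeff_X_pow]
      by_cases h : n = m
      · subst h; simp
      · rw [if_neg h, if_neg, mul_zero]
        intro h'
        exact h (Finsupp.single_injective _ h').symm

/-- The shifted polynomial `g(T + a)`, whose image in the ring of power series is the image of `g`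
in the completion at `a`. -/
def translate (a : Idx p q → K) : CoeffRing K p q →ₐ[K] CoeffRing K p q :=
  aeval fun i => X i + C (a i)

theorem coe_translate (a : Idx p q → K) (g : CoeffRing K p q) :
    (translate a g : CompletedRing K p q) = toCompletion a g := by
  have h : (coeToMvPowerSeries.ringHom).comp (translate a : CoeffRing K p q →+* CoeffRing K p q) =
      (toCompletion a : CoeffRing K p q →+* CompletedRing K p q) := by
    refine ringHom_ext (fun c => ?_) fun i => ?_
    · change ((translate a (C c) : CoeffRing K p q) : CompletedRing K p q) = toCompletion a (C c)
      rw [toCompletion_C, translate, aeval_C, algebraMap_eq, coe_C]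
    · change ((translate a (X i) : CoeffRing K p q) : CompletedRing K p q) = toCompletion a (X i)
      rw [toCompletion_X, translate, aeval_X, coe_add, coe_X, coe_C]
  exact DFunLike.congr_fun h g

/-- Restricting to the axis `T₀₀` gives the pencil through `a`, along which `Δ` vanishes exactly to
the order of the fibre length. This bounds the order of `Δ` from above. -/
theorem coeff_toCompletion_disc_ne_zero [CharZero K] (hp : 1 < p) (hq : 1 < q) (a : Idx p q → K)
    {u : MvPolynomial (Fin 2) K}
    (hu : u * hessian (weierstrassPoly a) - 1 ∈ singIdeal (weierstrassPoly a)) :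
    MvPowerSeries.coeff (Finsupp.single (idxOne hp hq) (singDim (weierstrassPoly a)))
      (toCompletion a (disc K p q)) ≠ 0 := by
  classical
  have hX : (fun i => eval a (X i : CoeffRing K p q)) = a := funext fun i => eval_X i
  have h := rootMultiplicity_pencilHom_disc hp hq (eval a) (u := u) (by rwa [hX])
  rw [hX, Polynomial.rootMultiplicity_eq_natTrailingDegree'] at h
  have h1 : ∀ g, pencilHom (eval a) g = aeval
      (fun i => if i = idxOne hp hq then (Polynomial.X : Polynomial K) else 0) (translate a g) := by
    intro g
    have : (pencilHom (eval a) : CoeffRing K p q →+* Polynomial K) =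
        ((aeval (fun i => if i = idxOne hp hq then (Polynomial.X : Polynomial K) else 0)).comp
          (translate a) : CoeffRing K p q →ₐ[K] Polynomial K) := by
      refine ringHom_ext (fun c => ?_) fun i => ?_
      · simp [pencilHom, Polynomial.algebraMap_eq]
      · rw [pencilHom, coe_eval₂Hom, eval₂_X]
        simp [translate, shiftConst, idxOne, Subtype.ext_iff, Polynomial.algebraMap_eq, add_comm]
    exact DFunLike.congr_fun this g
  rw [← coe_translate, coeff_coe, ← coeff_aeval_axis, ← h1, ← h.1]
  exact Polynomial.trailingCoeff_nonzero_iff_nonzero.mpr h.2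

end Multiplicity

/-! ### Factorization of the discriminant into branches -/

section Branches

theorem prod_dvd_of_prime {M ι : Type*} [CommRing M] [IsDomain M] (s : Finset ι) (D : ι → M)
    (hp : ∀ i ∈ s, Prime (D i)) (hne : ∀ i ∈ s, ∀ j ∈ s, D i ∣ D j → i = j) {m : M}
    (h : ∀ i ∈ s, D i ∣ m) : ∏ i ∈ s, D i ∣ m := by
  classical
  induction s using Finset.induction_on generalizing m with
  | empty => simp
  | insert i s hi ih =>
    obtain ⟨c, rfl⟩ := h i (Finset.mem_insert_self i s)
    rw [Finset.prod_insert hi]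
    refine mul_dvd_mul_left _ (ih (fun j hj => hp j (Finset.mem_insert_of_mem hj))
      (fun j hj l hl => hne j (Finset.mem_insert_of_mem hj) l (Finset.mem_insert_of_mem hl))
      fun j hj => ?_)
    refine ((hp j (Finset.mem_insert_of_mem hj)).dvd_or_dvd
      (h j (Finset.mem_insert_of_mem hj))).resolve_left fun hd => hi ?_
    rwa [← hne j (Finset.mem_insert_of_mem hj) i (Finset.mem_insert_self i s) hd]

/-- The minimal primes over a product of pairwise non-associated prime elements. -/
theorem bijOn_minimalPrimes {M ι : Type*} [CommRing M] [IsDomain M] (s : Finset ι) (D : ι → M)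
    (hp : ∀ i ∈ s, Prime (D i)) (hne : ∀ i ∈ s, ∀ j ∈ s, D i ∣ D j → i = j) :
    Set.BijOn (fun i => Ideal.span {D i}) s (Ideal.span {∏ i ∈ s, D i}).minimalPrimes := by
  have hprime : ∀ i ∈ s, (Ideal.span {D i}).IsPrime := fun i hi =>
    (Ideal.span_singleton_prime (hp i hi).ne_zero).mpr (hp i hi)
  have hle : ∀ i ∈ s, Ideal.span {∏ i ∈ s, D i} ≤ Ideal.span {D i} := fun i hi =>
    Ideal.span_singleton_le_span_singleton.mpr (Finset.dvd_prod_of_mem D hi)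
  have hex : ∀ Q : Ideal M, Q.IsPrime → Ideal.span {∏ i ∈ s, D i} ≤ Q →
      ∃ i ∈ s, Ideal.span {D i} ≤ Q := by
    intro Q hQ h
    obtain ⟨i, hi, hiQ⟩ := (hQ.prod_mem_iff).mp
      ((Ideal.span_singleton_le_iff_mem _).mp h)
    exact ⟨i, hi, (Ideal.span_singleton_le_iff_mem _).mpr hiQ⟩
  refine ⟨fun i hi => ⟨⟨hprime i hi, hle i hi⟩, ?_⟩, ?_, ?_⟩
  · rintro Q ⟨hQ, hQle⟩ hQi
    obtain ⟨j, hj, hjQ⟩ := hex Q hQ hQle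
    have := hne i hi j hj (Ideal.span_singleton_le_span_singleton.mp (hjQ.trans hQi))
    rw [this]
    exact hjQ
  · intro i hi j hj h
    exact hne i hi j hj (Ideal.span_singleton_le_span_singleton.mp (le_of_eq h.symm))
  · rintro Q ⟨⟨hQ, hQle⟩, hmin⟩
    obtain ⟨i, hi, hiQ⟩ := hex Q hQ hQle
    exact ⟨i, hi, le_antisymm hiQ (hmin ⟨hprime i hi, hle i hi⟩ hiQ)⟩

variable {K : Type*} [Field K] [IsAlgClosed K] [CharZero K] {p q : ℕ}

/-- The branches of the discriminant hypersurface at a nodal curve. -/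
theorem exists_branches (hp : 1 < p) (hq : 1 < q) {l : ℕ} (hl : 1 ≤ l) (a : Idx p q → K)
    (ha : closedPoint K p q a ∈ exactLocus K p q l) :
    (branches a).encard = l ∧ ∃ D : (Fin 2 → K) → CompletedRing K p q,
      Set.BijOn (fun P => Ideal.span {D P}) (nodes (curvePoly a)) (branches a) ∧
      Associated (toCompletion a (disc K p q)) (∏ᶠ P ∈ nodes (curvePoly a), D P) ∧
      ∀ P ∈ nodes (curvePoly a), D P - nodeForm p q P ∈ orderIdeal K (Idx p q) 2 := by
  classical
  have := isRegularLocalRing_mvPowerSeries (Idx p q) K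
  have := isDomain_of_isRegularLocalRing (CompletedRing K p q)
  have hcard := ((closedPoint_mem_exactLocus_iff hp hq hl a).mp ha).2
  obtain ⟨hdim, u, hu⟩ := (closedPoint_mem_exactLocus_iff' hp hq hl a).mp ha
  have hfin : (nodes (curvePoly a)).Finite := Set.finite_of_encard_eq_coe hcard
  choose! D hD hdvd using fun P (hP : P ∈ nodes (curvePoly a)) => exists_criticalValue hp hq a hP
  set s := hfin.toFinset with hs
  have hmem : ∀ {P}, P ∈ s ↔ P ∈ nodes (curvePoly a) := hfin.mem_toFinset
  have hscard : s.card = l := by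
    rw [hfin.encard_eq_coe_toFinset_card] at hcard
    exact_mod_cast hcard
  have hprime : ∀ P ∈ s, Prime (D P) := fun P hP => prime_criticalValue (hD P (hmem.mp hP)) hp hq
  have hne : ∀ P ∈ s, ∀ P' ∈ s, D P ∣ D P' → P = P' := fun P hP P' hP' h =>
    eq_of_dvd_criticalValue (hD P (hmem.mp hP)) hp hq (hD P' (hmem.mp hP')) h
  obtain ⟨c, hc⟩ := prod_dvd_of_prime s D hprime hne fun P hP => hdvd P (hmem.mp hP)
  have hprodmem : ∀ t : Finset (Fin 2 → K), t ⊆ s → ∏ P ∈ t, D P ∈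
      orderIdeal K (Idx p q) t.card := by
    intro t
    induction t using Finset.induction_on with
    | empty =>
      intro _
      exact mem_orderIdeal.mpr fun d hd => absurd hd (by simp)
    | insert P t hP ih =>
      intro ht
      rw [Finset.prod_insert hP, Finset.card_insert_of_notMem hP, add_comm]
      refine mul_mem_orderIdeal ?_ (ih ((Finset.subset_insert P t).trans ht))
      rw [mem_orderIdeal_one]
      exact constantCoeff_criticalValue (hD P (hmem.mp (ht (Finset.mem_insert_self P t))))
  -- The product of the `l` critical values has order at least `l`. If `c` had no constant term, `Δ`
  -- would have order greater than `l`, but its coefficient at `T₀₀^l` is nonzero.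
  have hcu : IsUnit c := by
    rw [MvPowerSeries.isUnit_iff_constantCoeff, isUnit_iff_ne_zero]
    intro h0
    have h1 := mul_mem_orderIdeal (hprodmem s subset_rfl) (mem_orderIdeal_one.mpr h0)
    rw [← hc] at h1
    refine coeff_toCompletion_disc_ne_zero hp hq a hu (mem_orderIdeal.mp h1 _ ?_)
    rw [hdim, hscard]
    simp
  have hassoc : Associated (toCompletion a (disc K p q)) (∏ P ∈ s, D P) := by
    rw [hc]
    exact associated_mul_unit_left _ _ hcu
  have hbr : branches a = (Ideal.span {∏ P ∈ s, D P}).minimalPrimes := by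
    rw [branches, (irreducible_disc_and_hypersurfaceIdeal_eq hp hq).2, Ideal.map_span,
      Set.image_singleton]
    congr 1
    exact Ideal.span_singleton_eq_span_singleton.mpr hassoc
  have hbij := bijOn_minimalPrimes s D hprime hne
  rw [← hbr, hs, hfin.coe_toFinset] at hbij
  refine ⟨?_, D, hbij, ?_, hD⟩
  · rw [← hbij.image_eq, hbij.injOn.encard_image, hcard]
  · rwa [finprod_mem_eq_finite_toFinset_prod _ hfin]

end Branches

end CurvesPQ

end

theorem proposition1p5 {K : Type*} [Field K] [IsAlgClosed K] [CharZero K] (p q : ℕ)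
    (hp : 1 < p) (hpq : p < q) (hcop : Nat.Coprime p q) :
    -- The monomials `ξ^α η^β` form a basis of `N`, and `Δ = det M` for this basis.
    (∃ b : Module.Basis (CurvesPQ.BasisIdx p q) (CurvesPQ.CoeffRing K p q)
        (CurvesPQ.CritAlg K p q),
      (∀ i, b i = Ideal.Quotient.mk _ (CurvesPQ.basisMonomial K p q i)) ∧
      CurvesPQ.disc K p q = (CurvesPQ.relationMatrix K p q b).det) ∧
    -- `Δ` is irreducible, and it defines `ℋ`.
    Irreducible (CurvesPQ.disc K p q) ∧
    CurvesPQ.hypersurfaceIdeal K p q = Ideal.span {CurvesPQ.disc K p q} ∧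
    -- `ℋ^1_{pq}` is the set of regular points of `ℋ_{pq}`.
    CurvesPQ.exactLocus K p q 1 =
      {x ∈ CurvesPQ.nodalLocus K p q | IsRegularLocalRing (CurvesPQ.LocalRingAt K p q x)} ∧
    ∀ l : ℕ, 1 ≤ l → ∀ a : CurvesPQ.Idx p q → K,
      -- The closed points of `ℋ^l_{pq}` are the curves with exactly `l` nodes as singularities.
      (CurvesPQ.closedPoint K p q a ∈ CurvesPQ.exactLocus K p q l ↔
        CurvesPQ.singularPoints (CurvesPQ.curvePoly a) = CurvesPQ.nodes (CurvesPQ.curvePoly a) ∧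
        (CurvesPQ.nodes (CurvesPQ.curvePoly a)).encard = l) ∧
      -- At such a point `ℋ` has `l` regular branches, one for each node, with the given tangents.
      (CurvesPQ.closedPoint K p q a ∈ CurvesPQ.exactLocus K p q l →
        (CurvesPQ.branches a).encard = l ∧
        ∃ D : (Fin 2 → K) → CurvesPQ.CompletedRing K p q,
          Set.BijOn (fun P => Ideal.span {D P}) (CurvesPQ.nodes (CurvesPQ.curvePoly a))
            (CurvesPQ.branches a) ∧
          Associated (CurvesPQ.toCompletion a (CurvesPQ.disc K p q))
            (∏ᶠ P ∈ CurvesPQ.nodes (CurvesPQ.curvePoly a), D P) ∧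
          ∀ P ∈ CurvesPQ.nodes (CurvesPQ.curvePoly a),
            IsRegularLocalRing (CurvesPQ.CompletedRing K p q ⧸ Ideal.span {D P}) ∧
            MvPowerSeries.order (D P) = 1 ∧
            (∃ c : K, c ≠ 0 ∧ MvPowerSeries.homogeneousComponent 1 (D P) =
              MvPowerSeries.C c * CurvesPQ.nodeForm p q P) ∧
            CurvesPQ.tangentSpace (Ideal.span {D P}) =
              {t | ∑ i, P 0 ^ i.1.1 * P 1 ^ i.1.2 * t i = 0}) := by
  have hq : 1 < q := hp.trans hpq
  obtain ⟨hirr, hideal⟩ := CurvesPQ.irreducible_disc_and_hypersurfaceIdeal_eq (K := K) hp hq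
  refine ⟨CurvesPQ.exists_basis_critAlg K hp hq, hirr, hideal, CurvesPQ.exactLocus_one_eq hp hq,
    fun l hl a => ⟨CurvesPQ.closedPoint_mem_exactLocus_iff hp hq hl a, fun ha => ?_⟩⟩
  obtain ⟨hcard, D, hbij, hassoc, hD⟩ := CurvesPQ.exists_branches hp hq hl a ha
  exact ⟨hcard, D, hbij, hassoc, fun P hP =>
    ⟨CurvesPQ.isRegularLocalRing_quotient_criticalValue (hD P hP) hp hq,
      CurvesPQ.order_criticalValue (hD P hP) hp hq,
      -- The critical value is normalized: its leading form is the form of the node itself, so the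
      -- constant is `1`.
      ⟨1, one_ne_zero, by
        rw [CurvesPQ.homogeneousComponent_criticalValue (hD P hP), map_one, one_mul]⟩,
      CurvesPQ.tangentSpace_criticalValue (hD P hP)⟩⟩
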